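/- Let $(M,g)$ be a smooth 6-dimensional Riemannian manifold with an $SU(3)$-structure $(g,J,\Psi)$, i.e. a $g$-orthogonal almost complex structure $J$ and a smooth complex 3-form $\Psi=\Psi^++\sqrt{-1}\,\Psi^-$ such that each tangent space has an orthonormal basis $e_1,\dots,e_6$ with $Je_1=e_2$, $Je_3=e_4$, $Je_5=e_6$ and $\Psi=-(e_1+\sqrt{-1}e_2)\wedge(e_3+\sqrt{-1}e_4)\wedge(e_5+\sqrt{-1}e_6)$ (vectors and 1-forms are identified by $g$). Suppose that $(M,g,J,\Psi)$ is an almost Calabi–Yau manifold with torsion (ACYT): there is a linear connection $\nabla$ (the torsion connection) with $\nabla g=\nabla J=\nabla\Psi=0$ whose torsion $T(X,Y,Z)=g(\nabla_XY-\nabla_YX-[X,Y],Z)$ is totally skew-symmetric. Let $\nabla^g$ be the Levi-Civita connection, $Scal^g$ its scalar curvature, $F(X,Y)=g(X,JY)$ the Kähler form, $N(X,Y,Z)=g([JX,JY]-[X,Y]-J[JX,Y]-J[X,JY],Z)$ the Nijenhuis tensor, $\theta(X)=\delta F(JX)$ the Lee form, where $\delta F(Y)=-\sum_i(\nabla^g_{e_i}F)(e_i,Y)$,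 and $(J\theta)(X)=-\theta(JX)$. Let $dF^+$ be the $(2,1)+(1,2)$-part of $dF$ with respect to $J$, and put $\|A\|^2=\sum_{i,j,k}A(e_i,e_j,e_k)^2$ for a 3-form $A$ and an orthonormal basis $(e_i)$. Assume that the curvature $R$ of $\nabla$ lies in $S^2\Lambda^2$, i.e. $R(X,Y,Z,V)=R(Z,V,X,Y)$, where $R(X,Y,Z,V)=g([\nabla_X,\nabla_Y]Z-\nabla_{[X,Y]}Z,V)$. Then $$(\nabla_XJ\theta)Y+(\nabla_YJ\theta)X=0,\qquad\text{equivalently}\qquad(\nabla_X\theta)JY=-(\nabla_Y\theta)JX,$$ and the vector field dual to $J\theta$ is a Killing vector field. Moreover: a) If $\|N\|^2$ is constant, then $\nabla N=0$ and $(\nabla_X\theta)Y=(\nabla_Y\theta)X=(\nabla_{JX}\theta)JY$. b) If $\theta=0$, then $\nabla T=\nabla dF=\nabla N=0$ and $$Scal^g=-\tfrac1{12}\|dF^+\|^2+\tfrac5{64}\|N\|^2,$$ and $Scal^g$ is constant on each connected component of $M$. -/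

import Mathlib

open Bundle Manifold
open scoped ContDiff

namespace ACYT

noncomputable section

section Connections

variable {E : Type*} [NormedAddCommGroup E] [NormedSpace ℝ E]
  {H : Type*} [TopologicalSpace H] {I : ModelWithCorners ℝ E H}
  {M : Type*} [TopologicalSpace M] [ChartedSpace H M] [IsManifold I ∞ M]

/-- The value at `x` and on the tangent vectors `v 0, …, v (k-1)` of the covariant derivative
`∇_u A` of a covariant `k`-tensor field `A` (with values in `V`):
`(∇_u A)(Y₀, …) = u (A(Y₀, …)) - ∑ᵢ A(…, ∇_u Yᵢ, …)`.
The vectors `v i` are extended to vector fields that are smooth near `x`. -/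
def covDeriv {V : Type*} [NormedAddCommGroup V] [NormedSpace ℝ V]
    (nabla : CovariantDerivative I E (fun x : M => TangentSpace I x)) {k : ℕ}
    (A : ∀ x : M, (Fin k → TangentSpace I x) → V) (x : M)
    (u : TangentSpace I x) (v : Fin k → TangentSpace I x) : V :=
  mvfderiv I (fun y : M => A y (fun i => FiberBundle.extend E (v i) y)) x u
    - ∑ i, A x (Function.update v i (nabla (FiberBundle.extend E (v i)) x u))

/-- The tensor field `A` is parallel, `∇ A = 0`. -/
def IsParallel {V : Type*} [NormedAddCommGroup V] [NormedSpace ℝ V]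
    (nabla : CovariantDerivative I E (fun x : M => TangentSpace I x)) {k : ℕ}
    (A : ∀ x : M, (Fin k → TangentSpace I x) → V) : Prop :=
  ∀ (x : M) (u : TangentSpace I x) (v : Fin k → TangentSpace I x), covDeriv nabla A x u v = 0

/-- The curvature `R(u, v) w = ∇_u ∇_v w - ∇_v ∇_u w - ∇_{[u, v]} w` at the point `x`. -/
def curvature (nabla : CovariantDerivative I E (fun x : M => TangentSpace I x)) (x : M)
    (u v w : TangentSpace I x) : TangentSpace I x :=
  nabla (fun y => nabla (FiberBundle.extend E w) y (FiberBundle.extend E v y)) x u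
    - nabla (fun y => nabla (FiberBundle.extend E w) y (FiberBundle.extend E u y)) x v
    - nabla (FiberBundle.extend E w) x
        (VectorField.mlieBracket I (FiberBundle.extend E u) (FiberBundle.extend E v) x)

/-- The exterior derivative of a 2-form,
`dα(X,Y,Z) = X α(Y,Z) + Y α(Z,X) + Z α(X,Y) - α([X,Y],Z) - α([Y,Z],X) - α([Z,X],Y)`. -/
def extDerivTwo (α : ∀ x : M, (Fin 2 → TangentSpace I x) → ℝ) (x : M)
    (v : Fin 3 → TangentSpace I x) : ℝ :=
  let X : Fin 3 → ∀ y : M, TangentSpace I y := fun i => FiberBundle.extend E (v i)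
  let br : Fin 3 → Fin 3 → TangentSpace I x :=
    fun i j => VectorField.mlieBracket I (X i) (X j) x
  mvfderiv I (fun y : M => α y ![X 1 y, X 2 y]) x (v 0)
    + mvfderiv I (fun y : M => α y ![X 2 y, X 0 y]) x (v 1)
    + mvfderiv I (fun y : M => α y ![X 0 y, X 1 y]) x (v 2)
    - α x ![br 0 1, v 2] - α x ![br 1 2, v 0] - α x ![br 2 0, v 1]

/-- The Nijenhuis tensor `N(X,Y) = [JX,JY] - [X,Y] - J[JX,Y] - J[X,JY]` of an almost complex
structure, as a `(1,2)`-tensor. -/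
def nijenhuis (J : ∀ x : M, TangentSpace I x →L[ℝ] TangentSpace I x) (x : M)
    (u v : TangentSpace I x) : TangentSpace I x :=
  let X : ∀ y : M, TangentSpace I y := FiberBundle.extend E u
  let Y : ∀ y : M, TangentSpace I y := FiberBundle.extend E v
  let JX : ∀ y : M, TangentSpace I y := fun y => J y (X y)
  let JY : ∀ y : M, TangentSpace I y := fun y => J y (Y y)
  VectorField.mlieBracket I JX JY x - VectorField.mlieBracket I X Y x
    - J x (VectorField.mlieBracket I JX Y x) - J x (VectorField.mlieBracket I X JY x)

end Connections

section Riemannian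

variable {E : Type*} [NormedAddCommGroup E] [NormedSpace ℝ E] [FiniteDimensional ℝ E]
  {H : Type*} [TopologicalSpace H] {I : ModelWithCorners ℝ E H}
  {M : Type*} [TopologicalSpace M] [ChartedSpace H M] [IsManifold I ∞ M]
  [RiemannianBundle (fun x : M => TangentSpace I x)]

/-- An orthonormal basis of the tangent space at `x`, used only to form metric traces. -/
def frame (x : M) :
    OrthonormalBasis (Fin (Module.finrank ℝ (TangentSpace I x))) ℝ (TangentSpace I x) :=
  haveI : FiniteDimensional ℝ (TangentSpace I x) := inferInstanceAs (FiniteDimensional ℝ E)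
  stdOrthonormalBasis ℝ (TangentSpace I x)

/-- The squared norm `‖A‖² = ∑_{i,j,k} A(eᵢ,eⱼ,eₖ)²` of a covariant 3-tensor. -/
def normSq (A : ∀ x : M, (Fin 3 → TangentSpace I x) → ℝ) (x : M) : ℝ :=
  ∑ i, ∑ j, ∑ k, A x ![frame x i, frame x j, frame x k] ^ 2

/-- The scalar curvature `∑_{i,j} g(R(eᵢ,eⱼ)eⱼ,eᵢ)` of a connection. -/
def scalarCurvature (nabla : CovariantDerivative I E (fun x : M => TangentSpace I x)) (x : M) : ℝ :=
  ∑ i, ∑ j, inner ℝ (curvature nabla x (frame x i) (frame x j) (frame x j)) (frame x i)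

/-- The curvature lies in `S²Λ²`: `R(X,Y,Z,V) = R(Z,V,X,Y)` where `R(X,Y,Z,V) = g(R(X,Y)Z,V)`. -/
def CurvaturePairSymmetric
    (nabla : CovariantDerivative I E (fun x : M => TangentSpace I x)) : Prop :=
  ∀ (x : M) (X Y Z V : TangentSpace I x),
    inner ℝ (curvature nabla x X Y Z) V = inner ℝ (curvature nabla x Z V X) Y

/-- The vector field dual to a 1-form `α`: `g(α♯, Y) = α(Y)`. -/
def sharp (α : ∀ x : M, (Fin 1 → TangentSpace I x) → ℝ) (x : M) : TangentSpace I x :=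
  ∑ i, α x ![frame x i] • frame x i

/-- A Killing vector field: a smooth vector field `ξ` with `L_ξ g = 0`, i.e.
`ξ g(Y,Z) = g([ξ,Y],Z) + g(Y,[ξ,Z])`. -/
def IsKilling (ξ : ∀ x : M, TangentSpace I x) : Prop :=
  ContMDiff I I.tangent ∞ (fun x => (⟨x, ξ x⟩ : TangentBundle I M)) ∧
  ∀ (x : M) (Y Z : ∀ x : M, TangentSpace I x),
    ContMDiffAt I I.tangent ∞ (fun y => (⟨y, Y y⟩ : TangentBundle I M)) x →
    ContMDiffAt I I.tangent ∞ (fun y => (⟨y, Z y⟩ : TangentBundle I M)) x →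
    mvfderiv I (fun y : M => inner ℝ (Y y) (Z y)) x (ξ x)
      = inner ℝ (VectorField.mlieBracket I ξ Y x) (Z x)
        + inner ℝ (Y x) (VectorField.mlieBracket I ξ Z x)

/-- The connection is metric, `∇g = 0`, i.e. `u g(Y,Z) = g(∇_u Y,Z) + g(Y,∇_u Z)`. -/
def IsMetric (nabla : CovariantDerivative I E (fun x : M => TangentSpace I x)) : Prop :=
  ∀ (x : M) (u : TangentSpace I x) (Y Z : ∀ x : M, TangentSpace I x),
    MDifferentiableAt I I.tangent (fun y => (⟨y, Y y⟩ : TangentBundle I M)) x →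
    MDifferentiableAt I I.tangent (fun y => (⟨y, Z y⟩ : TangentBundle I M)) x →
    mvfderiv I (fun y : M => inner ℝ (Y y) (Z y)) x u
      = inner ℝ (nabla Y x u) (Z x) + inner ℝ (Y x) (nabla Z x u)

/-- The codifferential of a 2-form, `δα(Y) = -∑ᵢ (∇^g_{eᵢ} α)(eᵢ, Y)`, where `D = ∇^g` is the
Levi-Civita connection. -/
def codiffTwo (D : CovariantDerivative I E (fun x : M => TangentSpace I x))
    (α : ∀ x : M, (Fin 2 → TangentSpace I x) → ℝ) (x : M) (v : Fin 1 → TangentSpace I x) : ℝ :=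
  -∑ i, covDeriv D α x (frame x i) ![frame x i, v 0]

/-- `D` is the Levi-Civita connection: metric and torsion free. -/
structure IsLeviCivita (D : CovariantDerivative I E (fun x : M => TangentSpace I x)) : Prop where
  metric : IsMetric D
  torsion_free : D.torsion = 0

/-- The torsion of a connection as a `(0,3)`-tensor, `T(X,Y,Z) = g(T(X,Y),Z)`. -/
def torsionTensor (nabla : CovariantDerivative I E (fun x : M => TangentSpace I x)) (x : M)
    (v : Fin 3 → TangentSpace I x) : ℝ :=
  inner ℝ (nabla.torsion x (v 0) (v 1)) (v 2)

end Riemannian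

/-- An `SU(3)`-structure `(g, J, Ψ)` on a Riemannian 6-manifold `(M, g)`: an orthogonal almost
complex structure `J` and a complex 3-form `Ψ = Ψ⁺ + iΨ⁻` such that every tangent space has an
orthonormal basis `e₁, …, e₆` with `Je₁ = e₂`, `Je₃ = e₄`, `Je₅ = e₆` (so that
`F = g(·, J·) = -e₁₂ - e₃₄ - e₅₆`) in which
`Ψ = -(e₁ + i e₂) ∧ (e₃ + i e₄) ∧ (e₅ + i e₆)`. -/
structure SU3Structure (M : Type*) [TopologicalSpace M]
    [ChartedSpace (EuclideanSpace ℝ (Fin 6)) M] [IsManifold (𝓡 6) ∞ M]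
    [RiemannianBundle (fun x : M => TangentSpace (𝓡 6) x)] where
  /-- The almost complex structure. -/
  J : ∀ x : M, TangentSpace (𝓡 6) x →L[ℝ] TangentSpace (𝓡 6) x
  contMDiff_J : ContMDiff (𝓡 6)
    ((𝓡 6).prod 𝓘(ℝ, EuclideanSpace ℝ (Fin 6) →L[ℝ] EuclideanSpace ℝ (Fin 6))) ∞
    (fun x => TotalSpace.mk' (EuclideanSpace ℝ (Fin 6) →L[ℝ] EuclideanSpace ℝ (Fin 6))
      (E := fun x : M => TangentSpace (𝓡 6) x →L[ℝ] TangentSpace (𝓡 6) x) x (J x))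
  J_J : ∀ (x : M) (v : TangentSpace (𝓡 6) x), J x (J x v) = -v
  inner_J_J : ∀ (x : M) (v w : TangentSpace (𝓡 6) x), inner ℝ (J x v) (J x w) = inner ℝ v w
  /-- The complex volume form. -/
  Ψ : ∀ x : M, TangentSpace (𝓡 6) x [⋀^Fin 3]→L[ℝ] ℂ
  contMDiff_Ψ : ∀ (x : M) (X : Fin 3 → ∀ y : M, TangentSpace (𝓡 6) y),
    (∀ i, ContMDiffAt (𝓡 6) (𝓡 6).tangent ∞
      (fun y => (⟨y, X i y⟩ : TangentBundle (𝓡 6) M)) x) →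
    ContMDiffAt (𝓡 6) 𝓘(ℝ, ℂ) ∞ (fun y => Ψ y (fun i => X i y)) x
  exists_adapted : ∀ x : M, ∃ e : OrthonormalBasis (Fin 6) ℝ (TangentSpace (𝓡 6) x),
    J x (e 0) = e 1 ∧ J x (e 2) = e 3 ∧ J x (e 4) = e 5 ∧
    ∀ v : Fin 3 → TangentSpace (𝓡 6) x,
      Ψ x v = -(Matrix.of fun a b : Fin 3 =>
        ((inner ℝ (![e 0, e 2, e 4] a) (v b) : ℝ) : ℂ)
          + Complex.I * ((inner ℝ (![e 1, e 3, e 5] a) (v b) : ℝ) : ℂ)).det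

namespace SU3Structure

variable {M : Type*} [TopologicalSpace M]
  [ChartedSpace (EuclideanSpace ℝ (Fin 6)) M] [IsManifold (𝓡 6) ∞ M]
  [RiemannianBundle (fun x : M => TangentSpace (𝓡 6) x)]
  (S : SU3Structure M)

/-- The Kähler form `F(X,Y) = g(X,JY)`. -/
def F (x : M) (v : Fin 2 → TangentSpace (𝓡 6) x) : ℝ := inner ℝ (v 0) (S.J x (v 1))

/-- The exterior derivative `dF` of the Kähler form. -/
def dF : ∀ x : M, (Fin 3 → TangentSpace (𝓡 6) x) → ℝ := extDerivTwo S.F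

/-- The `(1,2)+(2,1)`-part of `dF`: the projection
`α ↦ ¼ (3α + α(J·,J·,·) + α(J·,·,J·) + α(·,J·,J·))`, which kills the forms of type
`(3,0)+(0,3)` and fixes those of type `(2,1)+(1,2)`. -/
def dFPlus (x : M) (v : Fin 3 → TangentSpace (𝓡 6) x) : ℝ :=
  (1 / 4) * (3 * S.dF x v
    + S.dF x ![S.J x (v 0), S.J x (v 1), v 2]
    + S.dF x ![S.J x (v 0), v 1, S.J x (v 2)]
    + S.dF x ![v 0, S.J x (v 1), S.J x (v 2)])

/-- The Nijenhuis tensor as a `(0,3)`-tensor, `N(X,Y,Z) = g(N(X,Y),Z)`. -/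
def N (x : M) (v : Fin 3 → TangentSpace (𝓡 6) x) : ℝ :=
  inner ℝ (nijenhuis S.J x (v 0) (v 1)) (v 2)

/-- The Lee form `θ(X) = δF(JX)`. The connection `D` is the Levi-Civita connection. -/
def leeForm (D : CovariantDerivative (𝓡 6) (EuclideanSpace ℝ (Fin 6))
    (fun x : M => TangentSpace (𝓡 6) x)) (x : M) (v : Fin 1 → TangentSpace (𝓡 6) x) : ℝ :=
  codiffTwo D S.F x ![S.J x (v 0)]

/-- The 1-form `Jθ(X) = -θ(JX)`. -/
def JLeeForm (D : CovariantDerivative (𝓡 6) (EuclideanSpace ℝ (Fin 6))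
    (fun x : M => TangentSpace (𝓡 6) x)) (x : M) (v : Fin 1 → TangentSpace (𝓡 6) x) : ℝ :=
  -S.leeForm D x ![S.J x (v 0)]

/-- `∇` is the torsion connection of the `SU(3)`-structure and `(M, g, J, Ψ)` is an almost
Calabi-Yau manifold with torsion: `∇` is a smooth connection with totally skew-symmetric torsion
and `∇g = ∇J = ∇Ψ = 0`. -/
structure IsACYT
    (nabla : CovariantDerivative (𝓡 6) (EuclideanSpace ℝ (Fin 6))
      (fun x : M => TangentSpace (𝓡 6) x)) : Prop where
  smooth : nabla.ContMDiffCovariantDerivative ∞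
  skew_torsion : ∀ (x : M) (X Y Z : TangentSpace (𝓡 6) x),
    torsionTensor nabla x ![X, Y, Z] = -torsionTensor nabla x ![X, Z, Y]
  parallel_metric : IsMetric nabla
  parallel_J : ∀ (x : M) (u : TangentSpace (𝓡 6) x) (Y : ∀ y : M, TangentSpace (𝓡 6) y),
    MDifferentiableAt (𝓡 6) (𝓡 6).tangent (fun y => (⟨y, Y y⟩ : TangentBundle (𝓡 6) M)) x →
    nabla (fun y => S.J y (Y y)) x u = S.J x (nabla Y x u)
  parallel_Ψ : IsParallel nabla (fun x v => S.Ψ x v)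

end SU3Structure

end

end ACYT

/-! Everything is governed by the torsion `T` of `∇`. Because `∇g = ∇J = 0`, the Lie brackets in `N`
and `dF` can be rewritten with `∇` and all derivative terms drop out. So `N` is four times the
(3,0)+(0,3)-part of `T` (`N_eq`), `dF` is a sum of copies of `T` with one argument rotated by `J`
(`dF_eq`), and `Jθ` is `-1/2` times the trace `Σ T(·, eᵢ, Jeᵢ)` (`JLeeForm_eq`). Since `J` is
parallel, the same formulas express `∇N`, `∇dF` and `∇Jθ` through `∇T`.

The pair symmetry of `R`, fed into the first Bianchi identity, forces `∇T` to be alternating in all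
four arguments (`isFourForm_covDeriv_torsionTensor`). Hence `∇Jθ`, up to sign the contraction of a
4-form with a 2-form, is skew. For a metric connection with skew torsion the torsion terms cancel in
`L_ξ g`, so the dual field is Killing (`isKilling_sharp`).

Case a). The forms of type (3,0)+(0,3) at a point make a complex line. Constancy of `‖N‖²` makes
`∇_u N` orthogonal to `N` for every `u`. A 4-form in complex dimension three has no (4,0)-part,
which yields `∇_{Ju} N = -(∇_u N)(J·,·,·)` (`fourForm_proj_J`). Replacing `u` by `Ju` therefore
gives orthogonality to the other real direction of the line, and `∇N = 0` (`eq_zero_of_orthogonal`;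
the case `N = 0` is trivial). Then `∇N = 0` makes `∇Jθ` a form of type (1,1), and the symmetries of
`∇θ` follow by moving `J`.

Case b). Contraction with `F` is injective on 4-forms in complex dimension three
(`fourForm_eq_zero_of_contraction`), so `θ = 0` gives `∇T = 0`. Parallelism of `Ψ` kills the Ricci
form, and tracing the Bianchi identity gives `Scal = -q` for `∇`, where `q = Σ T(a,b,c) T(Ja,Jb,c)`
(`sum_curvature`). Passing to `∇^g = ∇ - T/2` adds `t/4`, where `t = ‖T‖²`. The identities `‖N‖² =
4t - 12q` and `‖dF⁺‖² = (3/4)(t + q)` turn `t/4 - q` into the stated formula, and parallel tensors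
have locally constant norm. -/

open Bundle Manifold
open scoped ContDiff Topology

set_option linter.unusedSectionVars false

namespace ACYT

noncomputable section

/-! ### Functions and vector fields smooth near a point. -/

section SmoothNear

variable {E : Type*} [NormedAddCommGroup E] [NormedSpace ℝ E]
  {H : Type*} [TopologicalSpace H] {I : ModelWithCorners ℝ E H}
  {M : Type*} [TopologicalSpace M] [ChartedSpace H M]

/-- The real function `f` is smooth on a neighbourhood of `x`. -/
def FunSmoothNear (I : ModelWithCorners ℝ E H) (f : M → ℝ) (x : M) : Prop :=
  ∀ᶠ y in 𝓝 x, ContMDiffAt I 𝓘(ℝ, ℝ) ∞ f y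

variable {f g : M → ℝ} {x : M}

namespace FunSmoothNear

lemma contMDiffAt (h : FunSmoothNear I f x) : ContMDiffAt I 𝓘(ℝ, ℝ) ∞ f x := h.self_of_nhds

lemma mdifferentiableAt (h : FunSmoothNear I f x) : MDifferentiableAt I 𝓘(ℝ, ℝ) f x :=
  h.contMDiffAt.mdifferentiableAt (by simp)

lemma eventually (h : FunSmoothNear I f x) : ∀ᶠ y in 𝓝 x, FunSmoothNear I f y :=
  eventually_eventually_nhds.2 h

lemma congr (h : FunSmoothNear I f x) (hfg : g =ᶠ[𝓝 x] f) : FunSmoothNear I g x := by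
  filter_upwards [h, hfg.eventuallyEq_nhds] with y h1 h2 using h1.congr_of_eventuallyEq h2

lemma const (c : ℝ) : FunSmoothNear I (fun _ : M => c) x :=
  Filter.Eventually.of_forall fun _ => contMDiffAt_const

lemma add (hf : FunSmoothNear I f x) (hg : FunSmoothNear I g x) :
    FunSmoothNear I (fun y => f y + g y) x := by
  filter_upwards [hf, hg] with y h1 h2 using h1.add h2

lemma mul (hf : FunSmoothNear I f x) (hg : FunSmoothNear I g x) :
    FunSmoothNear I (fun y => f y * g y) x := by
  filter_upwards [hf, hg] with y h1 h2
  exact h1.smul h2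

lemma sum {ι : Type*} {s : Finset ι} {f : ι → M → ℝ} (h : ∀ i ∈ s, FunSmoothNear I (f i) x) :
    FunSmoothNear I (fun y => ∑ i ∈ s, f i y) x := by
  have : ∀ᶠ y in 𝓝 x, ∀ i ∈ s, ContMDiffAt I 𝓘(ℝ, ℝ) ∞ (f i) y :=
    (Filter.eventually_all_finset s).2 h
  filter_upwards [this] with y hy
  exact contMDiffAt_finsetSum hy

end FunSmoothNear

variable [IsManifold I ∞ M] {X Y : ∀ y : M, TangentSpace I y}

/-- The vector field `X` is smooth on a neighbourhood of `x`. -/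
def SmoothNear (X : ∀ y : M, TangentSpace I y) (x : M) : Prop :=
  ∀ᶠ y in 𝓝 x, ContMDiffAt I I.tangent ∞ (fun z => (⟨z, X z⟩ : TangentBundle I M)) y

namespace SmoothNear

lemma contMDiffAt (h : SmoothNear X x) :
    ContMDiffAt I I.tangent ∞ (fun z => (⟨z, X z⟩ : TangentBundle I M)) x := h.self_of_nhds

lemma mdifferentiableAt (h : SmoothNear X x) :
    MDifferentiableAt I I.tangent (fun z => (⟨z, X z⟩ : TangentBundle I M)) x :=
  h.contMDiffAt.mdifferentiableAt (by simp)

lemma eventually (h : SmoothNear X x) : ∀ᶠ y in 𝓝 x, SmoothNear X y :=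
  eventually_eventually_nhds.2 h

lemma congr (h : SmoothNear X x) (hXY : ∀ᶠ y in 𝓝 x, Y y = X y) : SmoothNear Y x := by
  filter_upwards [h, eventually_eventually_nhds.2 hXY] with y h1 h2
  refine h1.congr_of_eventuallyEq ?_
  filter_upwards [h2] with z hz
  rw [hz]

lemma extend (v : TangentSpace I x) : SmoothNear (I := I) (FiberBundle.extend E v) x := by
  obtain ⟨s, hs, h⟩ := FiberBundle.exists_contMDiffOn_extend (k := ∞) I E v
  filter_upwards [eventually_mem_nhds_iff.2 hs] with y hy
  exact h.contMDiffAt hy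

lemma add (hX : SmoothNear X x) (hY : SmoothNear Y x) : SmoothNear (X + Y) x := by
  filter_upwards [hX, hY] with y h1 h2 using h1.add_section h2

lemma sub (hX : SmoothNear X x) (hY : SmoothNear Y x) : SmoothNear (X - Y) x := by
  filter_upwards [hX, hY] with y h1 h2 using h1.sub_section h2

lemma smul (hf : FunSmoothNear I f x) (hX : SmoothNear X x) : SmoothNear (f • X) x := by
  filter_upwards [hf, hX] with y h1 h2 using h1.smul_section h2

lemma sum {ι : Type*} {s : Finset ι} {X : ι → ∀ y : M, TangentSpace I y}
    (h : ∀ i ∈ s, SmoothNear (X i) x) : SmoothNear (fun y => ∑ i ∈ s, X i y) x := by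
  have : ∀ᶠ y in 𝓝 x, ∀ i ∈ s, ContMDiffAt I I.tangent ∞
      (fun z => (⟨z, X i z⟩ : TangentBundle I M)) y := (Filter.eventually_all_finset s).2 h
  filter_upwards [this] with y hy
  exact ContMDiffAt.sum_section hy

lemma mlieBracket [CompleteSpace E] (hX : SmoothNear X x) (hY : SmoothNear Y x) :
    SmoothNear (VectorField.mlieBracket I X Y) x := by
  have : IsManifold I (((⊤ : ℕ∞) : WithTop ℕ∞) + 1) M :=
    inferInstanceAs (IsManifold I ∞ M)
  have : IsManifold I (minSmoothness ℝ 2) M := by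
    rw [minSmoothness_of_isRCLikeNormedField]
    infer_instance
  filter_upwards [hX, hY] with y h1 h2
  exact ContMDiffAt.mlieBracket_vectorField (m := ⊤) (n := ⊤) h1 h2 (by simp)

lemma inner [RiemannianBundle (fun x : M => TangentSpace I x)]
    [IsContMDiffRiemannianBundle I ∞ E (fun x : M => TangentSpace I x)]
    (hX : SmoothNear X x) (hY : SmoothNear Y x) :
    FunSmoothNear I (fun y => inner ℝ (X y) (Y y)) x := by
  filter_upwards [hX, hY] with y h1 h2
  exact ContMDiffAt.inner_bundle (F := E) h1 h2

lemma clm {J : ∀ y : M, TangentSpace I y →L[ℝ] TangentSpace I y}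
    (hJ : ContMDiff I (I.prod 𝓘(ℝ, E →L[ℝ] E)) ∞ (fun y => TotalSpace.mk' (E →L[ℝ] E)
      (E := fun x : M => TangentSpace I x →L[ℝ] TangentSpace I x) y (J y)))
    (hX : SmoothNear X x) : SmoothNear (fun y => J y (X y)) x := by
  filter_upwards [hX] with y h1
  exact ContMDiffAt.clm_bundle_apply (hJ y) h1

/-- The smoothness of a connection is applied to a globally smooth field. A bump function supported
where `Y` is smooth, and equal to one near `x`, makes `Y` such a field, and `∇` depends only on
germs. -/
lemma nabla [FiniteDimensional ℝ E] [T2Space M]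
    {nabla : CovariantDerivative I E (fun x : M => TangentSpace I x)}
    (h : nabla.ContMDiffCovariantDerivative ∞)
    (hX : SmoothNear X x) (hY : SmoothNear Y x) : SmoothNear (fun y => nabla Y y (X y)) x := by
  obtain ⟨ψ, -, hψ⟩ := (SmoothBumpFunction.nhds_basis_tsupport (I := I) x).mem_iff.1 (interior_mem_nhds.2 hY)
  have hs : ContMDiff I I.tangent ∞
      (fun z => (⟨z, ((ψ : M → ℝ) • Y) z⟩ : TangentBundle I M)) := by
    exact ContMDiffOn.smul_section_of_tsupport (F := E) ψ.contMDiff.contMDiffOn isOpen_interior hψ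
      fun y hy => ContMDiffAt.contMDiffWithinAt (interior_subset hy)
  have h2 := h.contMDiff.contMDiff (σ := (ψ : M → ℝ) • Y) hs.contMDiffOn
  filter_upwards [hX, hY.eventually, ψ.eventuallyEq_one.eventuallyEq_nhds] with y h3 h4 h5
  have h6 := ContMDiffAt.clm_bundle_apply (h2.contMDiffAt Filter.univ_mem) h3
  refine h6.congr_of_eventuallyEq ?_
  filter_upwards [h4.eventually, h5.eventuallyEq_nhds] with z h7 h8
  congr 1
  refine DFunLike.congr_fun ?_ (X z)
  refine (nabla.isCovariantDerivativeOn (s := Set.univ)).congr_of_eventuallyEq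
    h7.mdifferentiableAt (hs z |>.mdifferentiableAt (by simp)) Filter.univ_mem ?_
  filter_upwards [h8] with w hw
  simp [hw]

end SmoothNear
end SmoothNear

/-! ### The Leibniz rule for covariant tensor fields. -/

section HasCovDerivAt

variable {E : Type*} [NormedAddCommGroup E] [NormedSpace ℝ E]
  {H : Type*} [TopologicalSpace H] {I : ModelWithCorners ℝ E H}
  {M : Type*} [TopologicalSpace M] [ChartedSpace H M]

lemma update_section {k : ℕ} (X : Fin k → ∀ y : M, TangentSpace I y) (i : Fin k)
    (σ : ∀ y, TangentSpace I y) (y : M) :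
    (fun j => Function.update X i σ j y) = Function.update (fun j => X j y) i (σ y) := by
  ext1 j
  by_cases h : j = i
  · subst h; simp
  · simp [h]

variable [IsManifold I ∞ M]

namespace SmoothTensorial

variable {W : Type*} [AddCommGroup W] [Module ℝ W]

/-- An operation on vector fields that is additive and linear over smooth functions, as far as
vector fields smooth near `x` are concerned, depends only on the value of the field at `x`. -/
lemma pointwise [FiniteDimensional ℝ E] {Φ : (∀ y : M, TangentSpace I y) → W} {x : M}
    (hadd : ∀ X Y : ∀ y : M, TangentSpace I y, SmoothNear X x → SmoothNear Y x →
      Φ (X + Y) = Φ X + Φ Y)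
    (hsmul : ∀ (f : M → ℝ) (X : ∀ y : M, TangentSpace I y), FunSmoothNear I f x →
      SmoothNear X x → Φ (f • X) = f x • Φ X)
    {X Y : ∀ y : M, TangentSpace I y} (hX : SmoothNear X x) (hY : SmoothNear Y x)
    (hXY : X x = Y x) : Φ X = Φ Y := by
  classical
  have hloc : ∀ {X Y : ∀ y : M, TangentSpace I y}, SmoothNear X x → SmoothNear Y x →
      (∀ᶠ y in 𝓝 x, X y = Y y) → Φ X = Φ Y := by
    intro X Y hX hY h
    -- The indicator of the coincidence set is equal to one near `x`, hence smooth there, and `ψ X =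
    -- ψ Y` holds everywhere. Locality follows from linearity over such functions.
    let ψ : M → ℝ := fun y => if X y = Y y then 1 else 0
    have hψ : FunSmoothNear I ψ x := (FunSmoothNear.const 1).congr (by
      filter_upwards [h] with y hy
      simp [ψ, hy])
    have hψx : ψ x = 1 := by simp [ψ, h.self_of_nhds]
    have h3 : ψ • X = ψ • Y := by
      ext1 y
      by_cases hy : X y = Y y <;> simp [ψ, hy]
    have h1 := hsmul ψ X hψ hX
    rw [h3, hsmul ψ Y hψ hY, hψx, one_smul, one_smul] at h1
    exact h1.symm
  have h0 : Φ 0 = 0 := by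
    have h := hadd 0 0
    have hz : SmoothNear (0 : ∀ y : M, TangentSpace I y) x := by
      have := (SmoothNear.extend (I := I) (0 : TangentSpace I x)).sub (SmoothNear.extend 0)
      simpa using this
    simpa using h hz hz
  have hsum : ∀ {ι : Type _} (s : Finset ι) (X : ι → ∀ y : M, TangentSpace I y),
      (∀ i, SmoothNear (X i) x) → Φ (fun y => ∑ i ∈ s, X i y) = ∑ i ∈ s, Φ (X i) := by
    intro ι s X hX
    induction s using Finset.induction_on with
    | empty => exact h0
    | insert a s ha ih =>
      rw [Finset.sum_insert ha, ← ih, ← hadd _ _ (hX a) (SmoothNear.sum fun i _ => hX i)]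
      congr 1
      ext1 y
      simp [Finset.sum_insert ha]
  -- Near `x` a field is a combination of a local frame with smooth coefficients, and only the
  -- values of the coefficients at `x` enter.
  let t := trivializationAt E (fun y : M => TangentSpace I y) x
  have hxt : x ∈ t.baseSet := FiberBundle.mem_baseSet_trivializationAt' x
  let b := Module.finBasis ℝ E
  have hs : ∀ i, SmoothNear (t.localFrame b i) x := fun i => by
    filter_upwards [t.open_baseSet.mem_nhds hxt] with y hy
    exact contMDiffAt_localFrame_of_mem ∞ t b i hy
  let c : (∀ y : M, TangentSpace I y) → Fin _ → M → ℝ :=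
    fun X i y => t.localFrameCoeff I b i y (X y)
  have hc : ∀ {X : ∀ y : M, TangentSpace I y}, SmoothNear X x → ∀ i, FunSmoothNear I (c X i) x := by
    intro X hX i
    filter_upwards [t.open_baseSet.mem_nhds hxt, hX] with y hy h
    exact _root_.contMDiffAt_localFrameCoeff b hy h i
  have hexp : ∀ {X : ∀ y : M, TangentSpace I y}, SmoothNear X x →
      Φ X = ∑ i, c X i x • Φ (t.localFrame b i) := by
    intro X hX
    have h1 : ∀ i, SmoothNear (c X i • t.localFrame b i) x := fun i => (hs i).smul (hc hX i)
    rw [hloc hX (SmoothNear.sum (s := Finset.univ) fun i _ => h1 i) ?_, hsum _ _ h1]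
    · exact Finset.sum_congr rfl fun i _ => hsmul _ _ (hc hX i) (hs i)
    · exact t.eventually_eq_localFrame_sum_coeff_smul b hxt
  rw [hexp hX, hexp hY]
  simp [c, hXY]

end SmoothTensorial

variable (nabla : CovariantDerivative I E (fun x : M => TangentSpace I x)) {k : ℕ}

/-- The covariant tensor field `A` satisfies the Leibniz rule at `x` in the direction `u` with
covariant derivative `A'`. -/
def HasCovDerivAt (A : ∀ x : M, (Fin k → TangentSpace I x) → ℝ) (x : M) (u : TangentSpace I x)
    (A' : (Fin k → TangentSpace I x) → ℝ) : Prop :=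
  ∀ X : Fin k → ∀ y : M, TangentSpace I y, (∀ i, SmoothNear (X i) x) →
    MDifferentiableAt I 𝓘(ℝ, ℝ) (fun y => A y (fun i => X i y)) x ∧
    mvfderiv I (fun y => A y (fun i => X i y)) x u = A' (fun i => X i x)
      + ∑ i, A x (Function.update (fun i => X i x) i (nabla (X i) x u))

/-- The field `L` of endomorphisms is smooth near `x` and parallel at `x`. -/
def IsParallelEnd (L : ∀ x : M, TangentSpace I x → TangentSpace I x) (x : M) : Prop :=
  ∀ X : ∀ y : M, TangentSpace I y, SmoothNear X x → SmoothNear (fun y => L y (X y)) x ∧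
    ∀ u, nabla (fun y => L y (X y)) x u = L x (nabla X x u)

variable {nabla} {A B : ∀ x : M, (Fin k → TangentSpace I x) → ℝ} {x : M} {u : TangentSpace I x}
  {A' B' : (Fin k → TangentSpace I x) → ℝ}

lemma IsParallelEnd.id : IsParallelEnd nabla (fun _ v => v) x := fun _ h => ⟨h, fun _ => rfl⟩

namespace HasCovDerivAt

/-- This turns structural rules (sums, permutations, composition with `J`, traces) into explicit
formulas for `covDeriv`, whose definition uses one particular extension of the vectors. -/
lemma covDeriv_eq (h : HasCovDerivAt nabla A x u A') (v : Fin k → TangentSpace I x) :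
    covDeriv nabla A x u v = A' v := by
  have := (h (fun i => FiberBundle.extend E (v i)) fun i => SmoothNear.extend _).2
  simp only [FiberBundle.extend_apply_self] at this
  rw [covDeriv, this]
  ring

lemma add (hA : HasCovDerivAt nabla A x u A') (hB : HasCovDerivAt nabla B x u B') :
    HasCovDerivAt nabla (fun y v => A y v + B y v) x u (fun v => A' v + B' v) := by
  intro X hX
  obtain ⟨h1, h2⟩ := hA X hX
  obtain ⟨h3, h4⟩ := hB X hX
  refine ⟨h1.add h3, ?_⟩
  have := congrArg (fun L => L u) (mvfderiv_add h1 h3)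
  refine this.trans ?_
  rw [_root_.add_apply, h2, h4, Finset.sum_add_distrib]
  ring

lemma const_mul (hA : HasCovDerivAt nabla A x u A') (c : ℝ) :
    HasCovDerivAt nabla (fun y v => c * A y v) x u (fun v => c * A' v) := by
  intro X hX
  obtain ⟨h1, h2⟩ := hA X hX
  have hc : MDifferentiableAt I 𝓘(ℝ, ℝ) (fun _ : M => c) x := mdifferentiableAt_const
  refine ⟨hc.smul h1, ?_⟩
  have := congrArg (fun L => L u) (mvfderiv_mul hc h1)
  refine this.trans ?_
  simp only [_root_.smul_apply, h2, smul_eq_mul,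
    mvfderiv_const, smul_zero, add_zero]
  rw [mul_add, Finset.mul_sum]

lemma sub (hA : HasCovDerivAt nabla A x u A') (hB : HasCovDerivAt nabla B x u B') :
    HasCovDerivAt nabla (fun y v => A y v - B y v) x u (fun v => A' v - B' v) := by
  simpa [sub_eq_add_neg] using hA.add (hB.const_mul (-1))

lemma neg (hA : HasCovDerivAt nabla A x u A') :
    HasCovDerivAt nabla (fun y v => -A y v) x u (fun v => -A' v) := by
  simpa using hA.const_mul (-1)

/-- Composition with parallel endomorphisms. -/
lemma comp (hA : HasCovDerivAt nabla A x u A')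
    {L : Fin k → ∀ x : M, TangentSpace I x → TangentSpace I x}
    (hL : ∀ i, IsParallelEnd nabla (L i) x) :
    HasCovDerivAt nabla (fun y v => A y (fun i => L i y (v i))) x u
      (fun v => A' (fun i => L i x (v i))) := by
  intro X hX
  obtain ⟨h1, h2⟩ := hA (fun i y => L i y (X i y)) fun i => (hL i _ (hX i)).1
  refine ⟨h1, h2.trans ?_⟩
  congr 1
  refine Finset.sum_congr rfl fun i _ => congrArg _ ?_
  ext1 j
  by_cases hij : j = i
  · subst hij
    simp [(hL j _ (hX j)).2]
  · simp [hij]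

/-- Permutation of the arguments. -/
lemma reindex (hA : HasCovDerivAt nabla A x u A') (σ : Equiv.Perm (Fin k)) :
    HasCovDerivAt nabla (fun y v => A y (fun i => v (σ i))) x u (fun v => A' (fun i => v (σ i))) := by
  intro X hX
  obtain ⟨h1, h2⟩ := hA (fun i => X (σ i)) fun i => hX (σ i)
  refine ⟨h1, h2.trans ?_⟩
  congr 1
  refine Eq.trans ?_ (Equiv.sum_comp σ _)
  refine Finset.sum_congr rfl fun i _ => congrArg _ ?_
  ext1 j
  by_cases hij : j = i
  · subst hij; simp
  · simp [hij]

end HasCovDerivAt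

/-- The function `f` of `k` vectors is multilinear. -/
def IsMultilin {V : Type*} [AddCommGroup V] [Module ℝ V] (f : (Fin k → V) → ℝ) : Prop :=
  ∃ m : MultilinearMap ℝ (fun _ : Fin k => V) ℝ, ∀ v, f v = m v

variable (nabla) in
/-- The failure of `A` to be constant along the vector fields `X i`, corrected by the derivatives
of these fields. -/
def leibnizDefect (A : ∀ x : M, (Fin k → TangentSpace I x) → ℝ) (x : M) (u : TangentSpace I x)
    (X : Fin k → ∀ y : M, TangentSpace I y) : ℝ :=
  mvfderiv I (fun y => A y (fun i => X i y)) x u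
    - ∑ i, A x (Function.update (fun i => X i x) i (nabla (X i) x u))

/-- The tensor field `A` is differentiable on vector fields that are smooth near `x`. -/
def DiffOnSmooth (A : ∀ x : M, (Fin k → TangentSpace I x) → ℝ) (x : M) : Prop :=
  ∀ X : Fin k → ∀ y : M, TangentSpace I y, (∀ i, SmoothNear (X i) x) →
    MDifferentiableAt I 𝓘(ℝ, ℝ) (fun y => A y (fun i => X i y)) x

lemma SmoothNear.update {X : Fin k → ∀ y : M, TangentSpace I y} (hX : ∀ i, SmoothNear (X i) x)
    (i : Fin k) {σ : ∀ y, TangentSpace I y} (hσ : SmoothNear σ x) (j : Fin k) :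
    SmoothNear (Function.update X i σ j) x := by
  by_cases h : j = i
  · subst h; simpa using hσ
  · simpa [h] using hX j

lemma DiffOnSmooth.update (hd : DiffOnSmooth A x) {X : Fin k → ∀ y : M, TangentSpace I y}
    (hX : ∀ i, SmoothNear (X i) x) (i : Fin k) {σ : ∀ y, TangentSpace I y} (hσ : SmoothNear σ x) :
    MDifferentiableAt I 𝓘(ℝ, ℝ)
      (fun y => A y (Function.update (fun j => X j y) i (σ y))) x := by
  have := hd (Function.update X i σ) (SmoothNear.update hX i hσ)
  simpa only [update_section] using this

/-- Isolates the dependence on slot `i`: the derivative of `σ` appears once, and in all other terms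
`σ` enters by its value. -/
lemma leibnizDefect_update (X : Fin k → ∀ y : M, TangentSpace I y) (i : Fin k)
    (σ : ∀ y, TangentSpace I y) :
    leibnizDefect nabla A x u (Function.update X i σ)
      = mvfderiv I (fun y => A y (Function.update (fun j => X j y) i (σ y))) x u
        - (A x (Function.update (fun j => X j x) i (nabla σ x u))
          + ∑ j ∈ Finset.univ.erase i, A x (Function.update
            (Function.update (fun j => X j x) j (nabla (X j) x u)) i (σ x))) := by
  simp only [leibnizDefect, update_section]
  congr 1
  rw [← Finset.add_sum_erase _ _ (Finset.mem_univ i)]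
  congr 1
  · simp
  · refine Finset.sum_congr rfl fun j hj => ?_
    have hji : j ≠ i := Finset.ne_of_mem_erase hj
    rw [Function.update_comm hji.symm, Function.update_of_ne hji]

lemma leibnizDefect_update_add (hm : ∀ y, IsMultilin (A y)) (hd : DiffOnSmooth A x)
    {X : Fin k → ∀ y : M, TangentSpace I y} (hX : ∀ i, SmoothNear (X i) x) (i : Fin k)
    {σ τ : ∀ y, TangentSpace I y} (hσ : SmoothNear σ x) (hτ : SmoothNear τ x) :
    leibnizDefect nabla A x u (Function.update X i (σ + τ))
      = leibnizDefect nabla A x u (Function.update X i σ)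
        + leibnizDefect nabla A x u (Function.update X i τ) := by
  have hcov := nabla.isCovariantDerivativeOn (s := Set.univ)
  have := congrArg (fun L => L u) (mvfderiv_add (hd.update hX i hσ) (hd.update hX i hτ))
  choose m hm using hm
  simp only [hm] at this
  simp only [leibnizDefect_update, hm, Pi.add_apply, MultilinearMap.map_update_add,
    Finset.sum_add_distrib, hcov.add hσ.mdifferentiableAt hτ.mdifferentiableAt, _root_.add_apply]
  have h2 : mvfderiv I (fun y => m y (Function.update (fun j => X j y) i (σ y))
    + m y (Function.update (fun j => X j y) i (τ y))) x u = _ := this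
  rw [h2]
  simp only [_root_.add_apply]
  ring

/-- The derivative of `f` from the product rule cancels the one that `∇(fσ)` contributes in slot
`i`. -/
lemma leibnizDefect_update_smul (hm : ∀ y, IsMultilin (A y)) (hd : DiffOnSmooth A x)
    {X : Fin k → ∀ y : M, TangentSpace I y} (hX : ∀ i, SmoothNear (X i) x) (i : Fin k)
    {f : M → ℝ} (hf : FunSmoothNear I f x) {σ : ∀ y, TangentSpace I y} (hσ : SmoothNear σ x) :
    leibnizDefect nabla A x u (Function.update X i (f • σ))
      = f x * leibnizDefect nabla A x u (Function.update X i σ) := by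
  have hcov := nabla.isCovariantDerivativeOn (s := Set.univ)
  have := congrArg (fun L => L u) (mvfderiv_mul hf.mdifferentiableAt (hd.update hX i hσ))
  choose m hm using hm
  simp only [hm, _root_.add_apply, _root_.smul_apply, smul_eq_mul] at this
  have h2 : mvfderiv I (fun y => f y * m y (Function.update (fun j => X j y) i (σ y))) x u
    = _ := this
  simp only [leibnizDefect_update, hm, Pi.smul_apply', MultilinearMap.map_update_smul, smul_eq_mul,
    hcov.leibniz hσ.mdifferentiableAt hf.mdifferentiableAt, _root_.add_apply,
    MultilinearMap.map_update_add, _root_.smul_apply, ContinuousLinearMap.smulRight_apply]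
  rw [h2, ← Finset.mul_sum]
  ring

namespace HasCovDerivAt

lemma eq_leibnizDefect (hA : HasCovDerivAt nabla A x u A')
    {X : Fin k → ∀ y : M, TangentSpace I y} (hX : ∀ i, SmoothNear (X i) x) :
    A' (fun i => X i x) = leibnizDefect nabla A x u X := by
  rw [leibnizDefect, (hA X hX).2]
  ring

lemma diffOnSmooth (hA : HasCovDerivAt nabla A x u A') : DiffOnSmooth A x :=
  fun X hX => (hA X hX).1

/-- `A'` may be computed on any fields with the given values, so sums and constant multiples of
extensions reduce the claim to the defect. -/
lemma isMultilin (hA : HasCovDerivAt nabla A x u A') (hm : ∀ y, IsMultilin (A y)) :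
    IsMultilin A' := by
  have hX : ∀ v : Fin k → TangentSpace I x, ∀ i,
      SmoothNear (I := I) (FiberBundle.extend E (v i)) x := fun v i => SmoothNear.extend _
  have hupd : ∀ (v : Fin k → TangentSpace I x) (i : Fin k) (σ : ∀ y, TangentSpace I y),
      SmoothNear σ x → A' (Function.update v i (σ x)) = leibnizDefect nabla A x u
        (Function.update (fun j => FiberBundle.extend E (v j)) i σ) := by
    intro v i σ hσ
    rw [← hA.eq_leibnizDefect (SmoothNear.update (hX v) i hσ), update_section]
    simp
  refine ⟨{ toFun := A', map_update_add' := ?_, map_update_smul' := ?_ }, fun _ => rfl⟩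
  · intro inst v i a b
    obtain rfl : inst = instDecidableEqFin k := Subsingleton.elim _ _
    have h := hupd v i (FiberBundle.extend E a + FiberBundle.extend E b)
      ((SmoothNear.extend _).add (SmoothNear.extend _))
    rw [leibnizDefect_update_add hm hA.diffOnSmooth (hX v) i (SmoothNear.extend _)
      (SmoothNear.extend _), ← hupd v i _ (SmoothNear.extend _),
      ← hupd v i _ (SmoothNear.extend _)] at h
    simpa using h
  · intro inst v i c a
    obtain rfl : inst = instDecidableEqFin k := Subsingleton.elim _ _
    have h := hupd v i ((fun _ : M => c) • FiberBundle.extend E a)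
      ((SmoothNear.extend _).smul (FunSmoothNear.const c))
    rw [leibnizDefect_update_smul hm hA.diffOnSmooth (hX v) i (FunSmoothNear.const c)
      (SmoothNear.extend _), ← hupd v i _ (SmoothNear.extend _)] at h
    simpa using h

/-- The Leibniz rule for a field of multilinear maps that is differentiable on smooth vector
fields. -/
lemma of_isMultilin [FiniteDimensional ℝ E] (hm : ∀ y, IsMultilin (A y)) (hd : DiffOnSmooth A x)
    (u : TangentSpace I x) :
    HasCovDerivAt nabla A x u (covDeriv nabla A x u) := by
  classical
  have key : ∀ (X : Fin k → ∀ y : M, TangentSpace I y), (∀ i, SmoothNear (X i) x) →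
      ∀ (i : Fin k) (σ τ : ∀ y, TangentSpace I y), SmoothNear σ x → SmoothNear τ x → σ x = τ x →
      leibnizDefect nabla A x u (Function.update X i σ)
        = leibnizDefect nabla A x u (Function.update X i τ) := by
    intro X hX i σ τ hσ hτ hστ
    exact SmoothTensorial.pointwise
      (Φ := fun σ => leibnizDefect nabla A x u (Function.update X i σ))
      (fun σ τ hσ hτ => leibnizDefect_update_add hm hd hX i hσ hτ)
      (fun f σ hf hσ => leibnizDefect_update_smul hm hd hX i hf hσ) hσ hτ hστ
  have hall : ∀ (X : Fin k → ∀ y : M, TangentSpace I y), (∀ i, SmoothNear (X i) x) →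
      leibnizDefect nabla A x u X
        = leibnizDefect nabla A x u (fun i => FiberBundle.extend E (X i x)) := by
    intro X hX
    let Z : Fin k → ∀ y : M, TangentSpace I y := fun i => FiberBundle.extend E (X i x)
    have hZ : ∀ i, SmoothNear (Z i) x := fun i => SmoothNear.extend _
    -- The fields are replaced by extensions of their values one slot at a time, each replacement
    -- justified by `key`.
    have : ∀ s : Finset (Fin k), leibnizDefect nabla A x u (s.piecewise Z X)
        = leibnizDefect nabla A x u X := by
      intro s
      induction s using Finset.induction_on with
      | empty => simp
      | insert a s ha ih =>
        have hp : ∀ i, SmoothNear (s.piecewise Z X i) x := by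
          intro i
          by_cases h : i ∈ s
          · simpa [h] using hZ i
          · simpa [h] using hX i
        rw [Finset.piecewise_insert, key _ hp a (Z a) (s.piecewise Z X a) (hZ a) (hp a) ?_,
          Function.update_eq_self, ih]
        simp [Z, ha]
    rw [← this Finset.univ, Finset.piecewise_univ]
  intro X hX
  refine ⟨hd X hX, ?_⟩
  have h1 := hall X hX
  simp only [leibnizDefect, FiberBundle.extend_apply_self] at h1
  rw [covDeriv, ← h1]
  ring

end HasCovDerivAt
end HasCovDerivAt

/-! ### Multilinear forms and basis-independent traces. -/

section Traces

variable {V : Type*} [NormedAddCommGroup V] [InnerProductSpace ℝ V] {ι κ : Type*}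
  [Fintype ι] [Fintype κ]

/-- The trace of a bilinear form does not depend on the orthonormal basis. -/
lemma sum_bilin_eq (b : OrthonormalBasis ι ℝ V) (c : OrthonormalBasis κ ℝ V) {B : V → V → ℝ}
    (h1 : ∀ w, IsLinearMap ℝ fun v => B v w) (h2 : ∀ v, IsLinearMap ℝ (B v)) :
    ∑ i, B (b i) (b i) = ∑ i, B (c i) (c i) := by
  classical
  let B' : V →ₗ[ℝ] V →ₗ[ℝ] ℝ := LinearMap.mk₂ ℝ B (fun v v' w => (h1 w).map_add v v')
    (fun a v w => (h1 w).map_smul a v) (fun v w w' => (h2 v).map_add w w')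
    (fun a v w => (h2 v).map_smul a w)
  change ∑ i, B' (b i) (b i) = ∑ i, B' (c i) (c i)
  -- Expand in the basis `c`; summing over `i` then leaves `⟨c j, c k⟩` as the coefficient of `B (c
  -- j) (c k)`.
  have h : ∀ i, B' (b i) (b i)
      = ∑ j, ∑ k, inner ℝ (c j) (b i) * inner ℝ (b i) (c k) * B' (c j) (c k) := by
    intro i
    conv_lhs => rw [← c.sum_repr' (b i)]
    simp only [map_sum, map_smul, LinearMap.sum_apply, LinearMap.smul_apply, smul_eq_mul]
    rw [Finset.sum_comm]
    refine Finset.sum_congr rfl fun j _ => ?_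
    rw [Finset.mul_sum]
    refine Finset.sum_congr rfl fun k _ => ?_
    rw [real_inner_comm (b i) (c j)]
    ring
  simp_rw [h]
  rw [Finset.sum_comm]
  refine Finset.sum_congr rfl fun j _ => ?_
  rw [Finset.sum_comm]
  simp_rw [← Finset.sum_mul, b.sum_inner_mul_inner, c.inner_eq_ite]
  simp

lemma IsMultilin.isLinearMap {k : ℕ} {f : (Fin k → V) → ℝ} (hf : IsMultilin f) (v : Fin k → V)
    (i : Fin k) : IsLinearMap ℝ fun w => f (Function.update v i w) := by
  obtain ⟨m, hm⟩ := hf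
  constructor <;> intros <;> simp [hm]

lemma IsMultilin.comp {k : ℕ} {f : (Fin k → V) → ℝ} (hf : IsMultilin f) {L : Fin k → V → V}
    (hL : ∀ i, IsLinearMap ℝ (L i)) : IsMultilin fun v => f fun i => L i (v i) := by
  obtain ⟨m, hm⟩ := hf
  exact ⟨m.compLinearMap fun i => (hL i).mk', fun v => hm _⟩

lemma IsMultilin.add {k : ℕ} {f g : (Fin k → V) → ℝ} (hf : IsMultilin f) (hg : IsMultilin g) :
    IsMultilin fun v => f v + g v := by
  obtain ⟨m, hm⟩ := hf
  obtain ⟨m', hm'⟩ := hg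
  exact ⟨m + m', fun v => by simp [hm, hm']⟩

lemma IsMultilin.const_mul {k : ℕ} {f : (Fin k → V) → ℝ} (hf : IsMultilin f) (c : ℝ) :
    IsMultilin fun v => c * f v := by
  obtain ⟨m, hm⟩ := hf
  exact ⟨c • m, fun v => by simp [hm]⟩

lemma IsMultilin.sub {k : ℕ} {f g : (Fin k → V) → ℝ} (hf : IsMultilin f) (hg : IsMultilin g) :
    IsMultilin fun v => f v - g v := by
  simpa [sub_eq_add_neg] using hf.add (hg.const_mul (-1))

section Three

variable {f : (Fin 3 → V) → ℝ}

lemma IsMultilin.linear_zero (hf : IsMultilin f) (b c : V) :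
    IsLinearMap ℝ fun a => f ![a, b, c] := by
  convert hf.isLinearMap ![0, b, c] 0 using 3 with a
  ext i; fin_cases i <;> rfl

lemma IsMultilin.linear_one (hf : IsMultilin f) (a c : V) :
    IsLinearMap ℝ fun b => f ![a, b, c] := by
  convert hf.isLinearMap ![a, 0, c] 1 using 3 with b
  ext i; fin_cases i <;> rfl

lemma IsMultilin.linear_two (hf : IsMultilin f) (a b : V) :
    IsLinearMap ℝ fun c => f ![a, b, c] := by
  convert hf.isLinearMap ![a, b, 0] 2 using 3 with c
  ext i; fin_cases i <;> rfl

lemma IsLinearMap.const_mul {g : V → ℝ} (hg : IsLinearMap ℝ g) (c : ℝ) :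
    IsLinearMap ℝ fun v => c * g v := by
  constructor
  · intro v w; rw [hg.map_add]; ring
  · intro a v; rw [hg.map_smul]; simp only [smul_eq_mul]; ring

lemma IsLinearMap.mul_const {g : V → ℝ} (hg : IsLinearMap ℝ g) (c : ℝ) :
    IsLinearMap ℝ fun v => g v * c := by
  simpa [mul_comm] using IsLinearMap.const_mul hg c

lemma IsLinearMap.finset_sum {g : κ → V → ℝ} (hg : ∀ k, IsLinearMap ℝ (g k)) :
    IsLinearMap ℝ fun v => ∑ k, g k v := by
  constructor
  · intro v w; simp [(hg _).map_add, Finset.sum_add_distrib]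
  · intro a v; simp [(hg _).map_smul, Finset.mul_sum]

/-- The inner product of two covariant 3-tensors does not depend on the orthonormal basis. -/
lemma sum_three_eq (b : OrthonormalBasis ι ℝ V) (c : OrthonormalBasis κ ℝ V)
    {f g : (Fin 3 → V) → ℝ} (hf : IsMultilin f) (hg : IsMultilin g) :
    ∑ i, ∑ j, ∑ k, f ![b i, b j, b k] * g ![b i, b j, b k]
      = ∑ i, ∑ j, ∑ k, f ![c i, c j, c k] * g ![c i, c j, c k] := by
  have h1 : ∀ (u v : V), ∑ k, f ![u, v, b k] * g ![u, v, b k]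
      = ∑ k, f ![u, v, c k] * g ![u, v, c k] := fun u v =>
    sum_bilin_eq b c (B := fun x y => f ![u, v, x] * g ![u, v, y])
      (fun w => IsLinearMap.mul_const (hf.linear_two u v) _)
      (fun w => IsLinearMap.const_mul (hg.linear_two u v) _)
  have h2 : ∀ (u : V), ∑ j, ∑ k, f ![u, b j, c k] * g ![u, b j, c k]
      = ∑ j, ∑ k, f ![u, c j, c k] * g ![u, c j, c k] := fun u =>
    sum_bilin_eq b c (B := fun x y => ∑ k, f ![u, x, c k] * g ![u, y, c k])
      (fun w => IsLinearMap.finset_sum fun k => IsLinearMap.mul_const (hf.linear_one u _) _)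
      (fun w => IsLinearMap.finset_sum fun k => IsLinearMap.const_mul (hg.linear_one u _) _)
  have h3 : ∑ i, ∑ j, ∑ k, f ![b i, c j, c k] * g ![b i, c j, c k]
      = ∑ i, ∑ j, ∑ k, f ![c i, c j, c k] * g ![c i, c j, c k] :=
    sum_bilin_eq b c (B := fun x y => ∑ j, ∑ k, f ![x, c j, c k] * g ![y, c j, c k])
      (fun w => IsLinearMap.finset_sum fun j => IsLinearMap.finset_sum fun k =>
        IsLinearMap.mul_const (hf.linear_zero _ _) _)
      (fun w => IsLinearMap.finset_sum fun j => IsLinearMap.finset_sum fun k =>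
        IsLinearMap.const_mul (hg.linear_zero _ _) _)
  simp_rw [h1, h2, h3]

end Three
end Traces

/-! ### Local orthonormal frames and differentiation of traces. -/

section Frames

variable {E : Type*} [NormedAddCommGroup E] [NormedSpace ℝ E] [FiniteDimensional ℝ E]
  {H : Type*} [TopologicalSpace H] {I : ModelWithCorners ℝ E H}
  {M : Type*} [TopologicalSpace M] [ChartedSpace H M] [IsManifold I ∞ M]
  [RiemannianBundle (fun x : M => TangentSpace I x)]
  [IsContMDiffRiemannianBundle I ∞ E (fun x : M => TangentSpace I x)]

lemma FunSmoothNear.comp {f : M → ℝ} {x : M} (hf : FunSmoothNear I f x) {g : ℝ → ℝ}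
    (hg : ∀ᶠ t in 𝓝 (f x), ContDiffAt ℝ ∞ g t) : FunSmoothNear I (fun y => g (f y)) x := by
  filter_upwards [hf, hf.contMDiffAt.continuousAt.eventually hg] with y h1 h2
  exact h2.contMDiffAt.comp y h1

/-- Near every point there is a smooth orthonormal frame. -/
theorem exists_orthonormal_frame (x : M) :
    ∃ e : Fin (Module.finrank ℝ E) → ∀ y : M, TangentSpace I y,
      (∀ i, SmoothNear (e i) x) ∧ ∀ᶠ y in 𝓝 x, Orthonormal ℝ (fun i => e i y) := by
  classical
  let t := trivializationAt E (fun y : M => TangentSpace I y) x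
  have hxt : x ∈ t.baseSet := FiberBundle.mem_baseSet_trivializationAt' x
  let b := Module.finBasis ℝ E
  let f : Fin (Module.finrank ℝ E) → ∀ y : M, TangentSpace I y := t.localFrame b
  have hf : ∀ i, SmoothNear (f i) x := fun i => by
    filter_upwards [t.open_baseSet.mem_nhds hxt] with y hy
    exact contMDiffAt_localFrame_of_mem ∞ t b i hy
  have hli : ∀ y ∈ t.baseSet, LinearIndependent ℝ (fun i => f i y) := by
    intro y hy
    rw [show (fun i => f i y) = t.basisAt b hy from
      funext fun i => t.localFrame_apply_of_mem_baseSet b hy]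
    exact (t.basisAt b hy).linearIndependent
  -- Fibrewise Gram–Schmidt. Smoothness goes by strong induction on the index, the denominators
  -- being nonzero near `x`.
  let g : Fin (Module.finrank ℝ E) → ∀ y : M, TangentSpace I y :=
    fun i y => InnerProductSpace.gramSchmidt ℝ (fun j => f j y) i
  have hg0 : ∀ y ∈ t.baseSet, ∀ i, g i y ≠ 0 := fun y hy i =>
    InnerProductSpace.gramSchmidt_ne_zero i (hli y hy)
  have hpos : ∀ i, inner ℝ (g i x) (g i x) ≠ 0 := fun i => inner_self_ne_zero.2 (hg0 x hxt i)
  have hg : ∀ i, SmoothNear (g i) x := by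
    intro i
    induction i using WellFoundedLT.induction with
    | ind i ih =>
      have h1 : ∀ j ∈ Finset.Iio i, SmoothNear ((fun y => inner ℝ (g j y) (f i y)
          * (inner ℝ (g j y) (g j y))⁻¹) • g j) x := by
        intro j hj
        have hj' := ih j (Finset.mem_Iio.1 hj)
        refine SmoothNear.smul ((hj'.inner (hf i)).mul ((hj'.inner hj').comp ?_)) hj'
        filter_upwards [isOpen_ne.mem_nhds (hpos j)] with s hs
        exact contDiffAt_inv ℝ hs
      refine ((hf i).sub (SmoothNear.sum h1)).congr (Filter.Eventually.of_forall fun y => ?_)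
      have := InnerProductSpace.gramSchmidt_def'' ℝ (fun j => f j y) i
      simp only [Pi.sub_apply]
      rw [this]
      simp [g, div_eq_mul_inv]
  refine ⟨fun i => (fun y => (Real.sqrt (inner ℝ (g i y) (g i y)))⁻¹) • g i, fun i => ?_, ?_⟩
  · refine SmoothNear.smul (((hg i).inner (hg i)).comp (g := fun s => (Real.sqrt s)⁻¹) ?_) (hg i)
    have : 0 < inner ℝ (g i x) (g i x) := real_inner_self_nonneg.lt_of_ne' (hpos i)
    filter_upwards [isOpen_Ioi.mem_nhds this] with s hs
    exact (contDiffAt_id.sqrt (ne_of_gt hs)).inv (Real.sqrt_ne_zero'.2 hs)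
  · filter_upwards [t.open_baseSet.mem_nhds hxt] with y hy
    convert InnerProductSpace.gramSchmidtNormed_orthonormal (hli y hy) using 2 with i
    simp [InnerProductSpace.gramSchmidtNormed, g]

/-- The orthonormal basis of a tangent space defined by an orthonormal family. -/
def orthonormalBasisOf {x : M} {e : Fin (Module.finrank ℝ E) → TangentSpace I x}
    (he : Orthonormal ℝ e) : OrthonormalBasis (Fin (Module.finrank ℝ E)) ℝ (TangentSpace I x) :=
  haveI : FiniteDimensional ℝ (TangentSpace I x) := inferInstanceAs (FiniteDimensional ℝ E)
  OrthonormalBasis.mk he (by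
    rw [he.linearIndependent.span_eq_top_of_card_eq_finrank' (by simp; rfl)])

lemma coe_orthonormalBasisOf {x : M} {e : Fin (Module.finrank ℝ E) → TangentSpace I x}
    (he : Orthonormal ℝ e) (i) : orthonormalBasisOf he i = e i := by
  simp [orthonormalBasisOf]

lemma mvfderiv_congr {f g : M → ℝ} {x : M} (h : f =ᶠ[𝓝 x] g) : mvfderiv I f x = mvfderiv I g x := by
  ext u
  change mfderiv I 𝓘(ℝ, ℝ) f x u = mfderiv I 𝓘(ℝ, ℝ) g x u
  rw [h.mfderiv_eq]
  rfl

lemma mvfderiv_finset_sum {ι : Type*} (s : Finset ι) {f : ι → M → ℝ} {x : M}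
    (h : ∀ i, MDifferentiableAt I 𝓘(ℝ, ℝ) (f i) x) (u : TangentSpace I x) :
    MDifferentiableAt I 𝓘(ℝ, ℝ) (fun y => ∑ i ∈ s, f i y) x ∧
      mvfderiv I (fun y => ∑ i ∈ s, f i y) x u = ∑ i ∈ s, mvfderiv I (f i) x u := by
  classical
  induction s using Finset.induction_on with
  | empty => exact ⟨by simpa using mdifferentiableAt_const, by simp [mvfderiv_const]⟩
  | insert a s ha ih =>
    simp only [Finset.sum_insert ha]
    refine ⟨(h a).add ih.1, ?_⟩
    rw [← ih.2]
    exact congrArg (fun L => L u) (mvfderiv_add (h a) ih.1)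

variable {nabla : CovariantDerivative I E (fun x : M => TangentSpace I x)} {x : M}

/-- The connection matrix of a metric connection in an orthonormal frame is skew-symmetric. -/
lemma IsMetric.inner_frame_skew (h : IsMetric nabla)
    {e : Fin (Module.finrank ℝ E) → ∀ y : M, TangentSpace I y} (hs : ∀ i, SmoothNear (e i) x)
    (he : ∀ᶠ y in 𝓝 x, Orthonormal ℝ (fun i => e i y)) (u : TangentSpace I x) (i j) :
    inner ℝ (nabla (e i) x u) (e j x) = -inner ℝ (nabla (e j) x u) (e i x) := by
  have h1 := h x u (e i) (e j) (hs i).mdifferentiableAt (hs j).mdifferentiableAt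
  have h2 : mvfderiv I (fun y : M => inner ℝ (e i y) (e j y)) x = 0 := by
    have : (fun y : M => inner ℝ (e i y) (e j y)) =ᶠ[𝓝 x] fun _ => if i = j then (1 : ℝ) else 0 := by
      filter_upwards [he] with y hy
      exact orthonormal_iff_ite.1 hy i j
    rw [mvfderiv, this.mfderiv_eq]
    exact mvfderiv_const _
  rw [h2, real_inner_comm] at h1
  rw [real_inner_comm (e i x)]
  simp only [_root_.zero_apply] at h1
  rw [real_inner_comm] at h1
  linarith

/-- In a sum over an orthonormal frame, the derivatives of the frame cancel. -/
lemma IsMetric.sum_nabla_frame (h : IsMetric nabla)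
    {e : Fin (Module.finrank ℝ E) → ∀ y : M, TangentSpace I y} (hs : ∀ i, SmoothNear (e i) x)
    (he : ∀ᶠ y in 𝓝 x, Orthonormal ℝ (fun i => e i y)) (u : TangentSpace I x)
    {B : TangentSpace I x → TangentSpace I x → ℝ}
    (h1 : ∀ w, IsLinearMap ℝ fun v => B v w) (h2 : ∀ v, IsLinearMap ℝ (B v)) :
    ∑ i, (B (nabla (e i) x u) (e i x) + B (e i x) (nabla (e i) x u)) = 0 := by
  have hexp : ∀ v, v = ∑ j, inner ℝ v (e j x) • e j x := by
    intro v
    have := (orthonormalBasisOf he.self_of_nhds).sum_repr' v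
    simp only [coe_orthonormalBasisOf] at this
    simpa only [real_inner_comm v] using this.symm
  have hl : ∀ i, B (nabla (e i) x u) (e i x)
      = ∑ j, inner ℝ (nabla (e i) x u) (e j x) * B (e j x) (e i x) := by
    intro i
    conv_lhs => rw [hexp (nabla (e i) x u)]
    refine (map_sum (h1 (e i x)).mk' _ _).trans (Finset.sum_congr rfl fun j _ => ?_)
    exact (h1 (e i x)).map_smul _ _
  have hr : ∀ i, B (e i x) (nabla (e i) x u)
      = ∑ j, inner ℝ (nabla (e i) x u) (e j x) * B (e i x) (e j x) := by
    intro i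
    conv_lhs => rw [hexp (nabla (e i) x u)]
    refine (map_sum (h2 (e i x)).mk' _ _).trans (Finset.sum_congr rfl fun j _ => ?_)
    exact (h2 (e i x)).map_smul _ _
  simp_rw [hl, hr]
  rw [Finset.sum_add_distrib]
  -- Exchanging the indices in one double sum pairs each value of `B` with a sum of two mirrored
  -- entries of the connection matrix, which is zero.
  conv_lhs => rw [Finset.sum_comm, ← Finset.sum_add_distrib]
  refine Finset.sum_eq_zero fun i _ => ?_
  rw [← Finset.sum_add_distrib]
  refine Finset.sum_eq_zero fun j _ => ?_
  rw [h.inner_frame_skew hs he u j i]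
  ring

variable {A : ∀ x : M, (Fin 3 → TangentSpace I x) → ℝ} {u : TangentSpace I x}
  {A' : (Fin 3 → TangentSpace I x) → ℝ}

lemma fin_three_section (X : Fin 3 → ∀ y : M, TangentSpace I y) (y : M) :
    (fun i => X i y) = ![X 0 y, X 1 y, X 2 y] := by
  ext1 i; fin_cases i <;> rfl

lemma HasCovDerivAt.three (hA : HasCovDerivAt nabla A x u A') {X Y Z : ∀ y : M, TangentSpace I y}
    (hX : SmoothNear X x) (hY : SmoothNear Y x) (hZ : SmoothNear Z x) :
    MDifferentiableAt I 𝓘(ℝ, ℝ) (fun y => A y ![X y, Y y, Z y]) x ∧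
    mvfderiv I (fun y => A y ![X y, Y y, Z y]) x u = A' ![X x, Y x, Z x]
      + (A x ![nabla X x u, Y x, Z x] + A x ![X x, nabla Y x u, Z x]
        + A x ![X x, Y x, nabla Z x u]) := by
  have h := hA ![X, Y, Z] (by intro i; fin_cases i <;> assumption)
  simp only [fin_three_section, Fin.sum_univ_three] at h
  refine ⟨h.1, h.2.trans ?_⟩
  congr 2
  · congr 1
    · congr 1; ext1 i; fin_cases i <;> rfl
    · congr 1; ext1 i; fin_cases i <;> rfl
  · congr 1; ext1 i; fin_cases i <;> rfl

/-- The trace over the last two arguments commutes with covariant differentiation by a metric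
connection. -/
lemma HasCovDerivAt.trace (h : IsMetric nabla) (hA : HasCovDerivAt nabla A x u A')
    (hm : ∀ y, IsMultilin (A y)) :
    HasCovDerivAt nabla
      (fun y (v : Fin 1 → TangentSpace I y) => ∑ i, A y ![v 0, frame y i, frame y i]) x u
      (fun v => ∑ i, A' ![v 0, frame x i, frame x i]) := by
  obtain ⟨e, hs, he⟩ := exists_orthonormal_frame (I := I) x
  have hbil : ∀ {y : M} {f : (Fin 3 → TangentSpace I y) → ℝ} (_ : IsMultilin f)
      (v : TangentSpace I y) (_ : Orthonormal ℝ (fun i => e i y)),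
      ∑ i, f ![v, frame y i, frame y i] = ∑ i, f ![v, e i y, e i y] := by
    intro y f hf v hy
    have := sum_bilin_eq (frame y) (orthonormalBasisOf hy) (B := fun a b => f ![v, a, b])
      (fun w => hf.linear_one v w) (fun w => hf.linear_two v w)
    simpa only [coe_orthonormalBasisOf] using this
  intro X hX
  -- `frame` is chosen point by point and need not be continuous. The trace does not see the basis,
  -- so a smooth orthonormal frame replaces it before differentiating.
  have h0 : (fun y => ∑ i, A y ![X 0 y, frame y i, frame y i])
      =ᶠ[𝓝 x] fun y => ∑ i, A y ![X 0 y, e i y, e i y] := by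
    filter_upwards [he] with y hy using hbil (hm y) _ hy
  have h1 := mvfderiv_finset_sum Finset.univ (fun i => (hA.three (hX 0) (hs i) (hs i)).1) u
  refine ⟨h1.1.congr_of_eventuallyEq h0, ?_⟩
  have h2 : mvfderiv I (fun y => ∑ i, A y ![X 0 y, frame y i, frame y i]) x u
      = mvfderiv I (fun y => ∑ i, A y ![X 0 y, e i y, e i y]) x u := by
    rw [mvfderiv_congr h0]
  rw [h2, h1.2]
  simp only [hbil (hA.isMultilin hm) _ he.self_of_nhds]
  simp only [fun i => (hA.three (hX 0) (hs i) (hs i)).2]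
  have h3 := h.sum_nabla_frame hs he u (B := fun a b => A x ![X 0 x, a, b])
      (fun w => (hm x).linear_one _ w) (fun w => (hm x).linear_two _ w)
  simp only [Finset.sum_add_distrib] at h3 ⊢
  simp only [Fin.sum_univ_one, Function.update_self, hbil (hm x) _ he.self_of_nhds]
  simp only [add_assoc, h3]
  simp

lemma mvfderiv_sum_sq {ι : Type*} [Fintype ι] {F : ι → ι → ι → M → ℝ} {x : M}
    (hF : ∀ i j k, MDifferentiableAt I 𝓘(ℝ, ℝ) (F i j k) x) (u : TangentSpace I x) :
    MDifferentiableAt I 𝓘(ℝ, ℝ) (fun y => ∑ i, ∑ j, ∑ k, F i j k y * F i j k y) x ∧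
      mvfderiv I (fun y => ∑ i, ∑ j, ∑ k, F i j k y * F i j k y) x u
        = 2 * ∑ i, ∑ j, ∑ k, mvfderiv I (F i j k) x u * F i j k x := by
  have hmul : ∀ i j k, MDifferentiableAt I 𝓘(ℝ, ℝ) (fun y => F i j k y * F i j k y) x ∧
      mvfderiv I (fun y => F i j k y * F i j k y) x u
        = 2 * (mvfderiv I (F i j k) x u * F i j k x) := by
    intro i j k
    refine ⟨(hF i j k).smul (hF i j k), ?_⟩
    refine (congrArg (fun L => L u) (mvfderiv_mul (hF i j k) (hF i j k))).trans ?_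
    simp only [_root_.add_apply, _root_.smul_apply, smul_eq_mul]
    ring
  have s1 := fun i j => mvfderiv_finset_sum Finset.univ (fun k => (hmul i j k).1) u
  have s2 := fun i => mvfderiv_finset_sum Finset.univ (fun j => (s1 i j).1) u
  have s3 := mvfderiv_finset_sum Finset.univ (fun i => (s2 i).1) u
  refine ⟨s3.1, s3.2.trans ?_⟩
  simp only [s2, s1, hmul, Finset.mul_sum]

/-- The derivative of the squared norm of a 3-tensor field. -/
lemma HasCovDerivAt.normSq (h : IsMetric nabla) (hA : HasCovDerivAt nabla A x u A')
    (hm : ∀ y, IsMultilin (A y)) :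
    MDifferentiableAt I 𝓘(ℝ, ℝ) (normSq A) x ∧
    mvfderiv I (ACYT.normSq A) x u = 2 * ∑ i, ∑ j, ∑ k,
      A' ![frame x i, frame x j, frame x k] * A x ![frame x i, frame x j, frame x k] := by
  obtain ⟨e, hs, he⟩ := exists_orthonormal_frame (I := I) x
  have hbil : ∀ {y : M} {f g : (Fin 3 → TangentSpace I y) → ℝ} (_ : IsMultilin f)
      (_ : IsMultilin g) (_ : Orthonormal ℝ (fun i => e i y)),
      ∑ i, ∑ j, ∑ k, f ![frame y i, frame y j, frame y k] * g ![frame y i, frame y j, frame y k]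
      = ∑ i, ∑ j, ∑ k, f ![e i y, e j y, e k y] * g ![e i y, e j y, e k y] := by
    intro y f g hf hg hy
    have := sum_three_eq (frame y) (orthonormalBasisOf hy) hf hg
    simpa only [coe_orthonormalBasisOf] using this
  let F : Fin _ → Fin _ → Fin _ → M → ℝ := fun i j k y => A y ![e i y, e j y, e k y]
  have hF : ∀ i j k, MDifferentiableAt I 𝓘(ℝ, ℝ) (F i j k) x := fun i j k =>
    (hA.three (hs i) (hs j) (hs k)).1
  have h0 : ACYT.normSq A =ᶠ[𝓝 x] fun y => ∑ i, ∑ j, ∑ k, F i j k y * F i j k y := by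
    filter_upwards [he] with y hy
    simp only [ACYT.normSq, pow_two]
    exact hbil (hm y) (hm y) hy
  have hsum := mvfderiv_sum_sq hF u
  refine ⟨hsum.1.congr_of_eventuallyEq h0, ?_⟩
  have h2 : mvfderiv I (ACYT.normSq A) x u
      = mvfderiv I (fun y => ∑ i, ∑ j, ∑ k, F i j k y * F i j k y) x u := by
    rw [mvfderiv_congr h0]
  rw [h2, hsum.2, hbil (hA.isMultilin hm) (hm x) he.self_of_nhds]
  simp only [F, fun i j k => (hA.three (hs i) (hs j) (hs k)).2]
  -- In each of the three slots the derivatives of the frame cancel against each other.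
  have t0 := h.sum_nabla_frame hs he u
    (B := fun a b => ∑ j, ∑ k, A x ![a, e j x, e k x] * A x ![b, e j x, e k x])
    (fun w => IsLinearMap.finset_sum fun j => IsLinearMap.finset_sum fun k =>
      IsLinearMap.mul_const ((hm x).linear_zero _ _) _)
    (fun w => IsLinearMap.finset_sum fun j => IsLinearMap.finset_sum fun k =>
      IsLinearMap.const_mul ((hm x).linear_zero _ _) _)
  have t1 := fun i => h.sum_nabla_frame hs he u
    (B := fun a b => ∑ k, A x ![e i x, a, e k x] * A x ![e i x, b, e k x])
    (fun w => IsLinearMap.finset_sum fun k => IsLinearMap.mul_const ((hm x).linear_one _ _) _)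
    (fun w => IsLinearMap.finset_sum fun k => IsLinearMap.const_mul ((hm x).linear_one _ _) _)
  have t2 := fun i j => h.sum_nabla_frame hs he u
    (B := fun a b => A x ![e i x, e j x, a] * A x ![e i x, e j x, b])
    (fun w => IsLinearMap.mul_const ((hm x).linear_two _ _) _)
    (fun w => IsLinearMap.const_mul ((hm x).linear_two _ _) _)
  have t1' := Finset.sum_eq_zero fun i (_ : i ∈ Finset.univ) => t1 i
  have t2' := Finset.sum_eq_zero fun i (_ : i ∈ Finset.univ) =>
    Finset.sum_eq_zero fun j (_ : j ∈ Finset.univ) => t2 i j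
  have hall := congrArg₂ (· + ·) (congrArg₂ (· + ·) t0 t1') t2'
  simp only [← Finset.sum_add_distrib, add_zero] at hall
  rw [← sub_eq_zero]
  simp only [Finset.mul_sum, ← Finset.sum_sub_distrib]
  rw [← hall]
  refine Finset.sum_congr rfl fun i _ => Finset.sum_congr rfl fun j _ =>
    Finset.sum_congr rfl fun k _ => ?_
  ring

end Frames

/-! ### Curvature of a connection with torsion, and the first Bianchi identity. -/

section Curvature

variable {E : Type*} [NormedAddCommGroup E] [NormedSpace ℝ E] [FiniteDimensional ℝ E]
  {H : Type*} [TopologicalSpace H] {I : ModelWithCorners ℝ E H}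
  {M : Type*} [TopologicalSpace M] [T2Space M] [ChartedSpace H M] [IsManifold I ∞ M]
  {x : M} {X Y Z W : ∀ y : M, TangentSpace I y}

/-- The commutator of two vector fields acting on a function is the Lie bracket. -/
theorem mvfderiv_commutator [Nontrivial E] {f : M → ℝ} (hX : SmoothNear X x) (hY : SmoothNear Y x)
    (hf : FunSmoothNear I f x)
    (hXf : FunSmoothNear I (fun y => mvfderiv I f y (X y)) x)
    (hYf : FunSmoothNear I (fun y => mvfderiv I f y (Y y)) x) :
    mvfderiv I (fun y => mvfderiv I f y (Y y)) x (X x)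
      - mvfderiv I (fun y => mvfderiv I f y (X y)) x (Y x)
      = mvfderiv I f x (VectorField.mlieBracket I X Y x) := by
  have : CompleteSpace E := FiniteDimensional.complete ℝ E
  have : IsManifold I (minSmoothness ℝ 3) M := by
    rw [minSmoothness_of_isRCLikeNormedField]
    infer_instance
  have : IsManifold I (minSmoothness ℝ 2) M := by
    rw [minSmoothness_of_isRCLikeNormedField]
    infer_instance
  -- The statement on functions is extracted from the Jacobi identity for fields: apply it to `X, Y,
  -- fZ` and subtract `f` times the identity for `X, Y, Z`. What remains is the wanted scalar times
  -- `Z`, so `Z` must not vanish at `x`.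
  obtain ⟨v, hv⟩ : ∃ v : TangentSpace I x, v ≠ 0 := exists_ne (0 : E)
  let Z : ∀ y : M, TangentSpace I y := FiberBundle.extend E v
  have hZ : SmoothNear Z x := SmoothNear.extend v
  have hfZ : SmoothNear (f • Z) x := hZ.smul hf
  have hle : minSmoothness ℝ 2 ≤ (∞ : WithTop ℕ∞) := by
    rw [minSmoothness_of_isRCLikeNormedField]; exact ENat.LEInfty.out
  have hbr : ∀ {X Y : ∀ y : M, TangentSpace I y}, SmoothNear X x → SmoothNear Y x →
      FunSmoothNear I (fun y => mvfderiv I f y (Y y)) x →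
      VectorField.mlieBracket I X (VectorField.mlieBracket I Y (f • Z)) x
      = mvfderiv I (fun y => mvfderiv I f y (Y y)) x (X x) • Z x
        + mvfderiv I f x (Y x) • VectorField.mlieBracket I X Z x
        + (mvfderiv I f x (X x) • VectorField.mlieBracket I Y Z x
          + f x • VectorField.mlieBracket I X (VectorField.mlieBracket I Y Z) x) := by
    intro X Y hX hY hYf
    have h1 : VectorField.mlieBracket I Y (f • Z) =ᶠ[𝓝 x]
        ((fun y => mvfderiv I f y (Y y)) • Z + f • VectorField.mlieBracket I Y Z :
          ∀ y : M, TangentSpace I y) := by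
      filter_upwards [hf.eventually, hZ.eventually] with y h2 h3
      exact VectorField.mlieBracket_smul_right h2.mdifferentiableAt h3.mdifferentiableAt
    refine (Filter.EventuallyEq.mlieBracket_vectorField_eq (V := X) (V₁ := X)
      Filter.EventuallyEq.rfl h1).trans ?_
    rw [VectorField.mlieBracket_add_right (hZ.smul hYf).mdifferentiableAt
        ((hY.mlieBracket hZ).smul hf).mdifferentiableAt,
      VectorField.mlieBracket_smul_right hYf.mdifferentiableAt hZ.mdifferentiableAt,
      VectorField.mlieBracket_smul_right hf.mdifferentiableAt (hY.mlieBracket hZ).mdifferentiableAt]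
  have hj := VectorField.leibniz_identity_mlieBracket_apply (hX.contMDiffAt.of_le hle)
    (hY.contMDiffAt.of_le hle) (hfZ.contMDiffAt.of_le hle)
  have hj2 := VectorField.leibniz_identity_mlieBracket_apply (hX.contMDiffAt.of_le hle)
    (hY.contMDiffAt.of_le hle) (hZ.contMDiffAt.of_le hle)
  rw [hbr hX hY hYf, hbr hY hX hXf,
    VectorField.mlieBracket_smul_right hf.mdifferentiableAt hZ.mdifferentiableAt, hj2] at hj
  have h5 : (mvfderiv I (fun y => mvfderiv I f y (Y y)) x (X x)
      - mvfderiv I (fun y => mvfderiv I f y (X y)) x (Y x)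
      - mvfderiv I f x (VectorField.mlieBracket I X Y x)) • Z x = 0 := by
    rw [← sub_eq_zero.2 hj]
    module
  have h6 := (smul_eq_zero.1 h5).resolve_right (by simpa [Z] using hv)
  linarith

/-- The curvature operator on vector fields. -/
def curvField (nabla : CovariantDerivative I E (fun x : M => TangentSpace I x))
    (X Y Z : ∀ y : M, TangentSpace I y) (x : M) : TangentSpace I x :=
  nabla (fun y => nabla Z y (Y y)) x (X x) - nabla (fun y => nabla Z y (X y)) x (Y x)
    - nabla Z x (VectorField.mlieBracket I X Y x)

lemma curvature_eq_curvField (nabla : CovariantDerivative I E (fun x : M => TangentSpace I x))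
    (u v w : TangentSpace I x) :
    curvature nabla x u v w = curvField nabla (FiberBundle.extend E u) (FiberBundle.extend E v)
      (FiberBundle.extend E w) x := by
  simp [curvature, curvField]

variable {nabla : CovariantDerivative I E (fun x : M => TangentSpace I x)}

variable [RiemannianBundle (fun x : M => TangentSpace I x)]
  [IsContMDiffRiemannianBundle I ∞ E (fun x : M => TangentSpace I x)]

/-- The curvature of a metric connection is skew-symmetric with respect to the metric. -/
lemma IsMetric.curvField_skew [Nontrivial E] (h : IsMetric nabla)
    (hs : nabla.ContMDiffCovariantDerivative ∞)
    (hX : SmoothNear X x) (hY : SmoothNear Y x) (hZ : SmoothNear Z x) (hW : SmoothNear W x) :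
    inner ℝ (curvField nabla X Y Z x) (W x) = -inner ℝ (Z x) (curvField nabla X Y W x) := by
  have h1 : ∀ {U : ∀ y : M, TangentSpace I y}, SmoothNear U x →
      (fun y => mvfderiv I (fun y => inner ℝ (Z y) (W y)) y (U y)) =ᶠ[𝓝 x]
      fun y => inner ℝ (nabla Z y (U y)) (W y) + inner ℝ (Z y) (nabla W y (U y)) := by
    intro U hU
    filter_upwards [hZ.eventually, hW.eventually] with y h2 h3
    exact h y (U y) Z W h2.mdifferentiableAt h3.mdifferentiableAt
  have h2 : ∀ {U V : ∀ y : M, TangentSpace I y}, SmoothNear U x → SmoothNear V x →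
      FunSmoothNear I (fun y => mvfderiv I (fun y => inner ℝ (Z y) (W y)) y (U y)) x ∧
      mvfderiv I (fun y => mvfderiv I (fun y => inner ℝ (Z y) (W y)) y (U y)) x (V x)
        = inner ℝ (nabla (fun y => nabla Z y (U y)) x (V x)) (W x)
          + inner ℝ (nabla Z x (U x)) (nabla W x (V x))
          + (inner ℝ (nabla Z x (V x)) (nabla W x (U x))
            + inner ℝ (Z x) (nabla (fun y => nabla W y (U y)) x (V x))) := by
    intro U V hU hV
    have hZU := hU.nabla hs hZ
    have hWU := hU.nabla hs hW
    refine ⟨((hZU.inner hW).add (hZ.inner hWU)).congr (h1 hU), ?_⟩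
    have h3 : mvfderiv I (fun y => mvfderiv I (fun y => inner ℝ (Z y) (W y)) y (U y)) x (V x)
        = mvfderiv I (fun y => inner ℝ (nabla Z y (U y)) (W y)
          + inner ℝ (Z y) (nabla W y (U y))) x (V x) := by
      rw [mvfderiv_congr (h1 hU)]
    rw [h3]
    refine (congrArg (fun L => L (V x)) (mvfderiv_add (hZU.inner hW).mdifferentiableAt
      (hZ.inner hWU).mdifferentiableAt)).trans ?_
    simp only [_root_.add_apply]
    rw [h x (V x) _ _ hZU.mdifferentiableAt hW.mdifferentiableAt,
      h x (V x) _ _ hZ.mdifferentiableAt hWU.mdifferentiableAt]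
  -- The mixed terms `⟨∇Z, ∇W⟩` are symmetric in `X, Y` and cancel in the commutator; the bracket
  -- term completes the curvature.
  have h3 := mvfderiv_commutator hX hY (hZ.inner hW) (h2 hX hY).1 (h2 hY hX).1
  rw [(h2 hX hY).2, (h2 hY hX).2, h x _ _ _ hZ.mdifferentiableAt hW.mdifferentiableAt] at h3
  simp only [curvField, inner_sub_left, inner_sub_right]
  linarith

/-- The curvature acts trivially on a parallel 3-tensor field. -/
lemma curvField_parallel_three [Nontrivial E] (hs : nabla.ContMDiffCovariantDerivative ∞)
    {A : ∀ x : M, (Fin 3 → TangentSpace I x) → ℝ} (hA : ∀ y u, HasCovDerivAt nabla A y u 0)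
    (hm : ∀ y, IsMultilin (A y))
    (hsm : ∀ {U V W : ∀ y : M, TangentSpace I y}, SmoothNear U x → SmoothNear V x →
      SmoothNear W x → FunSmoothNear I (fun y => A y ![U y, V y, W y]) x)
    {Z₀ Z₁ Z₂ : ∀ y : M, TangentSpace I y} (hX : SmoothNear X x) (hY : SmoothNear Y x)
    (hZ₀ : SmoothNear Z₀ x) (hZ₁ : SmoothNear Z₁ x) (hZ₂ : SmoothNear Z₂ x) :
    A x ![curvField nabla X Y Z₀ x, Z₁ x, Z₂ x] + A x ![Z₀ x, curvField nabla X Y Z₁ x, Z₂ x]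
      + A x ![Z₀ x, Z₁ x, curvField nabla X Y Z₂ x] = 0 := by
  have h1 : ∀ {U : ∀ y : M, TangentSpace I y}, SmoothNear U x →
      (fun y => mvfderiv I (fun y => A y ![Z₀ y, Z₁ y, Z₂ y]) y (U y)) =ᶠ[𝓝 x]
      fun y => A y ![nabla Z₀ y (U y), Z₁ y, Z₂ y] + A y ![Z₀ y, nabla Z₁ y (U y), Z₂ y]
        + A y ![Z₀ y, Z₁ y, nabla Z₂ y (U y)] := by
    intro U hU
    filter_upwards [hZ₀.eventually, hZ₁.eventually, hZ₂.eventually] with y h2 h3 h4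
    rw [((hA y (U y)).three h2 h3 h4).2]
    simp
  have h2 : ∀ {U V : ∀ y : M, TangentSpace I y}, SmoothNear U x → SmoothNear V x →
      FunSmoothNear I (fun y => mvfderiv I (fun y => A y ![Z₀ y, Z₁ y, Z₂ y]) y (U y)) x ∧
      mvfderiv I (fun y => mvfderiv I (fun y => A y ![Z₀ y, Z₁ y, Z₂ y]) y (U y)) x (V x)
        = (A x ![nabla (fun y => nabla Z₀ y (U y)) x (V x), Z₁ x, Z₂ x]
            + A x ![nabla Z₀ x (U x), nabla Z₁ x (V x), Z₂ x]
            + A x ![nabla Z₀ x (U x), Z₁ x, nabla Z₂ x (V x)])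
          + (A x ![nabla Z₀ x (V x), nabla Z₁ x (U x), Z₂ x]
            + A x ![Z₀ x, nabla (fun y => nabla Z₁ y (U y)) x (V x), Z₂ x]
            + A x ![Z₀ x, nabla Z₁ x (U x), nabla Z₂ x (V x)])
          + (A x ![nabla Z₀ x (V x), Z₁ x, nabla Z₂ x (U x)]
            + A x ![Z₀ x, nabla Z₁ x (V x), nabla Z₂ x (U x)]
            + A x ![Z₀ x, Z₁ x, nabla (fun y => nabla Z₂ y (U y)) x (V x)]) := by
    intro U V hU hV
    have k0 := hU.nabla hs hZ₀
    have k1 := hU.nabla hs hZ₁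
    have k2 := hU.nabla hs hZ₂
    have m0 := hsm k0 hZ₁ hZ₂
    have m1 := hsm hZ₀ k1 hZ₂
    have m2 := hsm hZ₀ hZ₁ k2
    refine ⟨((m0.add m1).add m2).congr (h1 hU), ?_⟩
    have h3 : mvfderiv I (fun y => mvfderiv I (fun y => A y ![Z₀ y, Z₁ y, Z₂ y]) y (U y)) x (V x)
        = mvfderiv I (fun y => A y ![nabla Z₀ y (U y), Z₁ y, Z₂ y]
          + A y ![Z₀ y, nabla Z₁ y (U y), Z₂ y] + A y ![Z₀ y, Z₁ y, nabla Z₂ y (U y)]) x (V x) := by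
      rw [mvfderiv_congr (h1 hU)]
    rw [h3]
    refine (congrArg (fun L => L (V x)) (mvfderiv_add (m0.add m1).mdifferentiableAt
      m2.mdifferentiableAt)).trans ?_
    simp only [_root_.add_apply]
    refine (congrArg (fun s => s + _) (congrArg (fun L => L (V x))
      (mvfderiv_add m0.mdifferentiableAt m1.mdifferentiableAt))).trans ?_
    simp only [_root_.add_apply]
    rw [((hA x (V x)).three k0 hZ₁ hZ₂).2, ((hA x (V x)).three hZ₀ k1 hZ₂).2,
      ((hA x (V x)).three hZ₀ hZ₁ k2).2]
    simp
  -- The terms with derivatives in two different slots are symmetric in `X, Y` and cancel.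
  have h3 := mvfderiv_commutator hX hY (hsm hZ₀ hZ₁ hZ₂) (h2 hX hY).1 (h2 hY hX).1
  rw [(h2 hX hY).2, (h2 hY hX).2, ((hA x _).three hZ₀ hZ₁ hZ₂).2] at h3
  simp only [curvField, ((hm x).linear_zero _ _).map_sub, ((hm x).linear_one _ _).map_sub,
    ((hm x).linear_two _ _).map_sub]
  simp only [Pi.zero_apply] at h3
  linarith

lemma SmoothNear.torsion (hs : nabla.ContMDiffCovariantDerivative ∞)
    (hX : SmoothNear X x) (hY : SmoothNear Y x) :
    SmoothNear (fun y => nabla.torsion y (X y) (Y y)) x := by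
  have : CompleteSpace E := FiniteDimensional.complete ℝ E
  refine (((hX.nabla hs hY).sub (hY.nabla hs hX)).sub (hX.mlieBracket hY)).congr ?_
  filter_upwards [hX.eventually, hY.eventually] with y h1 h2
  exact nabla.torsion_apply h1.mdifferentiableAt h2.mdifferentiableAt

lemma isMultilin_torsionTensor (y : M) : IsMultilin (torsionTensor nabla y) := by
  refine ⟨{ toFun := torsionTensor nabla y, map_update_add' := ?_, map_update_smul' := ?_ },
    fun _ => rfl⟩
  · intro inst v i a b
    obtain rfl : inst = instDecidableEqFin 3 := Subsingleton.elim _ _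
    fin_cases i <;> simp [torsionTensor, inner_add_left, inner_add_right]
  · intro inst v i a b
    obtain rfl : inst = instDecidableEqFin 3 := Subsingleton.elim _ _
    fin_cases i <;> simp [torsionTensor, inner_smul_left, inner_smul_right]

lemma torsionTensor_smooth (hs : nabla.ContMDiffCovariantDerivative ∞)
    (hX : SmoothNear X x) (hY : SmoothNear Y x) (hZ : SmoothNear Z x) :
    FunSmoothNear I (fun y => torsionTensor nabla y ![X y, Y y, Z y]) x :=
  (hX.torsion hs hY).inner hZ

lemma hasCovDerivAt_torsionTensor (hs : nabla.ContMDiffCovariantDerivative ∞)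
    (u : TangentSpace I x) :
    HasCovDerivAt nabla (torsionTensor nabla) x u (covDeriv nabla (torsionTensor nabla) x u) :=
  HasCovDerivAt.of_isMultilin isMultilin_torsionTensor
    (fun _ hX => (((hX 0).torsion hs (hX 1)).inner (hX 2)).mdifferentiableAt) u

/-- The first Bianchi identity for a metric connection with torsion. -/
theorem bianchi (h : IsMetric nabla) (hs : nabla.ContMDiffCovariantDerivative ∞)
    (u v w z : TangentSpace I x) :
    inner ℝ (curvature nabla x u v w) z + inner ℝ (curvature nabla x v w u) z
      + inner ℝ (curvature nabla x w u v) z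
    = covDeriv nabla (torsionTensor nabla) x u ![v, w, z]
      + covDeriv nabla (torsionTensor nabla) x v ![w, u, z]
      + covDeriv nabla (torsionTensor nabla) x w ![u, v, z]
      + torsionTensor nabla x ![nabla.torsion x u v, w, z]
      + torsionTensor nabla x ![nabla.torsion x v w, u, z]
      + torsionTensor nabla x ![nabla.torsion x w u, v, z] := by
  have : CompleteSpace E := FiniteDimensional.complete ℝ E
  have : IsManifold I (minSmoothness ℝ 3) M := by
    rw [minSmoothness_of_isRCLikeNormedField]
    infer_instance
  have hle : minSmoothness ℝ 2 ≤ (∞ : WithTop ℕ∞) := by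
    rw [minSmoothness_of_isRCLikeNormedField]; exact ENat.LEInfty.out
  simp only [curvature_eq_curvField]
  have hU : SmoothNear (I := I) (FiberBundle.extend E u) x := .extend u
  have hV : SmoothNear (I := I) (FiberBundle.extend E v) x := .extend v
  have hW : SmoothNear (I := I) (FiberBundle.extend E w) x := .extend w
  have hZ : SmoothNear (I := I) (FiberBundle.extend E z) x := .extend z
  have eU : (FiberBundle.extend E u : ∀ y : M, TangentSpace I y) x = u := by simp
  have eV : (FiberBundle.extend E v : ∀ y : M, TangentSpace I y) x = v := by simp
  have eW : (FiberBundle.extend E w : ∀ y : M, TangentSpace I y) x = w := by simp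
  have eZ : (FiberBundle.extend E z : ∀ y : M, TangentSpace I y) x = z := by simp
  generalize (FiberBundle.extend E u : ∀ y : M, TangentSpace I y) = U at *
  generalize (FiberBundle.extend E v : ∀ y : M, TangentSpace I y) = V at *
  generalize (FiberBundle.extend E w : ∀ y : M, TangentSpace I y) = W at *
  generalize (FiberBundle.extend E z : ∀ y : M, TangentSpace I y) = Z at *
  subst eU eV eW eZ
  -- Differentiate `∇_Q R - ∇_R Q = T(Q,R) + [Q,R]` along `P`, and use `∇_P [Q,R] - ∇_{[Q,R]} P =
  -- T(P,[Q,R]) + [P,[Q,R]]`. The cyclic sum of the left sides is the cyclic sum of the curvature.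
  have key : ∀ {P Q R : ∀ y : M, TangentSpace I y}, SmoothNear P x → SmoothNear Q x →
      SmoothNear R x →
      inner ℝ (nabla (fun y => nabla R y (Q y)) x (P x)) (Z x)
        - inner ℝ (nabla (fun y => nabla Q y (R y)) x (P x)) (Z x)
        - inner ℝ (nabla P x (VectorField.mlieBracket I Q R x)) (Z x)
      = covDeriv nabla (torsionTensor nabla) x (P x) ![Q x, R x, Z x]
        + inner ℝ (nabla.torsion x (nabla Q x (P x)) (R x)) (Z x)
        + inner ℝ (nabla.torsion x (Q x) (nabla R x (P x))) (Z x)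
        + inner ℝ (nabla.torsion x (P x) (VectorField.mlieBracket I Q R x)) (Z x)
        + inner ℝ (VectorField.mlieBracket I P (VectorField.mlieBracket I Q R) x) (Z x) := by
    intro P Q R hP hQ hR
    have h1 : nabla (fun y => nabla R y (Q y)) x (P x) - nabla (fun y => nabla Q y (R y)) x (P x)
        = nabla (fun y => nabla.torsion y (Q y) (R y)) x (P x)
          + nabla (VectorField.mlieBracket I Q R) x (P x) := by
      have hcov := nabla.isCovariantDerivativeOn (s := Set.univ)
      have e1 := hcov.add (hQ.torsion hs hR).mdifferentiableAt
        (hR.nabla hs hQ).mdifferentiableAt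
      have e2 := hcov.add (((hQ.torsion hs hR).add (hR.nabla hs hQ))).mdifferentiableAt
        (hQ.mlieBracket hR).mdifferentiableAt
      have e3 := hcov.congr_of_eventuallyEq (hQ.nabla hs hR).mdifferentiableAt
        (((hQ.torsion hs hR).add (hR.nabla hs hQ)).add (hQ.mlieBracket hR)).mdifferentiableAt
        Filter.univ_mem (by
          filter_upwards [hQ.eventually, hR.eventually] with y h1 h2
          simp only [Pi.add_apply]
          rw [nabla.torsion_apply h1.mdifferentiableAt h2.mdifferentiableAt]
          abel)
      rw [e3, e2, e1]
      simp only [_root_.add_apply]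
      abel
    have h2 := nabla.torsion_apply hP.mdifferentiableAt (hQ.mlieBracket hR).mdifferentiableAt
    have h3 := ((hasCovDerivAt_torsionTensor hs (P x)).three hQ hR hZ).2
    have h4 := h x (P x) _ _ (hQ.torsion hs hR).mdifferentiableAt hZ.mdifferentiableAt
    have h5 : (fun y => inner ℝ (nabla.torsion y (Q y) (R y)) (Z y))
      = fun y => torsionTensor nabla y ![Q y, R y, Z y] := rfl
    rw [h5, h3] at h4
    simp only [torsionTensor, Matrix.cons_val_zero, Matrix.cons_val_one, Matrix.cons_val] at h4
    rw [← inner_sub_left, h1, h2]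
    simp only [inner_add_left, inner_sub_left]
    linarith
  -- The double brackets disappear from the cyclic sum by the Jacobi identity.
  have hj := VectorField.leibniz_identity_mlieBracket_apply (hU.contMDiffAt.of_le hle)
    (hV.contMDiffAt.of_le hle) (hW.contMDiffAt.of_le hle)
  have hj2 : VectorField.mlieBracket I V (VectorField.mlieBracket I W U) x
      = -VectorField.mlieBracket I V (VectorField.mlieBracket I U W) x := by
    have h1 : VectorField.mlieBracket I W U = (-1 : ℝ) • VectorField.mlieBracket I U W := by
      rw [VectorField.mlieBracket_swap]; simp
    rw [h1, VectorField.mlieBracket_const_smul_right (hU.mlieBracket hW).mdifferentiableAt]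
    simp
  rw [VectorField.mlieBracket_swap_apply (V := VectorField.mlieBracket I U V)] at hj
  have hj3 := congrArg (fun a => inner ℝ a (Z x)) hj
  have hj4 := congrArg (fun a => inner ℝ a (Z x)) hj2
  simp only [inner_add_left, inner_neg_left] at hj3 hj4
  have kU := key hU hV hW
  have kV := key hV hW hU
  have kW := key hW hU hV
  -- Unfolding the inner torsion in `T(T(P,Q),R)` produces exactly the terms `T(∇Q, ·)` and
  -- `T(·,[·,·])` left over by `key`.
  have hT : ∀ {P Q : ∀ y : M, TangentSpace I y} (R : TangentSpace I x), SmoothNear P x →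
      SmoothNear Q x → inner ℝ (nabla.torsion x (nabla.torsion x (P x) (Q x)) R) (Z x)
      = -inner ℝ (nabla.torsion x R (nabla Q x (P x))) (Z x)
        - inner ℝ (nabla.torsion x (nabla P x (Q x)) R) (Z x)
        + inner ℝ (nabla.torsion x R (VectorField.mlieBracket I P Q x)) (Z x) := by
    intro P Q R hP hQ
    rw [nabla.torsion_apply hP.mdifferentiableAt hQ.mdifferentiableAt]
    simp only [map_sub, _root_.sub_apply, inner_sub_left]
    rw [nabla.torsion_antisymm R (nabla Q x (P x)),
      nabla.torsion_antisymm R (VectorField.mlieBracket I P Q x)]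
    simp only [inner_neg_left]
    ring
  simp only [curvField, torsionTensor, Matrix.cons_val_zero, Matrix.cons_val_one,
    Matrix.cons_val, inner_sub_left]
  have hA := fun (P Q : TangentSpace I x) => congrArg (fun a => inner ℝ a (Z x))
    (nabla.torsion_antisymm P Q)
  simp only [inner_neg_left] at hA
  rw [hT _ hU hV, hT _ hV hW, hT _ hW hU]
  linarith [hA (nabla V x (U x)) (W x), hA (nabla W x (V x)) (U x), hA (nabla U x (W x)) (V x),
    hA (V x) (nabla W x (U x)), hA (W x) (nabla U x (V x)), hA (U x) (nabla V x (W x))]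

end Curvature

/-! ### Hermitian linear algebra in complex dimension three: 4-forms. -/

section LinearAlgebra

variable {V : Type*} [NormedAddCommGroup V] [InnerProductSpace ℝ V]

lemma IsLinearMap.eq_zero_of_basis {ι : Type*} [Fintype ι] (b : OrthonormalBasis ι ℝ V)
    {f : V → ℝ} (hf : IsLinearMap ℝ f) (h : ∀ i, f (b i) = 0) (v : V) : f v = 0 := by
  have := b.toBasis.ext (f₁ := hf.mk') (f₂ := 0) (by simpa using h)
  exact congrArg (fun l => l v) this

/-- An alternating 4-form. -/
structure IsFourForm (A : V → V → V → V → ℝ) : Prop where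
  linear : ∀ b c d, IsLinearMap ℝ fun a => A a b c d
  swap₁ : ∀ a b c d, A a b c d = -A b a c d
  swap₂ : ∀ a b c d, A a b c d = -A a c b d
  swap₃ : ∀ a b c d, A a b c d = -A a b d c

namespace IsFourForm

variable {A : V → V → V → V → ℝ} (hA : IsFourForm A)
include hA

lemma linear₂ (a c d : V) : IsLinearMap ℝ fun b => A a b c d := by
  constructor
  · intro x y; simp only [hA.swap₁ a _ c d, (hA.linear a c d).map_add]; ring
  · intro r x; simp only [hA.swap₁ a _ c d, (hA.linear a c d).map_smul, smul_eq_mul]; ring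

lemma linear₃ (a b d : V) : IsLinearMap ℝ fun c => A a b c d := by
  constructor
  · intro x y; simp only [hA.swap₂ a b _ d, (hA.linear₂ a b d).map_add]; ring
  · intro r x; simp only [hA.swap₂ a b _ d, (hA.linear₂ a b d).map_smul, smul_eq_mul]; ring

lemma linear₄ (a b c : V) : IsLinearMap ℝ fun d => A a b c d := by
  constructor
  · intro x y; simp only [hA.swap₃ a b c _, (hA.linear₃ a b c).map_add]; ring
  · intro r x; simp only [hA.swap₃ a b c _, (hA.linear₃ a b c).map_smul, smul_eq_mul]; ring

lemma neg₂ (a b c d : V) : A a (-b) c d = -A a b c d := (hA.linear₂ a c d).map_neg b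

lemma neg₄ (a b c d : V) : A a b c (-d) = -A a b c d := (hA.linear₄ a b c).map_neg d

lemma self₁₂ (a c d : V) : A a a c d = 0 := by linarith [hA.swap₁ a a c d]
lemma self₂₃ (a b d : V) : A a b b d = 0 := by linarith [hA.swap₂ a b b d]

lemma self₁₃ (a b d : V) : A a b a d = 0 := by linarith [hA.swap₂ a b a d, hA.self₁₂ a b d]
lemma self₂₄ (a b c : V) : A a b c b = 0 := by linarith [hA.swap₃ a b c b, hA.self₂₃ a b c]
lemma self₁₄ (a b c : V) : A a b c a = 0 := by linarith [hA.swap₃ a b c a, hA.self₁₃ a b c]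

/-- The permutation that exchanges the two pairs is even. -/
lemma pair_swap (a b c d : V) : A a b c d = A c d a b := by
  rw [hA.swap₂ a b c d, hA.swap₁ a c b d, hA.swap₃ c a b d, hA.swap₂ c a d b]
  ring

lemma eq_zero_of_basis {ι : Type*} [Fintype ι] (e : OrthonormalBasis ι ℝ V)
    (h : ∀ i j k l, A (e i) (e j) (e k) (e l) = 0) (a b c d : V) : A a b c d = 0 :=
  IsLinearMap.eq_zero_of_basis e (hA.linear b c d) (fun i =>
    IsLinearMap.eq_zero_of_basis e (hA.linear₂ (e i) c d) (fun j =>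
      IsLinearMap.eq_zero_of_basis e (hA.linear₃ (e i) (e j) d) (fun k =>
        IsLinearMap.eq_zero_of_basis e (hA.linear₄ (e i) (e j) (e k)) (fun l => h i j k l) d) c)
      b) a

end IsFourForm

lemma IsMultilin.comp_three {f : (Fin 3 → V) → ℝ} (hf : IsMultilin f) (J K L : V →L[ℝ] V) :
    IsMultilin fun v : Fin 3 → V => f ![J (v 0), K (v 1), L (v 2)] := by
  have := hf.comp (L := ![J, K, L])
    (by intro i; fin_cases i <;> exact ⟨map_add _, map_smul _⟩)
  convert this using 3 with v
  ext i; fin_cases i <;> rfl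

/-- The orthonormal basis `e` of `V` is adapted to the complex structure `J`. -/
structure IsAdapted (J : V →L[ℝ] V) (e : OrthonormalBasis (Fin 6) ℝ V) : Prop where
  sq : ∀ v, J (J v) = -v
  isometry : ∀ v w, inner ℝ (J v) (J w) = inner ℝ v w
  apply_zero : J (e 0) = e 1
  apply_two : J (e 2) = e 3
  apply_four : J (e 4) = e 5

namespace IsAdapted

variable {J : V →L[ℝ] V} {e : OrthonormalBasis (Fin 6) ℝ V} (h : IsAdapted J e)
include h

lemma apply_one : J (e 1) = -e 0 := by rw [← h.apply_zero, h.sq]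
lemma apply_three : J (e 3) = -e 2 := by rw [← h.apply_two, h.sq]
lemma apply_five : J (e 5) = -e 4 := by rw [← h.apply_four, h.sq]

/-- Any four of the basis vectors include two that span a line or a complex line. -/
lemma pair (i j : Fin 6) (hij : i.val / 2 = j.val / 2) :
    e j = e i ∨ e j = J (e i) ∨ e j = -J (e i) := by
  fin_cases i <;> fin_cases j <;>
    first
    | (exfalso; revert hij; decide)
    | simp [h.apply_zero, h.apply_one, h.apply_two, h.apply_three, h.apply_four, h.apply_five]

/-- A 4-form vanishes if `A(X, JX, ·, ·) = 0`: there are no forms of type `(4,0)` in complex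
dimension three. -/
lemma fourForm_eq_zero {A : V → V → V → V → ℝ} (hA : IsFourForm A)
    (hJ : ∀ i c d, A (e i) (J (e i)) c d = 0) (a b c d : V) : A a b c d = 0 := by
  refine hA.eq_zero_of_basis e ?_ a b c d
  have h12 : ∀ i j : Fin 6, i.val / 2 = j.val / 2 → ∀ c d, A (e i) (e j) c d = 0 := by
    intro i j hij c d
    rcases h.pair i j hij with h1 | h1 | h1 <;> rw [h1]
    · exact hA.self₁₂ _ _ _
    · exact hJ _ _ _
    · rw [hA.neg₂, hJ, neg_zero]
  intro i j k l
  -- Pigeonhole: four basis vectors lie in three complex lines, so two of them share a line;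
  -- alternation brings those two to the front.
  have hp : ∀ p q r s : Fin 3, p = q ∨ p = r ∨ p = s ∨ q = r ∨ q = s ∨ r = s := by decide
  have hq := hp ⟨i.val / 2, by omega⟩ ⟨j.val / 2, by omega⟩ ⟨k.val / 2, by omega⟩
    ⟨l.val / 2, by omega⟩
  simp only [Fin.mk.injEq] at hq
  rcases hq with hq | hq | hq | hq | hq | hq
  · exact h12 i j hq _ _
  · rw [hA.swap₂, h12 i k hq, neg_zero]
  · rw [hA.swap₃, hA.swap₂, h12 i l hq]; simp
  · rw [hA.swap₁, hA.swap₂, h12 j k hq]; simp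
  · rw [hA.swap₁, hA.swap₃, hA.swap₂, h12 j l hq]; simp
  · rw [hA.pair_swap, h12 k l hq]

/-- The `(3,1)+(1,3)`-part of a 4-form in complex dimension three, contracted with a vector. -/
lemma fourForm_proj_J {A : V → V → V → V → ℝ} (hA : IsFourForm A) (u a b c : V) :
    A (J u) a b c - A (J u) (J a) (J b) c - A (J u) (J a) b (J c) - A (J u) a (J b) (J c)
      = -(A u (J a) b c - A u (J (J a)) (J b) c - A u (J (J a)) b (J c) - A u (J a) (J b) (J c)) := by
  -- `J` in one slot minus `J` in three slots. With slot eigenvalues `±i`, the first and third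
  -- elementary symmetric functions agree unless all four signs are equal, so `S` sees only the
  -- (4,0)+(0,4)-part, which is zero. Solving `S = 0` for the terms with `Ju` gives the claim.
  let S : V → V → V → V → ℝ := fun a b c d =>
    A (J a) b c d + A a (J b) c d + A a b (J c) d + A a b c (J d)
      - (A a (J b) (J c) (J d) + A (J a) b (J c) (J d) + A (J a) (J b) c (J d)
        + A (J a) (J b) (J c) d)
  have hS : IsFourForm S := by
    constructor
    · intro b c d
      constructor
      · intro x y
        simp only [S, map_add, (hA.linear _ _ _).map_add]
        ring
      · intro r x
        simp only [S, map_smul, (hA.linear _ _ _).map_smul, smul_eq_mul]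
        ring
    · intro a b c d
      simp only [S]
      rw [hA.swap₁ (J a) b c d, hA.swap₁ a (J b) c d, hA.swap₁ a b (J c) d, hA.swap₁ a b c (J d),
        hA.swap₁ a (J b) (J c) (J d), hA.swap₁ (J a) b (J c) (J d),
        hA.swap₁ (J a) (J b) c (J d), hA.swap₁ (J a) (J b) (J c) d]
      ring
    · intro a b c d
      simp only [S]
      rw [hA.swap₂ (J a) b c d, hA.swap₂ a (J b) c d, hA.swap₂ a b (J c) d, hA.swap₂ a b c (J d),
        hA.swap₂ a (J b) (J c) (J d), hA.swap₂ (J a) b (J c) (J d),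
        hA.swap₂ (J a) (J b) c (J d), hA.swap₂ (J a) (J b) (J c) d]
      ring
    · intro a b c d
      simp only [S]
      rw [hA.swap₃ (J a) b c d, hA.swap₃ a (J b) c d, hA.swap₃ a b (J c) d, hA.swap₃ a b c (J d),
        hA.swap₃ a (J b) (J c) (J d), hA.swap₃ (J a) b (J c) (J d),
        hA.swap₃ (J a) (J b) c (J d), hA.swap₃ (J a) (J b) (J c) d]
      ring
  have h0 : S u a b c = 0 := by
    refine h.fourForm_eq_zero hS (fun i c d => ?_) u a b c
    simp only [S, h.sq, hA.neg₂, hA.self₁₂]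
    linarith [hA.swap₁ (J (e i)) (e i) (J c) d, hA.swap₁ (J (e i)) (e i) c (J d)]
  simp only [S] at h0
  simp only [h.sq, hA.neg₂]
  linarith

/-- The contraction with the Kähler form is injective on 4-forms in complex dimension three. -/
lemma fourForm_eq_zero_of_contraction {A : V → V → V → V → ℝ} (hA : IsFourForm A)
    (hc : ∀ a b, A a b (e 0) (e 1) + A a b (e 2) (e 3) + A a b (e 4) (e 5) = 0)
    (a b c d : V) : A a b c d = 0 := by
  -- The components on pairs of complex lines, `z₁₂, z₁₃, z₂₃`, have all pairwise sums equal to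
  -- zero, hence vanish.
  have q1 := hc (e 0) (e 1)
  have q2 := hc (e 2) (e 3)
  have q3 := hc (e 4) (e 5)
  rw [hA.pair_swap (e 2) (e 3) (e 0) (e 1)] at q2
  rw [hA.pair_swap (e 4) (e 5) (e 0) (e 1), hA.pair_swap (e 4) (e 5) (e 2) (e 3)] at q3
  simp only [hA.self₁₃, add_zero, zero_add] at q1 q2 q3
  have z1 : A (e 0) (e 1) (e 2) (e 3) = 0 := by linarith
  have z2 : A (e 0) (e 1) (e 4) (e 5) = 0 := by linarith
  have z3 : A (e 2) (e 3) (e 4) (e 5) = 0 := by linarith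
  have z1' : A (e 2) (e 3) (e 0) (e 1) = 0 := by rw [hA.pair_swap, z1]
  have z2' : A (e 4) (e 5) (e 0) (e 1) = 0 := by rw [hA.pair_swap, z2]
  have z3' : A (e 4) (e 5) (e 2) (e 3) = 0 := by rw [hA.pair_swap, z3]
  -- For `eᵢ, eⱼ` in different complex lines, two terms of the contraction repeat a vector, so the
  -- third vanishes as well.
  have hlt : ∀ i j : Fin 6, i < j → A (e i) (e j) (e 0) (e 1) = 0 ∧ A (e i) (e j) (e 2) (e 3) = 0 ∧
      A (e i) (e j) (e 4) (e 5) = 0 := by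
    intro i j hij
    have := hc (e i) (e j)
    fin_cases i <;> fin_cases j <;>
      first
      | (exfalso; revert hij; decide)
      | (simp [hA.self₁₃, hA.self₂₄, hA.self₁₄, hA.self₂₃, z1, z2, z3, z1', z2', z3'] at this ⊢ <;>
          assumption)
  have hall : ∀ i j : Fin 6, A (e i) (e j) (e 0) (e 1) = 0 ∧ A (e i) (e j) (e 2) (e 3) = 0 ∧
      A (e i) (e j) (e 4) (e 5) = 0 := by
    intro i j
    rcases lt_trichotomy i j with hij | hij | hij
    · exact hlt i j hij
    · subst hij; simp [hA.self₁₂]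
    · rw [hA.swap₁ (e i), hA.swap₁ (e i), hA.swap₁ (e i)]
      simpa using hlt j i hij
  have hz : ∀ (k : Fin 6), (∀ i j, A (e i) (e j) (e k) (J (e k)) = 0) := by
    intro k i j
    obtain ⟨h1, h2, h3⟩ := hall i j
    fin_cases k <;> simp [h.apply_zero, h.apply_one, h.apply_two, h.apply_three, h.apply_four,
      h.apply_five, hA.neg₄, h1, h2, h3]
    · rw [hA.swap₃, h1, neg_zero]
    · rw [hA.swap₃, h2, neg_zero]
    · rw [hA.swap₃, h3, neg_zero]
  refine h.fourForm_eq_zero hA (fun i c d => ?_) a b c d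
  rw [hA.pair_swap]
  exact IsLinearMap.eq_zero_of_basis e (hA.linear d _ _) (fun k =>
    IsLinearMap.eq_zero_of_basis e (hA.linear₂ (e k) _ _) (fun l => hz i k l) d) c

/-- The isometry of `V` defined by `J`. -/
def equiv : V ≃ₗᵢ[ℝ] V :=
  LinearIsometryEquiv.mk (LinearEquiv.ofLinearMap (J : V →ₗ[ℝ] V) (-(J : V →ₗ[ℝ] V))
    (by ext v; simp [h.sq]) (by ext v; simp [h.sq])) fun v => by
      have h1 := h.isometry v v
      rw [real_inner_self_eq_norm_sq, real_inner_self_eq_norm_sq] at h1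
      exact (pow_left_inj₀ (norm_nonneg _) (norm_nonneg _) two_ne_zero).1 h1

variable {ι : Type*} [Fintype ι] (b : OrthonormalBasis ι ℝ V)

/-- An isometry carries an orthonormal basis to an orthonormal basis, and the trace does not depend
on the basis. -/
lemma sum_bilin_J {B : V → V → ℝ} (h1 : ∀ w, IsLinearMap ℝ fun v => B v w)
    (h2 : ∀ v, IsLinearMap ℝ (B v)) : ∑ i, B (b i) (b i) = ∑ i, B (J (b i)) (J (b i)) := by
  rw [sum_bilin_eq b (b.map h.equiv) h1 h2]
  simp only [OrthonormalBasis.map_apply]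
  rfl

section Toggle

variable {f g : (Fin 3 → V) → ℝ} (hf : IsMultilin f) (hg : IsMultilin g)
include hf hg

/-- `J` may be inserted into the same slot of both factors. With `J² = -1`, these three moves
generate all the norm identities below. -/
lemma sum_three_J_zero : ∑ i, ∑ j, ∑ k, f ![b i, b j, b k] * g ![b i, b j, b k]
    = ∑ i, ∑ j, ∑ k, f ![J (b i), b j, b k] * g ![J (b i), b j, b k] :=
  h.sum_bilin_J b (B := fun x y => ∑ j, ∑ k, f ![x, b j, b k] * g ![y, b j, b k])
    (fun _ => IsLinearMap.finset_sum fun _ => IsLinearMap.finset_sum fun _ =>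
      IsLinearMap.mul_const (hf.linear_zero _ _) _)
    (fun _ => IsLinearMap.finset_sum fun _ => IsLinearMap.finset_sum fun _ =>
      IsLinearMap.const_mul (hg.linear_zero _ _) _)

lemma sum_three_J_one : ∑ i, ∑ j, ∑ k, f ![b i, b j, b k] * g ![b i, b j, b k]
    = ∑ i, ∑ j, ∑ k, f ![b i, J (b j), b k] * g ![b i, J (b j), b k] :=
  Finset.sum_congr rfl fun i _ =>
    h.sum_bilin_J b (B := fun x y => ∑ k, f ![b i, x, b k] * g ![b i, y, b k])
      (fun _ => IsLinearMap.finset_sum fun _ => IsLinearMap.mul_const (hf.linear_one _ _) _)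
      (fun _ => IsLinearMap.finset_sum fun _ => IsLinearMap.const_mul (hg.linear_one _ _) _)

lemma sum_three_J_two : ∑ i, ∑ j, ∑ k, f ![b i, b j, b k] * g ![b i, b j, b k]
    = ∑ i, ∑ j, ∑ k, f ![b i, b j, J (b k)] * g ![b i, b j, J (b k)] :=
  Finset.sum_congr rfl fun i _ => Finset.sum_congr rfl fun j _ =>
    h.sum_bilin_J b (B := fun x y => f ![b i, b j, x] * g ![b i, b j, y])
      (fun _ => IsLinearMap.mul_const (hf.linear_two _ _) _)
      (fun _ => IsLinearMap.const_mul (hg.linear_two _ _) _)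

end Toggle

/-- The contraction with the Kähler form in an adapted basis. -/
lemma sum_contraction {B : V → V → ℝ} (h1 : ∀ w, IsLinearMap ℝ fun v => B v w)
    (h2 : ∀ v, IsLinearMap ℝ (B v)) (hs : ∀ v w, B v w = -B w v) :
    ∑ i, B (b i) (J (b i)) = 2 * (B (e 0) (e 1) + B (e 2) (e 3) + B (e 4) (e 5)) := by
  have hJ : ∀ v, IsLinearMap ℝ fun w => B v (J w) := by
    intro v
    constructor
    · intro x y; rw [map_add, (h2 v).map_add]
    · intro r x; rw [map_smul, (h2 v).map_smul]
  rw [sum_bilin_eq b e (B := fun v w => B v (J w)) (fun w => h1 _) hJ]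
  simp only [Fin.sum_univ_six, h.apply_zero, h.apply_one, h.apply_two, h.apply_three, h.apply_four,
    h.apply_five, (h2 _).map_neg]
  rw [hs (e 1), hs (e 3), hs (e 5)]
  ring

end IsAdapted

/-! ### 3-forms and their (3,0)+(0,3)-type. -/

/-- An alternating 3-form. -/
structure IsThreeForm (f : (Fin 3 → V) → ℝ) : Prop where
  multilin : IsMultilin f
  swap₁ : ∀ a b c, f ![a, b, c] = -f ![b, a, c]
  swap₂ : ∀ a b c, f ![a, b, c] = -f ![a, c, b]

namespace IsThreeForm

variable {f : (Fin 3 → V) → ℝ} (hf : IsThreeForm f)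
include hf

lemma self₁₂ (a c : V) : f ![a, a, c] = 0 := by linarith [hf.swap₁ a a c]
lemma self₂₃ (a b : V) : f ![a, b, b] = 0 := by linarith [hf.swap₂ a b b]
lemma self₁₃ (a b : V) : f ![a, b, a] = 0 := by linarith [hf.swap₂ a b a, hf.self₁₂ a b]
lemma neg₁ (a b c : V) : f ![-a, b, c] = -f ![a, b, c] := (hf.multilin.linear_zero b c).map_neg a
lemma neg₂ (a b c : V) : f ![a, -b, c] = -f ![a, b, c] := (hf.multilin.linear_one a c).map_neg b
lemma neg₃ (a b c : V) : f ![a, b, -c] = -f ![a, b, c] := (hf.multilin.linear_two a b).map_neg c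

end IsThreeForm

/-- A real 3-form of type `(3,0)+(0,3)`. -/
structure IsTypeThreeZero (J : V →L[ℝ] V) (f : (Fin 3 → V) → ℝ) : Prop extends IsThreeForm f where
  J_J : ∀ a b c, f ![J a, J b, c] = -f ![a, b, c]

namespace IsTypeThreeZero

variable {J : V →L[ℝ] V} {e : OrthonormalBasis (Fin 6) ℝ V} {f g : (Fin 3 → V) → ℝ}

/-- `J` can be moved between slots: such a form is the real part of a complex trilinear one. -/
lemma J_two (hf : IsTypeThreeZero J f) (h : IsAdapted J e) (a b c : V) :
    f ![a, J b, c] = f ![J a, b, c] := by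
  have := hf.J_J (J a) b c
  rw [h.sq, hf.neg₁] at this
  linarith

lemma J_three (hf : IsTypeThreeZero J f) (h : IsAdapted J e) (a b c : V) :
    f ![a, b, J c] = f ![J a, b, c] := by
  rw [hf.swap₂, hf.J_two h, ← hf.swap₂]

/-- The type has one complex dimension: the two given values are the real coordinates, and all other
components on the basis are obtained from them by moving `J` or are zero. -/
lemma eq_zero (hf : IsTypeThreeZero J f) (h : IsAdapted J e) (h0 : f ![e 0, e 2, e 4] = 0)
    (h1 : f ![e 1, e 2, e 4] = 0) (a b c : V) : f ![a, b, c] = 0 := by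
  have h2 : f ![e 0, e 3, e 4] = 0 := by
    rw [← h.apply_two, hf.J_two h, h.apply_zero, h1]
  have h3 : f ![e 1, e 3, e 4] = 0 := by
    rw [← h.apply_zero, ← h.apply_two, hf.J_J, h0, neg_zero]
  -- Moving `J` to the first slot leaves the value unchanged, whereas alternation changes its sign.
  have hself : ∀ a c, f ![a, J a, c] = 0 := by
    intro a c
    have := hf.swap₁ a (J a) c
    rw [hf.J_two h] at this ⊢
    linarith
  have h01 : ∀ c, f ![e 0, e 1, c] = 0 := fun c => h.apply_zero ▸ hself _ c
  have h23 : ∀ c, f ![e 2, e 3, c] = 0 := fun c => h.apply_two ▸ hself _ c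
  have h45 : ∀ c, f ![c, e 5, e 4] = 0 := fun c => by
    rw [hf.swap₂, hf.swap₁, ← h.apply_four, hf.swap₂, hself]; simp
  have h01' : ∀ c, f ![e 0, c, e 1] = 0 := fun c => by rw [hf.swap₂, h01, neg_zero]
  have h01'' : ∀ c, f ![c, e 0, e 1] = 0 := fun c => by rw [hf.swap₁, h01', neg_zero]
  have h10 : ∀ c, f ![e 1, c, e 0] = 0 := fun c => by
    rw [hf.swap₁, hf.swap₂, h01'', neg_zero, neg_zero]
  have h23' : ∀ c, f ![e 2, c, e 3] = 0 := fun c => by rw [hf.swap₂, h23, neg_zero]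
  have h23'' : ∀ c, f ![c, e 2, e 3] = 0 := fun c => by rw [hf.swap₁, h23', neg_zero]
  have h32' : ∀ c, f ![c, e 3, e 2] = 0 := fun c => by rw [hf.swap₂, h23'', neg_zero]
  have hlift : ∀ k, (∀ i j, i < j → f ![e i, e j, e k] = 0) → ∀ a b, f ![a, b, e k] = 0 := by
    intro k hk a b
    refine IsLinearMap.eq_zero_of_basis e (hf.multilin.linear_zero _ _) (fun i => ?_) a
    refine IsLinearMap.eq_zero_of_basis e (hf.multilin.linear_one _ _) (fun j => ?_) b
    rcases lt_trichotomy i j with hij | hij | hij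
    · exact hk i j hij
    · subst hij; exact hf.self₁₂ _ _
    · rw [hf.swap₁, hk j i hij, neg_zero]
  have H4 : ∀ a b, f ![a, b, e 4] = 0 := by
    refine hlift 4 fun i j hij => ?_
    fin_cases i <;> fin_cases j <;>
      first
      | (exfalso; revert hij; decide)
      | simp [h0, h1, h2, h3, h01, h23, h45, hf.self₂₃]
  have H5 : ∀ a b, f ![a, b, e 5] = 0 := fun a b => by
    rw [← h.apply_four, hf.J_three h, H4]
  have H4' : ∀ a b, f ![a, e 4, b] = 0 := fun a b => by rw [hf.swap₂, H4, neg_zero]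
  have H5' : ∀ a b, f ![a, e 5, b] = 0 := fun a b => by rw [hf.swap₂, H5, neg_zero]
  refine IsLinearMap.eq_zero_of_basis e (hf.multilin.linear_two a b) (fun k => ?_) c
  refine hlift k (fun i j hij => ?_) a b
  fin_cases k <;> [skip; skip; skip; skip; exact H4 _ _; exact H5 _ _] <;>
    fin_cases i <;> fin_cases j <;>
      first
      | (exfalso; revert hij; decide)
      | simp [h01, h23, hf.self₂₃, hf.self₁₃, H4', H5', h01', h10, h32', h23'']

/-- The complex structure on the line of such forms: rotating one argument keeps the type. -/
lemma comp_J (hf : IsTypeThreeZero J f) (h : IsAdapted J e) :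
    IsTypeThreeZero J fun v => f ![J (v 0), v 1, v 2] := by
  refine ⟨⟨?_, fun a b c => ?_, fun a b c => ?_⟩, fun a b c => ?_⟩
  · exact IsMultilin.comp_three hf.multilin J (.id ℝ V) (.id ℝ V)
  · change f ![J a, b, c] = -f ![J b, a, c]
    rw [← hf.J_two h, hf.swap₁]
  · exact hf.swap₂ _ _ _
  · change f ![J (J a), J b, c] = -f ![J a, b, c]
    rw [hf.J_J]

lemma lin_comb (hf : IsTypeThreeZero J f) (hg : IsTypeThreeZero J g) (r s : ℝ) :
    IsTypeThreeZero J fun v => r * f v + s * g v := by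
  refine ⟨⟨(hf.multilin.const_mul r).add (hg.multilin.const_mul s), fun a b c => ?_,
    fun a b c => ?_⟩, fun a b c => ?_⟩
  · rw [hf.swap₁, hg.swap₁]; ring
  · rw [hf.swap₂, hg.swap₂]; ring
  · rw [hf.J_J, hg.J_J]; ring

/-- The forms of type `(3,0)+(0,3)` form a complex line: a form orthogonal to `f` and to `Jf`
vanishes. -/
lemma eq_zero_of_orthogonal (hf : IsTypeThreeZero J f) (hg : IsTypeThreeZero J g)
    (h : IsAdapted J e) {ι : Type*} [Fintype ι] (b : OrthonormalBasis ι ℝ V)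
    (h1 : ∑ i, ∑ j, ∑ k, g ![b i, b j, b k] * f ![b i, b j, b k] = 0)
    (h2 : ∑ i, ∑ j, ∑ k, g ![J (b i), b j, b k] * f ![b i, b j, b k] = 0)
    (hne : ∑ i, ∑ j, ∑ k, f ![b i, b j, b k] ^ 2 ≠ 0) (x y z : V) : g ![x, y, z] = 0 := by
  obtain ⟨p, hp⟩ : ∃ p, p = f ![e 0, e 2, e 4] := ⟨_, rfl⟩
  obtain ⟨q, hq⟩ : ∃ q, q = f ![e 1, e 2, e 4] := ⟨_, rfl⟩
  obtain ⟨p', hp'⟩ : ∃ p, p = g ![e 0, e 2, e 4] := ⟨_, rfl⟩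
  obtain ⟨q', hq'⟩ : ∃ q, q = g ![e 1, e 2, e 4] := ⟨_, rfl⟩
  have hD : p ^ 2 + q ^ 2 ≠ 0 := by
    intro h0
    have hp0 : p = 0 := by nlinarith [sq_nonneg p, sq_nonneg q]
    have hq0 : q = 0 := by nlinarith [sq_nonneg p, sq_nonneg q]
    refine hne (Finset.sum_eq_zero fun i _ => Finset.sum_eq_zero fun j _ =>
      Finset.sum_eq_zero fun k _ => ?_)
    rw [hf.eq_zero h (hp ▸ hp0) (hq ▸ hq0)]
    simp
  have hfJ := hf.comp_J h
  -- In the coordinates of `IsTypeThreeZero.eq_zero`, `f` is `(p, q)` and `f(J·,·,·)` is `(q, -p)`;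
  -- Cramer's rule expresses `g = (p', q')` through these two.
  have key : ∀ x y z, (p ^ 2 + q ^ 2) * g ![x, y, z]
      = (p * p' + q * q') * f ![x, y, z] + (q * p' - p * q') * f ![J x, y, z] := by
    intro x y z
    have h3 := (hg.lin_comb (hf.lin_comb hfJ (p * p' + q * q') (q * p' - p * q'))
      (p ^ 2 + q ^ 2) (-1)).eq_zero h ?_ ?_ x y z
    · simp only [Matrix.cons_val_zero, Matrix.cons_val_one, Matrix.cons_val] at h3
      linarith
    · simp only [Matrix.cons_val_zero, Matrix.cons_val_one, Matrix.cons_val, h.apply_zero,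
        ← hp, ← hq, ← hp']
      ring
    · simp only [Matrix.cons_val_zero, Matrix.cons_val_one, Matrix.cons_val, h.apply_one,
        hf.neg₁, ← hp, ← hq, ← hq']
      ring
  -- Inserting `J` into the first slots changes the sign of this product, so `f` and `f(J·,·,·)` are
  -- orthogonal. The sums `e1`, `e2` then isolate the two coefficients.
  have hJ0 : ∑ i, ∑ j, ∑ k, f ![J (b i), b j, b k] * f ![b i, b j, b k] = 0 := by
    have := h.sum_three_J_zero b hfJ.multilin hf.multilin
    simp only [Matrix.cons_val_zero, Matrix.cons_val_one, Matrix.cons_val, h.sq, hf.neg₁,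
      neg_mul, Finset.sum_neg_distrib] at this
    simp only [mul_comm (f ![b _, b _, b _])] at this
    linarith
  have e1 : (p ^ 2 + q ^ 2) * ∑ i, ∑ j, ∑ k, g ![b i, b j, b k] * f ![b i, b j, b k]
      = (p * p' + q * q') * ∑ i, ∑ j, ∑ k, f ![b i, b j, b k] ^ 2
        + (q * p' - p * q') * ∑ i, ∑ j, ∑ k, f ![J (b i), b j, b k] * f ![b i, b j, b k] := by
    simp only [Finset.mul_sum, ← Finset.sum_add_distrib, ← mul_assoc, key]
    refine Finset.sum_congr rfl fun i _ => Finset.sum_congr rfl fun j _ =>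
      Finset.sum_congr rfl fun k _ => ?_
    ring
  have e2 : (p ^ 2 + q ^ 2) * ∑ i, ∑ j, ∑ k, g ![J (b i), b j, b k] * f ![b i, b j, b k]
      = (p * p' + q * q') * ∑ i, ∑ j, ∑ k, f ![J (b i), b j, b k] * f ![b i, b j, b k]
        - (q * p' - p * q') * ∑ i, ∑ j, ∑ k, f ![b i, b j, b k] ^ 2 := by
    simp only [Finset.mul_sum, ← Finset.sum_sub_distrib, ← mul_assoc, key, h.sq, hf.neg₁]
    refine Finset.sum_congr rfl fun i _ => Finset.sum_congr rfl fun j _ =>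
      Finset.sum_congr rfl fun k _ => ?_
    ring
  rw [h1, hJ0, mul_zero, mul_zero, add_zero] at e1
  rw [h2, hJ0, mul_zero, mul_zero, zero_sub] at e2
  have z1 := (mul_eq_zero.1 e1.symm).resolve_right hne
  have z2 := (mul_eq_zero.1 (neg_eq_zero.1 e2.symm)).resolve_right hne
  have := key x y z
  rw [z1, z2, zero_mul, zero_mul, add_zero] at this
  exact (mul_eq_zero.1 this).resolve_left hD

end IsTypeThreeZero

/-! ### Quadratic invariants of a 3-form: `t = Σ T²` and `q = Σ T(a,b,c) T(Ja,Jb,c)`. -/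

section ThreeForm

variable {J : V →L[ℝ] V} {e : OrthonormalBasis (Fin 6) ℝ V} (h : IsAdapted J e)
  {ι : Type*} [Fintype ι] (b : OrthonormalBasis ι ℝ V) {T : (Fin 3 → V) → ℝ} (hT : IsThreeForm T)
include h hT

/-- Relabelling summation indices, with the two signs cancelling: the choice of the two slots that
carry `J` is irrelevant. -/
lemma IsThreeForm.sum_J_one_three : ∑ i, ∑ j, ∑ k, T ![b i, b j, b k] * T ![J (b i), b j, J (b k)]
    = ∑ i, ∑ j, ∑ k, T ![b i, b j, b k] * T ![J (b i), J (b j), b k] := by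
  refine Finset.sum_congr rfl fun i _ => ?_
  rw [Finset.sum_comm]
  refine Finset.sum_congr rfl fun j _ => Finset.sum_congr rfl fun k _ => ?_
  rw [hT.swap₂ _ (b k), hT.swap₂ _ (b k), neg_mul_neg]

lemma IsThreeForm.sum_J_two_three : ∑ i, ∑ j, ∑ k, T ![b i, b j, b k] * T ![b i, J (b j), J (b k)]
    = ∑ i, ∑ j, ∑ k, T ![b i, b j, b k] * T ![J (b i), J (b j), b k] := by
  rw [← hT.sum_J_one_three h b, Finset.sum_comm]
  refine Finset.sum_congr rfl fun i _ => Finset.sum_congr rfl fun j _ =>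
    Finset.sum_congr rfl fun k _ => ?_
  rw [hT.swap₁ (b j), hT.swap₁ (b j), neg_mul_neg]

/-- Inserting `J` into the first slots produces `J²` in one factor, hence the sign. -/
lemma IsThreeForm.sum_J_one_mul_J_two :
    ∑ i, ∑ j, ∑ k, T ![J (b i), b j, b k] * T ![b i, J (b j), b k]
      = -∑ i, ∑ j, ∑ k, T ![b i, b j, b k] * T ![J (b i), J (b j), b k] := by
  have := h.sum_three_J_zero b (IsMultilin.comp_three hT.multilin J (.id ℝ V) (.id ℝ V))
    (IsMultilin.comp_three hT.multilin (.id ℝ V) J (.id ℝ V))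
  simpa [h.sq, hT.neg₁] using this

lemma IsThreeForm.sum_J_one_mul_J_three :
    ∑ i, ∑ j, ∑ k, T ![J (b i), b j, b k] * T ![b i, b j, J (b k)]
      = -∑ i, ∑ j, ∑ k, T ![b i, b j, b k] * T ![J (b i), J (b j), b k] := by
  have := h.sum_three_J_zero b (IsMultilin.comp_three hT.multilin J (.id ℝ V) (.id ℝ V))
    (IsMultilin.comp_three hT.multilin (.id ℝ V) (.id ℝ V) J)
  rw [← hT.sum_J_one_three h b]
  simpa [h.sq, hT.neg₁] using this

lemma IsThreeForm.sum_J_two_mul_J_three :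
    ∑ i, ∑ j, ∑ k, T ![b i, J (b j), b k] * T ![b i, b j, J (b k)]
      = -∑ i, ∑ j, ∑ k, T ![b i, b j, b k] * T ![J (b i), J (b j), b k] := by
  have := h.sum_three_J_one b (IsMultilin.comp_three hT.multilin (.id ℝ V) J (.id ℝ V))
    (IsMultilin.comp_three hT.multilin (.id ℝ V) (.id ℝ V) J)
  rw [← hT.sum_J_two_three h b]
  simpa [h.sq, hT.neg₂] using this

/-- The squared norm of four times the `(3,0)+(0,3)`-part of a 3-form. -/
lemma IsThreeForm.sum_sq_proj :
    ∑ i, ∑ j, ∑ k, (T ![b i, b j, b k] - T ![J (b i), J (b j), b k] - T ![J (b i), b j, J (b k)]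
        - T ![b i, J (b j), J (b k)]) ^ 2
      = 4 * ∑ i, ∑ j, ∑ k, T ![b i, b j, b k] ^ 2
        - 12 * ∑ i, ∑ j, ∑ k, T ![b i, b j, b k] * T ![J (b i), J (b j), b k] := by
  have m100 := IsMultilin.comp_three hT.multilin J (.id ℝ V) (.id ℝ V)
  have m010 := IsMultilin.comp_three hT.multilin (.id ℝ V) J (.id ℝ V)
  have m001 := IsMultilin.comp_three hT.multilin (.id ℝ V) (.id ℝ V) J
  have t000 := h.sum_three_J_zero b hT.multilin hT.multilin
  have t000' := h.sum_three_J_one b hT.multilin hT.multilin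
  have t100 := h.sum_three_J_one b m100 m100
  have t100' := h.sum_three_J_two b m100 m100
  have t010 := h.sum_three_J_two b m010 m010
  have c0 := h.sum_three_J_zero b m010 m001
  have c1 := h.sum_three_J_one b m100 m001
  have c2 := h.sum_three_J_two b m100 m010
  have q1 := hT.sum_J_one_three h b
  have q2 := hT.sum_J_two_three h b
  have r1 := hT.sum_J_one_mul_J_two h b
  have r2 := hT.sum_J_one_mul_J_three h b
  have r3 := hT.sum_J_two_mul_J_three h b
  simp only [ContinuousLinearMap.id_apply, Matrix.cons_val_zero, Matrix.cons_val_one,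
    Matrix.cons_val] at t000 t000' t100 t100' t010 c0 c1 c2
  -- Each of the four squares sums to `t`, each product with `a` to `q`, and each remaining product
  -- to `-q`: in all `4t - 6q - 6q`.
  have expand : ∀ a p q r : ℝ, (a - p - q - r) ^ 2 = a * a + p * p + q * q + r * r
      - 2 * (a * p) - 2 * (a * q) - 2 * (a * r) + 2 * (p * q) + 2 * (p * r) + 2 * (q * r) := by
    intros; ring
  simp only [expand, sq, Finset.sum_add_distrib, Finset.sum_sub_distrib, ← Finset.mul_sum]
  linarith

/-- The squared norm of the `(2,1)+(1,2)`-part of `dF`, where `dF` is determined by the torsion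
`T`. -/
lemma IsThreeForm.sum_sq_plus :
    ∑ i, ∑ j, ∑ k, ((1 / 4) * (T ![J (b i), b j, b k] + T ![b i, J (b j), b k]
        + T ![b i, b j, J (b k)] + 3 * T ![J (b i), J (b j), J (b k)])) ^ 2
      = 3 / 4 * (∑ i, ∑ j, ∑ k, T ![b i, b j, b k] ^ 2
        + ∑ i, ∑ j, ∑ k, T ![b i, b j, b k] * T ![J (b i), J (b j), b k]) := by
  have m100 := IsMultilin.comp_three hT.multilin J (.id ℝ V) (.id ℝ V)
  have m110 := IsMultilin.comp_three hT.multilin J J (.id ℝ V)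
  have t0 := h.sum_three_J_zero b hT.multilin hT.multilin
  have t1 := h.sum_three_J_one b hT.multilin hT.multilin
  have t2 := h.sum_three_J_two b hT.multilin hT.multilin
  have t3 := h.sum_three_J_one b m100 m100
  have t4 := h.sum_three_J_two b m110 m110
  have c0 := h.sum_three_J_zero b hT.multilin (IsMultilin.comp_three hT.multilin (.id ℝ V) J J)
  have c1 := h.sum_three_J_one b hT.multilin (IsMultilin.comp_three hT.multilin J (.id ℝ V) J)
  have c2 := h.sum_three_J_two b hT.multilin m110
  have q1 := hT.sum_J_one_three h b
  have q2 := hT.sum_J_two_three h b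
  have r1 := hT.sum_J_one_mul_J_two h b
  have r2 := hT.sum_J_one_mul_J_three h b
  have r3 := hT.sum_J_two_mul_J_three h b
  simp only [ContinuousLinearMap.id_apply, Matrix.cons_val_zero, Matrix.cons_val_one,
    Matrix.cons_val] at t0 t1 t2 t3 t4 c0 c1 c2
  -- The squares give `(12/16) t`. The products among `a, p, q` sum to `-q` each, those with `r` to
  -- `+q` each, in all `(9/8 - 3/8) q`.
  have expand : ∀ a p q r : ℝ, ((1 / 4) * (a + p + q + 3 * r)) ^ 2
      = (1 / 16) * (a * a) + (1 / 16) * (p * p) + (1 / 16) * (q * q) + (9 / 16) * (r * r)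
      + (1 / 8) * (a * p) + (1 / 8) * (a * q) + (1 / 8) * (p * q) + (3 / 8) * (a * r)
      + (3 / 8) * (p * r) + (3 / 8) * (q * r) := by
    intros; ring
  simp only [expand, sq, Finset.sum_add_distrib, ← Finset.mul_sum]
  linarith

/-- The scalar curvature of a Hermitian connection with parallel torsion `T` and with vanishing
Ricci form. -/
lemma IsThreeForm.sum_curvature {R : V → V → V → V → ℝ}
    (hR₁ : ∀ y z w, IsLinearMap ℝ fun x => R x y z w)
    (hR₄ : ∀ x y z, IsLinearMap ℝ fun w => R x y z w)
    (hskew : ∀ x y z w, R x y z w = -R x y w z)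
    (hJ : ∀ x y z w, R x y (J z) w = -R x y z (J w))
    (htr : ∀ x y, ∑ i, R x y (b i) (J (b i)) = 0)
    (hB : ∀ x y z w, R x y z w + R y z x w + R z x y w
      = ∑ k, T ![x, y, b k] * T ![z, w, b k] + ∑ k, T ![y, z, b k] * T ![x, w, b k]
        + ∑ k, T ![z, x, b k] * T ![y, w, b k])
    (hT0 : ∀ x, ∑ i, T ![b i, J (b i), x] = 0) :
    ∑ i, ∑ j, R (b i) (b j) (b j) (b i)
      = -∑ i, ∑ j, ∑ k, T ![b i, b j, b k] * T ![J (b i), J (b j), b k] := by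
  -- Trace the Bianchi identity over `(bⱼ, bᵢ, Jbᵢ, Jbⱼ)`. On the left, the outer terms are each the
  -- scalar curvature and the middle one is a trace of the Ricci form. On the right, the outer terms
  -- are `-q` each and the middle one vanishes by `hT0`.
  have hsum : ∑ j, ∑ i, (R (b j) (b i) (J (b i)) (J (b j)) + R (b i) (J (b i)) (b j) (J (b j))
      + R (J (b i)) (b j) (b i) (J (b j))) = ∑ j, ∑ i,
        (∑ k, T ![b j, b i, b k] * T ![J (b i), J (b j), b k]
          + ∑ k, T ![b i, J (b i), b k] * T ![b j, J (b j), b k]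
          + ∑ k, T ![J (b i), b j, b k] * T ![b i, J (b j), b k]) :=
    Finset.sum_congr rfl fun j _ => Finset.sum_congr rfl fun i _ => hB _ _ _ _
  simp only [Finset.sum_add_distrib] at hsum
  have a1 : ∑ j, ∑ i, R (b j) (b i) (J (b i)) (J (b j)) = ∑ i, ∑ j, R (b i) (b j) (b j) (b i) := by
    refine Finset.sum_congr rfl fun j _ => Finset.sum_congr rfl fun i _ => ?_
    rw [hJ, h.sq, (hR₄ _ _ _).map_neg, neg_neg]
  have a2 : ∑ j, ∑ i, R (b i) (J (b i)) (b j) (J (b j)) = 0 := by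
    rw [Finset.sum_comm]
    exact Finset.sum_eq_zero fun i _ => htr _ _
  have a3 : ∑ j, ∑ i, R (J (b i)) (b j) (b i) (J (b j))
      = ∑ i, ∑ j, R (b i) (b j) (b j) (b i) := by
    rw [Finset.sum_comm]
    have := h.sum_bilin_J b (B := fun x y => ∑ j, R x (b j) (b j) y)
      (fun _ => IsLinearMap.finset_sum fun _ => hR₁ _ _ _)
      (fun _ => IsLinearMap.finset_sum fun _ => hR₄ _ _ _)
    rw [this]
    refine Finset.sum_congr rfl fun j _ => Finset.sum_congr rfl fun i _ => ?_
    linarith [hJ (J (b j)) (b i) (b j) (b i), hskew (J (b j)) (b i) (b i) (J (b j))]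
  have d1 : ∑ j, ∑ i, ∑ k, T ![b j, b i, b k] * T ![J (b i), J (b j), b k]
      = -∑ i, ∑ j, ∑ k, T ![b i, b j, b k] * T ![J (b i), J (b j), b k] := by
    simp only [← Finset.sum_neg_distrib]
    refine Finset.sum_congr rfl fun i _ => Finset.sum_congr rfl fun j _ =>
      Finset.sum_congr rfl fun k _ => ?_
    rw [hT.swap₁ (J (b j)), mul_neg]
  have d2 : ∑ j, ∑ i, ∑ k, T ![b i, J (b i), b k] * T ![b j, J (b j), b k] = 0 := by
    refine Finset.sum_eq_zero fun j _ => ?_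
    rw [Finset.sum_comm]
    refine Finset.sum_eq_zero fun k _ => ?_
    rw [← Finset.sum_mul, hT0, zero_mul]
  have d3 : ∑ j, ∑ i, ∑ k, T ![J (b i), b j, b k] * T ![b i, J (b j), b k]
      = -∑ i, ∑ j, ∑ k, T ![b i, b j, b k] * T ![J (b i), J (b j), b k] := by
    rw [Finset.sum_comm, hT.sum_J_one_mul_J_two h b]
  linarith

end ThreeForm

end LinearAlgebra

/-! ### Pair-symmetric curvature makes `∇T` a 4-form. -/

section PairSymmetric

variable {E : Type*} [NormedAddCommGroup E] [NormedSpace ℝ E] [FiniteDimensional ℝ E] [Nontrivial E]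
  {H : Type*} [TopologicalSpace H] {I : ModelWithCorners ℝ E H}
  {M : Type*} [TopologicalSpace M] [T2Space M] [ChartedSpace H M] [IsManifold I ∞ M]
  [RiemannianBundle (fun x : M => TangentSpace I x)]
  [IsContMDiffRiemannianBundle I ∞ E (fun x : M => TangentSpace I x)]
  {nabla : CovariantDerivative I E (fun x : M => TangentSpace I x)} {x : M}

lemma IsMetric.curvature_skew (h : IsMetric nabla) (hs : nabla.ContMDiffCovariantDerivative ∞)
    (u v w z : TangentSpace I x) :
    inner ℝ (curvature nabla x u v w) z = -inner ℝ (curvature nabla x u v z) w := by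
  have := h.curvField_skew hs (SmoothNear.extend u) (SmoothNear.extend v) (SmoothNear.extend w)
    (SmoothNear.extend z)
  simp only [← curvature_eq_curvField, FiberBundle.extend_apply_self] at this
  rw [this, real_inner_comm]

lemma isThreeForm_torsionTensor (h : ∀ X Y Z : TangentSpace I x,
    torsionTensor nabla x ![X, Y, Z] = -torsionTensor nabla x ![X, Z, Y]) :
    IsThreeForm (torsionTensor nabla x) := by
  refine ⟨isMultilin_torsionTensor x, fun a b c => ?_, h⟩
  simp only [torsionTensor, Matrix.cons_val_zero, Matrix.cons_val_one, Matrix.cons_val]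
  rw [nabla.torsion_antisymm, inner_neg_left]

/-- Puts the quadratic terms of the Bianchi identity in the form `⟨T(u,v), T(w,z)⟩`, which displays
their symmetries. -/
lemma torsionTensor_torsion (h : ∀ X Y Z : TangentSpace I x,
    torsionTensor nabla x ![X, Y, Z] = -torsionTensor nabla x ![X, Z, Y])
    (u v w z : TangentSpace I x) :
    torsionTensor nabla x ![nabla.torsion x u v, w, z]
      = inner ℝ (nabla.torsion x u v) (nabla.torsion x w z) := by
  have hT := isThreeForm_torsionTensor h
  rw [hT.swap₁, hT.swap₂, neg_neg]
  simp only [torsionTensor, Matrix.cons_val_zero, Matrix.cons_val_one, Matrix.cons_val]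
  rw [real_inner_comm]

/-- Covariant differentiation commutes with permuting the arguments, so alternation passes to the
derivative. -/
lemma isThreeForm_covDeriv_torsionTensor (hs : nabla.ContMDiffCovariantDerivative ∞)
    (h : ∀ (x : M) (X Y Z : TangentSpace I x),
      torsionTensor nabla x ![X, Y, Z] = -torsionTensor nabla x ![X, Z, Y])
    (u : TangentSpace I x) : IsThreeForm (covDeriv nabla (torsionTensor nabla) x u) := by
  have hA := hasCovDerivAt_torsionTensor hs u
  have hswap : ∀ σ : Equiv.Perm (Fin 3),
      (∀ (y : M) (v : Fin 3 → TangentSpace I y),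
        -torsionTensor nabla y (fun i => v (σ i)) = torsionTensor nabla y v) →
      ∀ v, covDeriv nabla (torsionTensor nabla) x u v
        = -covDeriv nabla (torsionTensor nabla) x u (fun i => v (σ i)) := by
    intro σ hσ v
    have h1 := (hA.reindex σ).neg
    simp only [hσ] at h1
    exact h1.covDeriv_eq v
  have hvec : ∀ {y : M} (v : Fin 3 → TangentSpace I y), v = ![v 0, v 1, v 2] := fun v => by
    ext1 i; fin_cases i <;> rfl
  refine ⟨hA.isMultilin isMultilin_torsionTensor, fun a b c => ?_, fun a b c => ?_⟩
  · rw [hswap (Equiv.swap 0 1) (fun y v => ?_)]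
    · congr 2; ext1 i; fin_cases i <;> rfl
    · rw [hvec v, (isThreeForm_torsionTensor (h y)).swap₁]
      congr 2; ext1 i; fin_cases i <;> rfl
  · rw [hswap (Equiv.swap 1 2) (fun y v => ?_)]
    · congr 2; ext1 i; fin_cases i <;> rfl
    · rw [hvec v, (isThreeForm_torsionTensor (h y)).swap₂]
      congr 2; ext1 i; fin_cases i <;> rfl

/-- If the curvature of a metric connection with skew-symmetric torsion `T` is pair symmetric, then
`∇T` is a 4-form. -/
theorem isFourForm_covDeriv_torsionTensor (hg : IsMetric nabla)
    (hs : nabla.ContMDiffCovariantDerivative ∞)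
    (h : ∀ (x : M) (X Y Z : TangentSpace I x),
      torsionTensor nabla x ![X, Y, Z] = -torsionTensor nabla x ![X, Z, Y])
    (hR : CurvaturePairSymmetric nabla) (x : M) :
    IsFourForm fun u a b c : TangentSpace I x =>
      covDeriv nabla (torsionTensor nabla) x u ![a, b, c] := by
  have ht := fun u : TangentSpace I x => isThreeForm_covDeriv_torsionTensor hs h u
  -- Add the Bianchi identities for `(X,Y,Z;V)` and `(X,Y,V;Z)`. Pair symmetry and skewness cancel
  -- all curvature terms; the quadratic torsion terms and the derivatives along `X` and `Y` are odd
  -- under exchanging `Z` and `V`. Only the two terms of the claim survive.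
  have hskew : ∀ X Y Z V : TangentSpace I x, covDeriv nabla (torsionTensor nabla) x Z ![X, Y, V]
      = -covDeriv nabla (torsionTensor nabla) x V ![X, Y, Z] := by
    intro X Y Z V
    have b1 := bianchi hg hs X Y Z V
    have b2 := bianchi hg hs X Y V Z
    simp only [torsionTensor_torsion (h x)] at b1 b2
    have c1 := hR x Z X Y V
    have c2 := hg.curvature_skew hs Y V X Z
    have c3 := hR x V X Y Z
    have c4 := hg.curvature_skew hs Y Z V X
    have c5 := hg.curvature_skew hs X Y V Z
    have t1 := (ht X).swap₂ Y Z V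
    have t2 := (ht Y).swap₁ Z X V
    have t3 := (ht Y).swap₂ X V Z
    have t4 := (ht Y).swap₁ V X Z
    have d1 : inner ℝ (nabla.torsion x X Y) (nabla.torsion x V Z)
        = -inner ℝ (nabla.torsion x X Y) (nabla.torsion x Z V) := by
      rw [nabla.torsion_antisymm V Z, inner_neg_right]
    have d2 : inner ℝ (nabla.torsion x Y V) (nabla.torsion x X Z)
        = -inner ℝ (nabla.torsion x Z X) (nabla.torsion x Y V) := by
      rw [nabla.torsion_antisymm X Z, inner_neg_right, real_inner_comm]
    have d3 : inner ℝ (nabla.torsion x V X) (nabla.torsion x Y Z)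
        = -inner ℝ (nabla.torsion x Y Z) (nabla.torsion x X V) := by
      rw [nabla.torsion_antisymm V X, inner_neg_left, real_inner_comm]
    linarith
  have hs1 : ∀ a b c d : TangentSpace I x, covDeriv nabla (torsionTensor nabla) x a ![b, c, d]
      = -covDeriv nabla (torsionTensor nabla) x b ![a, c, d] := by
    intro a b c d
    rw [(ht a).swap₁, (ht a).swap₂, neg_neg, hskew, (ht b).swap₂, (ht b).swap₁, neg_neg]
  refine ⟨fun b c d => ?_, hs1, fun u a b c => (ht u).swap₁ a b c, fun u a b c => (ht u).swap₂ a b c⟩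
  have h1 := (ht b).multilin.linear_zero c d
  constructor
  · intro u v; rw [hs1, h1.map_add, hs1 u, hs1 v]; ring
  · intro r u; rw [hs1, h1.map_smul, hs1 u]; simp

end PairSymmetric

/-! ### The curvature of the torsion connection of an `SU(3)`-structure. -/

variable {M : Type*} [TopologicalSpace M] [T2Space M]
  [ChartedSpace (EuclideanSpace ℝ (Fin 6)) M] [IsManifold (𝓡 6) ∞ M]
  [RiemannianBundle (fun x : M => TangentSpace (𝓡 6) x)]
  [IsContMDiffRiemannianBundle (𝓡 6) ∞ (EuclideanSpace ℝ (Fin 6))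
    (fun x : M => TangentSpace (𝓡 6) x)]
  {S : SU3Structure M}
  {nabla D : CovariantDerivative (𝓡 6) (EuclideanSpace ℝ (Fin 6))
    (fun x : M => TangentSpace (𝓡 6) x)} {x : M}

namespace SU3Structure

lemma smoothNear_J {X : ∀ y : M, TangentSpace (𝓡 6) y} (hX : SmoothNear X x) :
    SmoothNear (fun y => S.J y (X y)) x := hX.clm S.contMDiff_J

lemma inner_J_left (v w : TangentSpace (𝓡 6) x) :
    inner ℝ (S.J x v) w = -inner ℝ v (S.J x w) := by
  rw [← S.inner_J_J x v (S.J x w), S.J_J, inner_neg_right, neg_neg]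

namespace IsACYT

variable (h : S.IsACYT nabla)
include h

lemma isParallelEnd_J : IsParallelEnd nabla (fun y v => S.J y v) x := fun X hX =>
  ⟨hX.clm S.contMDiff_J, fun u => h.parallel_J x u X hX.mdifferentiableAt⟩

/-- The curvature of a Hermitian connection commutes with `J`. -/
lemma curvature_J (u v w z : TangentSpace (𝓡 6) x) :
    inner ℝ (curvature nabla x u v (S.J x w)) z = -inner ℝ (curvature nabla x u v w) (S.J x z) := by
  let X := FiberBundle.extend (EuclideanSpace ℝ (Fin 6)) u
  let Y := FiberBundle.extend (EuclideanSpace ℝ (Fin 6)) v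
  let W := FiberBundle.extend (EuclideanSpace ℝ (Fin 6)) w
  let Z := FiberBundle.extend (EuclideanSpace ℝ (Fin 6)) z
  have hX : SmoothNear X x := SmoothNear.extend u
  have hY : SmoothNear Y x := SmoothNear.extend v
  have hW : SmoothNear W x := SmoothNear.extend w
  have hZ : SmoothNear Z x := SmoothNear.extend z
  have hJ : ∀ {P : ∀ y : M, TangentSpace (𝓡 6) y}, SmoothNear P x → ∀ p,
      nabla (fun y => nabla (fun y => S.J y (W y)) y (P y)) x p
        = S.J x (nabla (fun y => nabla W y (P y)) x p) := by
    intro P hP p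
    rw [← h.parallel_J x p _ (hP.nabla h.smooth hW).mdifferentiableAt]
    refine DFunLike.congr_fun ?_ p
    refine (nabla.isCovariantDerivativeOn (s := Set.univ)).congr_of_eventuallyEq
      (hP.nabla h.smooth (smoothNear_J hW)).mdifferentiableAt
      (smoothNear_J (hP.nabla h.smooth hW)).mdifferentiableAt Filter.univ_mem ?_
    filter_upwards [hW.eventually] with y hy
    exact h.parallel_J y (P y) W hy.mdifferentiableAt
  have h1 : curvField nabla X Y (fun y => S.J y (W y)) x = S.J x (curvField nabla X Y W x) := by
    simp only [curvField]
    rw [hJ hY, hJ hX, h.parallel_J x _ W hW.mdifferentiableAt]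
    simp only [map_sub]
  -- The field `JW` is not the chosen extension of `Jw`. Skewness moves both curvature expressions
  -- onto `z`, where they coincide, so the choice of extension does not matter.
  have h2 := h.parallel_metric.curvField_skew h.smooth hX hY
    (smoothNear_J (S := S) hW) hZ
  rw [h1] at h2
  have h3 := h.parallel_metric.curvature_skew h.smooth u v (S.J x w) z
  simp only [curvature_eq_curvField nabla] at h3 ⊢
  rw [h3, real_inner_comm, ← inner_J_left]
  simp only [W, X, Y, Z, FiberBundle.extend_apply_self] at h2
  exact h2.symm

/-- Only the imaginary part of `Ψ` is needed: it detects the complex trace of the curvature, that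
is, the Ricci form. -/
lemma hasCovDerivAt_im_Ψ (y : M) (u : TangentSpace (𝓡 6) y) :
    HasCovDerivAt nabla (fun y v => (S.Ψ y v).im) y u 0 := by
  have hm : ∀ y : M, IsMultilin (fun v => (S.Ψ y v).im) := fun y =>
    ⟨Complex.imLm.compMultilinearMap (S.Ψ y).toMultilinearMap, fun v => rfl⟩
  have hd : ∀ X : Fin 3 → ∀ y : M, TangentSpace (𝓡 6) y, (∀ i, SmoothNear (X i) y) →
      MDifferentiableAt (𝓡 6) 𝓘(ℝ, ℂ) (fun y => S.Ψ y (fun i => X i y)) y := fun X hX =>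
    (S.contMDiff_Ψ y X fun i => (hX i).contMDiffAt).mdifferentiableAt (by simp)
  have hd' : DiffOnSmooth (I := 𝓡 6) (fun y v => (S.Ψ y v).im) y := fun X hX =>
    (Complex.imCLM.differentiableAt.mdifferentiableAt).comp y (hd X hX)
  have h1 := HasCovDerivAt.of_isMultilin (nabla := nabla) hm hd' u
  convert h1 using 1
  ext v
  have h2 := congrArg Complex.im (h.parallel_Ψ y u v)
  have h3 : mvfderiv (𝓡 6) (fun y : M => (S.Ψ y (fun i =>
      FiberBundle.extend (EuclideanSpace ℝ (Fin 6)) (v i) y)).im) y u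
      = (mvfderiv (𝓡 6) (fun y : M => S.Ψ y (fun i =>
      FiberBundle.extend (EuclideanSpace ℝ (Fin 6)) (v i) y)) y u).im := by
    have h4 := mvfderiv_comp_apply (I' := 𝓡 6) (I := 𝓘(ℝ, ℂ)) (g := Complex.imCLM) y
      (f := fun y : M => S.Ψ y (fun i => FiberBundle.extend (EuclideanSpace ℝ (Fin 6)) (v i) y))
      (Complex.imCLM.differentiableAt.mdifferentiableAt)
      (hd (fun i => FiberBundle.extend (EuclideanSpace ℝ (Fin 6)) (v i))
        (fun i => SmoothNear.extend (v i))) u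
    refine h4.trans ?_
    rw [mvfderiv, mvfderiv, mfderiv_eq_fderiv, ContinuousLinearMap.fderiv]
    rfl
  simp only [covDeriv, Complex.sub_im, Complex.im_sum, Complex.zero_im] at h2
  simp only [covDeriv, h3, h2, Pi.zero_apply]

/-- The Ricci form of a connection preserving the `SU(3)`-structure vanishes. -/
lemma exists_adapted : ∃ e : OrthonormalBasis (Fin 6) ℝ (TangentSpace (𝓡 6) x),
    IsAdapted (S.J x) e ∧ ∀ u v, inner ℝ (curvature nabla x u v (e 0)) (e 1)
      + inner ℝ (curvature nabla x u v (e 2)) (e 3)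
      + inner ℝ (curvature nabla x u v (e 4)) (e 5) = 0 := by
  obtain ⟨e, h0, h2, h4, hΨ⟩ := S.exists_adapted x
  refine ⟨e, ⟨S.J_J x, S.inner_J_J x, h0, h2, h4⟩, fun u v => ?_⟩
  have hm : ∀ y : M, IsMultilin (fun v => (S.Ψ y v).im) := fun y =>
    ⟨Complex.imLm.compMultilinearMap (S.Ψ y).toMultilinearMap, fun v => rfl⟩
  have hsm : ∀ {U V W : ∀ y : M, TangentSpace (𝓡 6) y}, SmoothNear U x → SmoothNear V x →
      SmoothNear W x → FunSmoothNear (𝓡 6) (fun y => (S.Ψ y ![U y, V y, W y]).im) x := by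
    intro U V W hU hV hW
    filter_upwards [hU, hV, hW] with y h1 h2 h3
    have h5 := S.contMDiff_Ψ y ![U, V, W] (by intro i; fin_cases i <;> assumption)
    simp only [fin_three_section] at h5
    exact Complex.imCLM.contMDiff.contMDiffAt.comp y h5
  -- The curvature acts trivially on `Im Ψ`; evaluated on `e₀, e₂, e₄`, this action is minus the sum
  -- of the `⟨R e₂ₖ, e₂ₖ₊₁⟩`.
  have h5 := curvField_parallel_three h.smooth h.hasCovDerivAt_im_Ψ hm hsm
    (SmoothNear.extend u) (SmoothNear.extend v) (SmoothNear.extend (e 0))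
    (SmoothNear.extend (e 2)) (SmoothNear.extend (e 4))
  simp only [← curvature_eq_curvField, FiberBundle.extend_apply_self, hΨ, Matrix.det_fin_three,
    Matrix.of_apply] at h5
  simp [e.inner_eq_ite] at h5
  linarith [real_inner_comm (curvature nabla x u v (e 0)) (e 1),
    real_inner_comm (curvature nabla x u v (e 2)) (e 3),
    real_inner_comm (curvature nabla x u v (e 4)) (e 5)]

end IsACYT
end SU3Structure

/-! ### The Levi-Civita connection as `∇ - T/2`. -/

section LeviCivita

variable {E : Type*} [NormedAddCommGroup E] [NormedSpace ℝ E] [FiniteDimensional ℝ E] [Nontrivial E]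
  {H : Type*} [TopologicalSpace H] {I : ModelWithCorners ℝ E H}
  {M : Type*} [TopologicalSpace M] [T2Space M] [ChartedSpace H M] [IsManifold I ∞ M]
  [RiemannianBundle (fun x : M => TangentSpace I x)]
  [IsContMDiffRiemannianBundle I ∞ E (fun x : M => TangentSpace I x)]
  {nabla D : CovariantDerivative I E (fun x : M => TangentSpace I x)} {x : M}

/-- The Levi-Civita connection is `∇ - T/2` if `∇` is a metric connection whose torsion `T` is
totally skew-symmetric. -/
lemma IsLeviCivita.apply_eq (hD : IsLeviCivita D) (hg : IsMetric nabla)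
    (h : ∀ (x : M) (X Y Z : TangentSpace I x),
      torsionTensor nabla x ![X, Y, Z] = -torsionTensor nabla x ![X, Z, Y])
    {Y : ∀ y : M, TangentSpace I y} (hY : SmoothNear Y x) (u : TangentSpace I x) :
    D Y x u = nabla Y x u - (1 / 2 : ℝ) • nabla.torsion x u (Y x) := by
  -- Koszul's argument for the difference of the connections: `s` is skew in its last two arguments
  -- because both are metric, and its skew part in the first two is `T`. Three permuted instances
  -- solve to `s = T/2`.
  let s : (∀ y : M, TangentSpace I y) → (∀ y : M, TangentSpace I y) →
      (∀ y : M, TangentSpace I y) → ℝ := fun X Y Z => inner ℝ (nabla Y x (X x) - D Y x (X x)) (Z x)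
  have h1 : ∀ {X Y Z : ∀ y : M, TangentSpace I y}, SmoothNear Y x → SmoothNear Z x →
      s X Y Z = -s X Z Y := by
    intro X Y Z hY hZ
    have e1 := hg x (X x) Y Z hY.mdifferentiableAt hZ.mdifferentiableAt
    have e2 := hD.metric x (X x) Y Z hY.mdifferentiableAt hZ.mdifferentiableAt
    simp only [s, inner_sub_left]
    rw [real_inner_comm (Y x) (nabla Z x (X x)), real_inner_comm (Y x) (D Z x (X x))]
    linarith
  have h2 : ∀ {X Y Z : ∀ y : M, TangentSpace I y}, SmoothNear X x → SmoothNear Y x →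
      s X Y Z - s Y X Z = torsionTensor nabla x ![X x, Y x, Z x] := by
    intro X Y Z hX hY
    have e1 := nabla.torsion_apply hX.mdifferentiableAt hY.mdifferentiableAt
    have e2 := D.torsion_apply hX.mdifferentiableAt hY.mdifferentiableAt
    rw [hD.torsion_free] at e2
    have e3 : (0 : TangentSpace I x) = D Y x (X x) - D X x (Y x)
      - VectorField.mlieBracket I X Y x := e2
    simp only [s, torsionTensor, Matrix.cons_val_zero, Matrix.cons_val_one, Matrix.cons_val]
    rw [e1, ← inner_sub_left]
    congr 1
    rw [← sub_zero (nabla Y x (X x) - nabla X x (Y x) - VectorField.mlieBracket I X Y x), e3]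
    abel
  have hT := isThreeForm_torsionTensor (h x)
  rw [eq_comm, sub_eq_iff_eq_add, ← sub_eq_iff_eq_add', eq_comm]
  refine ext_inner_right ℝ fun w => ?_
  let X := FiberBundle.extend (x := x) E u
  let Z := FiberBundle.extend (x := x) E w
  have hX : SmoothNear X x := SmoothNear.extend u
  have hZ : SmoothNear Z x := SmoothNear.extend w
  have a1 := h2 (Z := Z) hX hY
  have a2 := h2 (Z := X) hY hZ
  have a3 := h2 (Z := Y) hZ hX
  have b1 := h1 (X := X) hY hZ
  have b2 := h1 (X := Y) hX hZ
  have b3 := h1 (X := Z) hX hY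
  rw [hT.swap₂, hT.swap₁, neg_neg] at a2
  rw [hT.swap₁, hT.swap₂, neg_neg] at a3
  have key : s X Y Z = (1 / 2) * torsionTensor nabla x ![X x, Y x, Z x] := by linarith
  simp only [s, X, Z, FiberBundle.extend_apply_self, torsionTensor, Matrix.cons_val_zero,
    Matrix.cons_val_one, Matrix.cons_val] at key
  rw [inner_smul_left]
  exact key.symm ▸ rfl

end LeviCivita

section Comp

variable {E : Type*} [NormedAddCommGroup E] [NormedSpace ℝ E]
  {H : Type*} [TopologicalSpace H] {I : ModelWithCorners ℝ E H}
  {M : Type*} [TopologicalSpace M] [ChartedSpace H M] [IsManifold I ∞ M]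
  {nabla : CovariantDerivative I E (fun x : M => TangentSpace I x)} {x : M} {u : TangentSpace I x}
  {A : ∀ x : M, (Fin 3 → TangentSpace I x) → ℝ} {A' : (Fin 3 → TangentSpace I x) → ℝ}

lemma HasCovDerivAt.comp_three (hA : HasCovDerivAt nabla A x u A')
    {J K L : ∀ x : M, TangentSpace I x → TangentSpace I x} (hJ : IsParallelEnd nabla J x)
    (hK : IsParallelEnd nabla K x) (hL : IsParallelEnd nabla L x) :
    HasCovDerivAt nabla (fun y (v : Fin 3 → TangentSpace I y) => A y ![J y (v 0), K y (v 1), L y (v 2)]) x u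
      (fun v : Fin 3 → TangentSpace I x => A' ![J x (v 0), K x (v 1), L x (v 2)]) := by
  have := hA.comp (L := ![J, K, L]) (by intro i; fin_cases i <;> assumption)
  convert this using 1
  · ext y v; congr 1; ext1 i; fin_cases i <;> rfl
  · ext v; congr 1; ext1 i; fin_cases i <;> rfl

end Comp

/-! ### `N`, `dF`, the Lee form and their derivatives in terms of the torsion. -/

variable {M : Type*} [TopologicalSpace M] [T2Space M]
  [ChartedSpace (EuclideanSpace ℝ (Fin 6)) M] [IsManifold (𝓡 6) ∞ M]
  [RiemannianBundle (fun x : M => TangentSpace (𝓡 6) x)]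
  [IsContMDiffRiemannianBundle (𝓡 6) ∞ (EuclideanSpace ℝ (Fin 6))
    (fun x : M => TangentSpace (𝓡 6) x)]
  {S : SU3Structure M}
  {nabla D : CovariantDerivative (𝓡 6) (EuclideanSpace ℝ (Fin 6))
    (fun x : M => TangentSpace (𝓡 6) x)} {x : M}

namespace SU3Structure.IsACYT

variable (h : S.IsACYT nabla)
include h

lemma mlieBracket_eq {X Y : ∀ y : M, TangentSpace (𝓡 6) y} (hX : SmoothNear X x)
    (hY : SmoothNear Y x) : VectorField.mlieBracket (𝓡 6) X Y x
      = nabla Y x (X x) - nabla X x (Y x) - nabla.torsion x (X x) (Y x) := by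
  rw [nabla.torsion_apply hX.mdifferentiableAt hY.mdifferentiableAt]
  abel

/-- With brackets written as `∇_X Y - ∇_Y X - T(X,Y)`, the derivative terms cancel because `∇J = 0`.
The result is four times the (3,0)+(0,3)-part of `T`. -/
lemma N_eq (v : Fin 3 → TangentSpace (𝓡 6) x) : S.N x v = torsionTensor nabla x v
    - torsionTensor nabla x ![S.J x (v 0), S.J x (v 1), v 2]
    - torsionTensor nabla x ![S.J x (v 0), v 1, S.J x (v 2)]
    - torsionTensor nabla x ![v 0, S.J x (v 1), S.J x (v 2)] := by
  have hX := SmoothNear.extend (I := 𝓡 6) (v 0)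
  have hY := SmoothNear.extend (I := 𝓡 6) (v 1)
  have hJX := smoothNear_J (S := S) hX
  have hJY := smoothNear_J (S := S) hY
  simp only [N, nijenhuis]
  rw [h.mlieBracket_eq hJX hJY, h.mlieBracket_eq hX hY, h.mlieBracket_eq hJX hY,
    h.mlieBracket_eq hX hJY]
  simp only [h.parallel_J x _ _ hX.mdifferentiableAt, h.parallel_J x _ _ hY.mdifferentiableAt,
    FiberBundle.extend_apply_self, map_sub, S.J_J, inner_sub_left, torsionTensor,
    Matrix.cons_val_zero, Matrix.cons_val_one, Matrix.cons_val, inner_neg_left, inner_J_left]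
  ring

lemma dF_eq (v : Fin 3 → TangentSpace (𝓡 6) x) : S.dF x v
    = torsionTensor nabla x ![S.J x (v 0), v 1, v 2] + torsionTensor nabla x ![v 0, S.J x (v 1), v 2]
      + torsionTensor nabla x ![v 0, v 1, S.J x (v 2)] := by
  have hT := isThreeForm_torsionTensor (h.skew_torsion x)
  have hext := fun i => SmoothNear.extend (I := 𝓡 6) (v i)
  have key : ∀ {X Y : ∀ y : M, TangentSpace (𝓡 6) y}, SmoothNear X x → SmoothNear Y x → ∀ u,
      mvfderiv (𝓡 6) (fun y => S.F y ![X y, Y y]) x u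
        = inner ℝ (nabla X x u) (S.J x (Y x)) - inner ℝ (S.J x (X x)) (nabla Y x u) := by
    intro X Y hX hY u
    refine (h.parallel_metric x u X _ hX.mdifferentiableAt
      (smoothNear_J (S := S) hY).mdifferentiableAt).trans ?_
    rw [h.parallel_J x _ _ hY.mdifferentiableAt, inner_J_left]
    ring
  rw [hT.swap₁, hT.swap₂, neg_neg, hT.swap₂ (v 0), hT.swap₁ (v 0), neg_neg]
  simp only [dF, extDerivTwo]
  rw [key (hext 1) (hext 2), key (hext 2) (hext 0), key (hext 0) (hext 1),
    h.mlieBracket_eq (hext 0) (hext 1), h.mlieBracket_eq (hext 1) (hext 2),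
    h.mlieBracket_eq (hext 2) (hext 0)]
  simp only [F, FiberBundle.extend_apply_self, torsionTensor,
    Matrix.cons_val_zero, Matrix.cons_val_one, Matrix.cons_val, inner_sub_left,
    real_inner_comm (nabla _ x _) (S.J x _)]
  ring

/-- Since `∇F = 0` and `D = ∇ - T/2`, the derivative `D_u F(u,w)` is a pure torsion term; the part
with `T(u,u)` is zero. -/
lemma codiffTwo_F (hD : IsLeviCivita D) (v : TangentSpace (𝓡 6) x) : codiffTwo D S.F x ![v]
    = -(1 / 2) * ∑ i, torsionTensor nabla x ![v, frame x i, S.J x (frame x i)] := by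
  have hT := isThreeForm_torsionTensor (h.skew_torsion x)
  have key : ∀ u w : TangentSpace (𝓡 6) x, covDeriv D S.F x u ![u, w]
      = (1 / 2) * torsionTensor nabla x ![w, u, S.J x u] := by
    intro u w
    have hU := SmoothNear.extend (I := 𝓡 6) u
    have hW := SmoothNear.extend (I := 𝓡 6) w
    have h1 := h.parallel_metric x u _ _ hU.mdifferentiableAt
      (smoothNear_J (S := S) hW).mdifferentiableAt
    rw [h.parallel_J x _ _ hW.mdifferentiableAt] at h1
    have h2 : torsionTensor nabla x ![w, u, S.J x u] = -torsionTensor nabla x ![u, w, S.J x u] :=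
      hT.swap₁ _ _ _
    have h3 := hT.self₁₂ u (S.J x w)
    simp only [covDeriv, F, Fin.sum_univ_two, Matrix.cons_val_zero, Matrix.cons_val_one,
      Function.update_self, Function.update_of_ne (zero_ne_one : (0 : Fin 2) ≠ 1),
      Function.update_of_ne (one_ne_zero : (1 : Fin 2) ≠ 0)] 
    rw [h1, h2, hD.apply_eq h.parallel_metric h.skew_torsion hU,
      hD.apply_eq h.parallel_metric h.skew_torsion hW]
    simp only [torsionTensor, Matrix.cons_val_zero, Matrix.cons_val_one, Matrix.cons_val] at h3 ⊢
    simp only [FiberBundle.extend_apply_self, map_sub, map_smul, inner_sub_left, inner_sub_right,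
      inner_smul_left, inner_smul_right, h3]
    have h4 := inner_J_left (S := S) u (nabla.torsion x u w)
    rw [real_inner_comm] at h4
    simp only [h4, conj_trivial]
    ring
  simp only [codiffTwo, Matrix.cons_val_zero, key, ← Finset.mul_sum]
  ring

lemma JLeeForm_eq (hD : IsLeviCivita D) (v : Fin 1 → TangentSpace (𝓡 6) x) :
    S.JLeeForm D x v
      = -(1 / 2) * ∑ i, torsionTensor nabla x ![v 0, frame x i, S.J x (frame x i)] := by
  have hT := isThreeForm_torsionTensor (h.skew_torsion x)
  simp only [JLeeForm, leeForm, Matrix.cons_val_zero, S.J_J]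
  rw [h.codiffTwo_F hD]
  simp only [hT.neg₁, Finset.sum_neg_distrib]
  ring

lemma leeForm_eq (hD : IsLeviCivita D) (v : Fin 1 → TangentSpace (𝓡 6) x) :
    S.leeForm D x v = S.JLeeForm D x ![S.J x (v 0)] := by
  rw [h.JLeeForm_eq hD, leeForm, h.codiffTwo_F hD]
  rfl

lemma hasCovDerivAt_torsion (u : TangentSpace (𝓡 6) x) :
    HasCovDerivAt nabla (torsionTensor nabla) x u (covDeriv nabla (torsionTensor nabla) x u) :=
  hasCovDerivAt_torsionTensor h.smooth u

/-- The type projection is built from the parallel `J`, so it commutes with `∇`. -/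
lemma hasCovDerivAt_N {u : TangentSpace (𝓡 6) x} {A : (Fin 3 → TangentSpace (𝓡 6) x) → ℝ}
    (hA : HasCovDerivAt nabla (torsionTensor nabla) x u A) :
    HasCovDerivAt nabla S.N x u fun v => A v - A ![S.J x (v 0), S.J x (v 1), v 2]
      - A ![S.J x (v 0), v 1, S.J x (v 2)] - A ![v 0, S.J x (v 1), S.J x (v 2)] := by
  have hJ : IsParallelEnd nabla (fun y v => S.J y v) x := h.isParallelEnd_J
  have := ((hA.sub (hA.comp_three hJ hJ .id)).sub (hA.comp_three hJ .id hJ)).sub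
    (hA.comp_three .id hJ hJ)
  convert this using 1
  ext y v
  exact h.N_eq v

lemma hasCovDerivAt_dF {u : TangentSpace (𝓡 6) x} {A : (Fin 3 → TangentSpace (𝓡 6) x) → ℝ}
    (hA : HasCovDerivAt nabla (torsionTensor nabla) x u A) :
    HasCovDerivAt nabla S.dF x u fun v => A ![S.J x (v 0), v 1, v 2]
      + A ![v 0, S.J x (v 1), v 2] + A ![v 0, v 1, S.J x (v 2)] := by
  have hJ : IsParallelEnd nabla (fun y v => S.J y v) x := h.isParallelEnd_J
  have := ((hA.comp_three hJ .id .id).add (hA.comp_three .id hJ .id)).add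
    (hA.comp_three .id .id hJ)
  convert this using 1
  ext y v
  exact h.dF_eq v

lemma hasCovDerivAt_JLeeForm (hD : IsLeviCivita D) {u : TangentSpace (𝓡 6) x}
    {A : (Fin 3 → TangentSpace (𝓡 6) x) → ℝ}
    (hA : HasCovDerivAt nabla (torsionTensor nabla) x u A) :
    HasCovDerivAt nabla (S.JLeeForm D) x u fun v =>
      -(1 / 2) * ∑ i, A ![v 0, frame x i, S.J x (frame x i)] := by
  have hJ : IsParallelEnd nabla (fun y v => S.J y v) x := h.isParallelEnd_J
  have := ((hA.comp_three .id .id hJ).trace h.parallel_metric fun y =>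
    IsMultilin.comp_three (isMultilin_torsionTensor y) (.id ℝ _) (.id ℝ _) (S.J y)).const_mul
      (-(1 / 2))
  convert this using 1
  · ext y v
    exact h.JLeeForm_eq hD v
  · rfl

lemma hasCovDerivAt_leeForm {u : TangentSpace (𝓡 6) x} (hD : IsLeviCivita D)
    {A : (Fin 1 → TangentSpace (𝓡 6) x) → ℝ} (hA : HasCovDerivAt nabla (S.JLeeForm D) x u A) :
    HasCovDerivAt nabla (S.leeForm D) x u fun v => A ![S.J x (v 0)] := by
  have := hA.comp (L := fun _ y v => S.J y v) fun _ => h.isParallelEnd_J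
  convert this using 1
  · ext y v
    rw [h.leeForm_eq hD]
    congr 1; ext1 i; fin_cases i; rfl
  · ext v
    congr 1; ext1 i; fin_cases i; rfl

lemma dFPlus_eq (v : Fin 3 → TangentSpace (𝓡 6) x) : S.dFPlus x v
    = (1 / 4) * (torsionTensor nabla x ![S.J x (v 0), v 1, v 2]
      + torsionTensor nabla x ![v 0, S.J x (v 1), v 2]
      + torsionTensor nabla x ![v 0, v 1, S.J x (v 2)]
      + 3 * torsionTensor nabla x ![S.J x (v 0), S.J x (v 1), S.J x (v 2)]) := by
  have hT := isThreeForm_torsionTensor (h.skew_torsion x)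
  simp only [dFPlus, h.dF_eq, Matrix.cons_val_zero, Matrix.cons_val_one, Matrix.cons_val, S.J_J,
    hT.neg₁, hT.neg₂, hT.neg₃]
  ring

end SU3Structure.IsACYT

/-! ### Functions with vanishing derivative. -/

section LocallyConstant

variable {E : Type*} [NormedAddCommGroup E] [NormedSpace ℝ E]
  {H : Type*} [TopologicalSpace H] {I : ModelWithCorners ℝ E H} [I.Boundaryless]
  {M : Type*} [TopologicalSpace M] [ChartedSpace H M] [IsManifold I ∞ M]

/-- A function with vanishing derivative is constant on each connected component. -/
theorem eq_of_mvfderiv_eq_zero {f : M → ℝ} (hf : ∀ x, MDifferentiableAt I 𝓘(ℝ, ℝ) f x)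
    (h0 : ∀ (x : M) (u : TangentSpace I x), mvfderiv I f x u = 0) {x y : M}
    (hy : y ∈ connectedComponent x) : f y = f x := by
  have hloc : IsLocallyConstant f := by
    refine (IsLocallyConstant.iff_eventually_eq f).2 fun x => ?_
    have hI1 : IsManifold I 1 M := .of_le (n := ∞) (by simp)
    let φ := extChartAt I x
    obtain ⟨r, hr, hball⟩ := Metric.isOpen_iff.1 (isOpen_extChartAt_target (I := I) x) (φ x)
      (mem_extChartAt_target x)
    have hd : ∀ z ∈ Metric.ball (φ x) r, MDifferentiableAt 𝓘(ℝ, E) 𝓘(ℝ, ℝ) (f ∘ φ.symm) z ∧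
        mfderiv 𝓘(ℝ, E) 𝓘(ℝ, ℝ) (f ∘ φ.symm) z = 0 := by
      intro z hz
      have h1 : MDifferentiableAt 𝓘(ℝ, E) I φ.symm z := by
        have := mdifferentiableWithinAt_extChartAt_symm (I := I) (hball hz)
        rwa [I.range_eq_univ, mdifferentiableWithinAt_univ] at this
      refine ⟨(hf _).comp z h1, ?_⟩
      rw [mfderiv_comp z (hf _) h1]
      ext u
      exact h0 _ _
    have hconst : ∀ z ∈ Metric.ball (φ x) r, f (φ.symm z) = f x := by
      intro z hz
      have := Metric.isOpen_ball.is_const_of_fderiv_eq_zero (𝕜 := ℝ) (f := f ∘ φ.symm)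
        (convex_ball (φ x) r).isPreconnected
        (fun w hw => (hd w hw).1.differentiableAt.differentiableWithinAt)
        (fun w hw => by
          have := (hd w hw).2
          rw [mfderiv_eq_fderiv] at this
          exact this) hz (Metric.mem_ball_self hr)
      simpa [φ] using this
    filter_upwards [(continuousAt_extChartAt (I := I) x).preimage_mem_nhds
      (Metric.ball_mem_nhds _ hr), extChartAt_source_mem_nhds (I := I) x] with y h1 h2
    rw [← hconst _ h1, φ.left_inv h2]
  exact hloc.apply_eq_of_isPreconnected isPreconnected_connectedComponent hy
    mem_connectedComponent

end LocallyConstant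

/-! ### Killing fields from 1-forms with skew derivative. -/

section Killing

variable {E : Type*} [NormedAddCommGroup E] [NormedSpace ℝ E] [FiniteDimensional ℝ E]
  {H : Type*} [TopologicalSpace H] {I : ModelWithCorners ℝ E H}
  {M : Type*} [TopologicalSpace M] [ChartedSpace H M] [IsManifold I ∞ M]
  [RiemannianBundle (fun x : M => TangentSpace I x)]
  {nabla D : CovariantDerivative I E (fun x : M => TangentSpace I x)} {x : M}
  {α : ∀ x : M, (Fin 1 → TangentSpace I x) → ℝ}

lemma inner_sharp (hα : IsLinearMap ℝ fun v => α x ![v]) (w : TangentSpace I x) :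
    inner ℝ (sharp α x) w = α x ![w] := by
  have h1 : α x ![w] = IsLinearMap.mk' (fun v => α x ![v]) hα w := rfl
  rw [h1, ← (frame x).sum_repr' w, map_sum, sharp, sum_inner]
  refine Finset.sum_congr rfl fun i _ => ?_
  rw [map_smul, (frame x).sum_repr' w, inner_smul_left, smul_eq_mul, mul_comm]
  rfl

variable [IsContMDiffRiemannianBundle I ∞ E (fun x : M => TangentSpace I x)]

/-- `sharp` is defined with the possibly discontinuous `frame`; near `x` it equals the same sum over
a smooth orthonormal frame. -/
lemma smoothNear_sharp (hα : ∀ y, IsLinearMap ℝ fun v => α y ![v])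
    (hs : ∀ {X : ∀ y : M, TangentSpace I y}, SmoothNear X x →
      FunSmoothNear I (fun y => α y ![X y]) x) : SmoothNear (sharp α) x := by
  obtain ⟨e, he, ho⟩ := exists_orthonormal_frame (I := I) x
  refine (SmoothNear.sum (s := Finset.univ) fun i _ => (he i).smul (hs (he i))).congr ?_
  filter_upwards [ho] with y hy
  refine ext_inner_right ℝ fun w => ?_
  rw [inner_sharp (hα y), sum_inner]
  have h1 : α y ![w] = IsLinearMap.mk' (fun v => α y ![v]) (hα y) w := rfl
  rw [h1, ← (orthonormalBasisOf hy).sum_repr' w, map_sum]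
  refine Finset.sum_congr rfl fun i _ => ?_
  rw [map_smul, (orthonormalBasisOf hy).sum_repr' w, coe_orthonormalBasisOf, smul_eq_mul, mul_comm]
  exact (inner_smul_left (𝕜 := ℝ) _ _ _).symm

/-- The vector field dual to a 1-form `α` is a Killing field if `∇α` is skew-symmetric for some
metric connection `∇` with totally skew-symmetric torsion. -/
theorem isKilling_sharp (hg : IsMetric nabla)
    (hT : ∀ (x : M) (X Y Z : TangentSpace I x),
      torsionTensor nabla x ![X, Y, Z] = -torsionTensor nabla x ![X, Z, Y])
    (hα : ∀ y, IsLinearMap ℝ fun v => α y ![v])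
    (hs : ∀ {x : M} {X : ∀ y : M, TangentSpace I y}, SmoothNear X x →
      FunSmoothNear I (fun y => α y ![X y]) x)
    (hd : ∀ (x : M) (u : TangentSpace I x), HasCovDerivAt nabla α x u (covDeriv nabla α x u))
    (hskew : ∀ (x : M) (u v : TangentSpace I x),
      covDeriv nabla α x u ![v] + covDeriv nabla α x v ![u] = 0) : IsKilling (sharp α) := by
  have hξ : ∀ x, SmoothNear (sharp α) x := fun x => smoothNear_sharp hα hs
  refine ⟨fun x => (hξ x).contMDiffAt, fun x Y Z hY hZ => ?_⟩
  have hY' := hY.mdifferentiableAt (by simp)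
  have hZ' := hZ.mdifferentiableAt (by simp)
  have hξ' := (hξ x).mdifferentiableAt
  have key : ∀ u w : TangentSpace I x,
      inner ℝ (nabla (sharp α) x u) w = covDeriv nabla α x u ![w] := by
    intro u w
    have hW := SmoothNear.extend (I := I) w
    have h1 := (hd x u (fun _ => FiberBundle.extend E w) fun _ => hW).2
    have h2 := hg x u _ _ hξ' hW.mdifferentiableAt
    have h3 : (fun y => inner ℝ (sharp α y) (FiberBundle.extend E w y))
        = fun y => α y fun _ => FiberBundle.extend E w y := by
      ext y
      rw [inner_sharp (hα y)]
      congr 1; ext1 i; fin_cases i; rfl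
    rw [h3, h1, inner_sharp (hα x)] at h2
    simp only [FiberBundle.extend_apply_self, Fin.sum_univ_one] at h2
    have h4 : Function.update (fun _ : Fin 1 => w) 0 (nabla (FiberBundle.extend E w) x u)
        = ![nabla (FiberBundle.extend E w) x u] := by
      ext1 i; fin_cases i; simp
    have h5 : (fun _ : Fin 1 => w) = ![w] := by ext1 i; fin_cases i; rfl
    rw [h4, h5] at h2
    linarith
  have h1 := nabla.torsion_apply hξ' hY'
  have h2 := nabla.torsion_apply hξ' hZ'
  -- After this substitution in `L_ξ g`, the torsion terms cancel by total skewness and the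
  -- symmetric part of `∇α` remains, which is zero.
  have e1 : VectorField.mlieBracket I (sharp α) Y x = nabla Y x (sharp α x)
      - nabla (sharp α) x (Y x) - nabla.torsion x (sharp α x) (Y x) := by rw [h1]; abel
  have e2 : VectorField.mlieBracket I (sharp α) Z x = nabla Z x (sharp α x)
      - nabla (sharp α) x (Z x) - nabla.torsion x (sharp α x) (Z x) := by rw [h2]; abel
  have h3 := hT x (sharp α x) (Y x) (Z x)
  have h4 := hskew x (Y x) (Z x)
  simp only [torsionTensor, Matrix.cons_val_zero, Matrix.cons_val_one, Matrix.cons_val] at h3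
  rw [hg x _ Y Z hY' hZ', e1, e2]
  simp only [inner_sub_left, inner_sub_right, key]
  rw [real_inner_comm (nabla (sharp α) x (Z x)) (Y x), key,
    real_inner_comm (nabla.torsion x (sharp α x) (Z x)) (Y x)]
  linarith

end Killing

/-! ### Curvature of the Levi-Civita connection when the torsion is parallel. -/

section ScalarCurvature

variable {E : Type*} [NormedAddCommGroup E] [NormedSpace ℝ E] [FiniteDimensional ℝ E] [Nontrivial E]
  {H : Type*} [TopologicalSpace H] {I : ModelWithCorners ℝ E H}
  {M : Type*} [TopologicalSpace M] [T2Space M] [ChartedSpace H M] [IsManifold I ∞ M]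
  [RiemannianBundle (fun x : M => TangentSpace I x)]
  [IsContMDiffRiemannianBundle I ∞ E (fun x : M => TangentSpace I x)]
  {nabla D : CovariantDerivative I E (fun x : M => TangentSpace I x)} {x : M}

/-- The torsion of a metric connection as a vector-valued form is parallel if the torsion tensor
is. -/
lemma IsMetric.nabla_torsion (hg : IsMetric nabla) (hs : nabla.ContMDiffCovariantDerivative ∞)
    (hp : IsParallel nabla (torsionTensor nabla)) {Y Z : ∀ y : M, TangentSpace I y}
    (hY : SmoothNear Y x) (hZ : SmoothNear Z x) (u : TangentSpace I x) :
    nabla (fun y => nabla.torsion y (Y y) (Z y)) x u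
      = nabla.torsion x (nabla Y x u) (Z x) + nabla.torsion x (Y x) (nabla Z x u) := by
  refine ext_inner_right ℝ fun w => ?_
  have hW := SmoothNear.extend (I := I) w
  have h1 := hg x u _ _ (hY.torsion hs hZ).mdifferentiableAt hW.mdifferentiableAt
  have h2 := ((hasCovDerivAt_torsionTensor hs u).three hY hZ hW).2
  rw [hp x u] at h2
  simp only [torsionTensor, Matrix.cons_val_zero, Matrix.cons_val_one, Matrix.cons_val] at h2
  rw [h2] at h1
  simp only [FiberBundle.extend_apply_self] at h1
  rw [inner_add_left]
  linarith

/-- The curvature of the Levi-Civita connection in terms of a metric connection with parallel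
skew-symmetric torsion. -/
lemma IsLeviCivita.curvature_eq (hD : IsLeviCivita D) (hg : IsMetric nabla)
    (hs : nabla.ContMDiffCovariantDerivative ∞)
    (hT : ∀ (x : M) (X Y Z : TangentSpace I x),
      torsionTensor nabla x ![X, Y, Z] = -torsionTensor nabla x ![X, Z, Y])
    (hp : IsParallel nabla (torsionTensor nabla)) (u v w : TangentSpace I x) :
    curvature D x u v w = curvature nabla x u v w
      - (1 / 2 : ℝ) • nabla.torsion x (nabla.torsion x u v) w
      + (1 / 4 : ℝ) • (nabla.torsion x u (nabla.torsion x v w)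
        - nabla.torsion x v (nabla.torsion x u w)) := by
  have hU := SmoothNear.extend (I := I) u
  have hV := SmoothNear.extend (I := I) v
  have hW := SmoothNear.extend (I := I) w
  have key : ∀ {V : ∀ y : M, TangentSpace I y}, SmoothNear V x → ∀ u,
      D (fun y => D (FiberBundle.extend E w) y (V y)) x u
        = nabla (fun y => nabla (FiberBundle.extend E w) y (V y)) x u
          - (1 / 2 : ℝ) • (nabla.torsion x (nabla V x u) w
            + nabla.torsion x (V x) (nabla (FiberBundle.extend E w) x u))
          - (1 / 2 : ℝ) • (nabla.torsion x u (nabla (FiberBundle.extend E w) x (V x)))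
          + (1 / 4 : ℝ) • nabla.torsion x u (nabla.torsion x (V x) w) := by
    intro V hV u
    have n1 := hV.nabla hs hW
    have n2 := (hV.torsion hs hW).smul (FunSmoothNear.const (-(1 / 2 : ℝ)))
    have h1 : ∀ᶠ y in 𝓝 x, D (FiberBundle.extend E w) y (V y)
        = ((fun y => nabla (FiberBundle.extend E w) y (V y)) + (fun _ : M => -(1 / 2 : ℝ)) •
          fun y => nabla.torsion y (V y) (FiberBundle.extend E w y)) y := by
      filter_upwards [hW.eventually] with y hy
      rw [hD.apply_eq hg hT hy]
      simp [sub_eq_add_neg]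
    have hcov := nabla.isCovariantDerivativeOn (s := Set.univ)
    have h2 : D (fun y => D (FiberBundle.extend E w) y (V y)) x u = _ := DFunLike.congr_fun
      ((D.isCovariantDerivativeOn (s := Set.univ)).congr_of_eventuallyEq
        ((n1.add n2).congr h1).mdifferentiableAt (n1.add n2).mdifferentiableAt
        Filter.univ_mem h1) u
    rw [h2, hD.apply_eq hg hT (n1.add n2), hcov.add n1.mdifferentiableAt n2.mdifferentiableAt,
      hcov.leibniz (hV.torsion hs hW).mdifferentiableAt mdifferentiableAt_const]
    simp only [_root_.add_apply, _root_.smul_apply, hg.nabla_torsion hs hp hV hW,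
      FiberBundle.extend_apply_self, Pi.add_apply, Pi.smul_apply', map_add, map_smul]
    simp [mvfderiv_const]
    module
  have hb := nabla.torsion_apply hU.mdifferentiableAt hV.mdifferentiableAt
  simp only [FiberBundle.extend_apply_self] at hb
  simp only [curvature]
  rw [key hV, key hU, hD.apply_eq hg hT hW, hb]
  simp only [FiberBundle.extend_apply_self, map_sub, _root_.sub_apply]
  module

/-- The scalar curvature of the Levi-Civita connection in terms of a metric connection with
parallel skew-symmetric torsion. -/
theorem IsLeviCivita.scalarCurvature_eq (hD : IsLeviCivita D) (hg : IsMetric nabla)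
    (hs : nabla.ContMDiffCovariantDerivative ∞)
    (hT : ∀ (x : M) (X Y Z : TangentSpace I x),
      torsionTensor nabla x ![X, Y, Z] = -torsionTensor nabla x ![X, Z, Y])
    (hp : IsParallel nabla (torsionTensor nabla)) (x : M) :
    scalarCurvature D x
      = scalarCurvature nabla x + (1 / 4) * normSq (torsionTensor nabla) x := by
  simp only [scalarCurvature, normSq, Finset.mul_sum, ← Finset.sum_add_distrib]
  refine Finset.sum_congr rfl fun i _ => Finset.sum_congr rfl fun j _ => ?_
  rw [hD.curvature_eq hg hs hT hp, ← Finset.mul_sum]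
  have h1 : ∑ k, torsionTensor nabla x ![frame x i, frame x j, frame x k] ^ 2
      = inner ℝ (nabla.torsion x (frame x i) (frame x j))
        (nabla.torsion x (frame x i) (frame x j)) := by
    rw [← (frame x).sum_inner_mul_inner]
    refine Finset.sum_congr rfl fun k _ => ?_
    rw [real_inner_comm (nabla.torsion x _ _) (frame x k), sq]
    rfl
  -- The terms with coefficients `1/2` and `1/4` contribute `+1/2` and `-1/4` of `|T(eᵢ,eⱼ)|²`.
  have h2 := torsionTensor_torsion (hT x) (frame x i) (frame x j) (frame x j) (frame x i)
  have h3 := torsionTensor_torsion (hT x) (frame x i) (frame x j) (frame x i) (frame x j)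
  have h4 := (isThreeForm_torsionTensor (hT x)).swap₁ (frame x j)
    (nabla.torsion x (frame x i) (frame x j)) (frame x i)
  have h5 := (isThreeForm_torsionTensor (hT x)).swap₂
    (nabla.torsion x (frame x i) (frame x j)) (frame x j) (frame x i)
  simp only [torsionTensor, Matrix.cons_val_zero, Matrix.cons_val_one, Matrix.cons_val] at h2 h3 h4 h5
  simp only [inner_add_left, inner_sub_left, inner_smul_left, nabla.torsion_self, map_zero,
    inner_zero_left, conj_trivial, h1]
  linarith

end ScalarCurvature

/-! ### The (3,0)+(0,3)-projection and vanishing criteria. -/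

section Projection

variable {V : Type*} [NormedAddCommGroup V] [InnerProductSpace ℝ V]

/-- Four times the `(3,0)+(0,3)`-part of a 3-form. -/
lemma IsThreeForm.isTypeThreeZero_proj {J : V →L[ℝ] V} {e : OrthonormalBasis (Fin 6) ℝ V}
    (h : IsAdapted J e) {f : (Fin 3 → V) → ℝ} (hf : IsThreeForm f) :
    IsTypeThreeZero J fun v => f v - f ![J (v 0), J (v 1), v 2] - f ![J (v 0), v 1, J (v 2)]
      - f ![v 0, J (v 1), J (v 2)] := by
  refine ⟨⟨((hf.multilin.sub (IsMultilin.comp_three hf.multilin J J (.id ℝ V))).sub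
    (IsMultilin.comp_three hf.multilin J (.id ℝ V) J)).sub
    (IsMultilin.comp_three hf.multilin (.id ℝ V) J J), fun a b c => ?_, fun a b c => ?_⟩,
    fun a b c => ?_⟩
  · simp only [Matrix.cons_val_zero, Matrix.cons_val_one, Matrix.cons_val]
    rw [hf.swap₁ a, hf.swap₁ (J a) (J b), hf.swap₁ (J a) b, hf.swap₁ a]
    ring
  · simp only [Matrix.cons_val_zero, Matrix.cons_val_one, Matrix.cons_val]
    rw [hf.swap₂ a, hf.swap₂ (J a) (J b), hf.swap₂ (J a) b, hf.swap₂ a (J b)]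
    ring
  · simp only [Matrix.cons_val_zero, Matrix.cons_val_one, Matrix.cons_val, h.sq, hf.neg₁, hf.neg₂]
    ring

lemma IsMultilin.eq_zero_of_sum_sq {ι : Type*} [Fintype ι] (b : OrthonormalBasis ι ℝ V)
    {f : (Fin 3 → V) → ℝ} (hf : IsMultilin f)
    (h : ∑ i, ∑ j, ∑ k, f ![b i, b j, b k] ^ 2 = 0) (v : Fin 3 → V) : f v = 0 := by
  have h0 : ∀ i j k, f ![b i, b j, b k] = 0 := by
    intro i j k
    have h1 := (Finset.sum_eq_zero_iff_of_nonneg fun i _ => by positivity).1 h i (Finset.mem_univ _)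
    have h2 := (Finset.sum_eq_zero_iff_of_nonneg fun j _ => by positivity).1 h1 j (Finset.mem_univ _)
    have h3 := (Finset.sum_eq_zero_iff_of_nonneg fun k _ => by positivity).1 h2 k (Finset.mem_univ _)
    exact pow_eq_zero_iff two_ne_zero |>.1 h3
  have hv : v = ![v 0, v 1, v 2] := by ext1 i; fin_cases i <;> rfl
  rw [hv]
  exact IsLinearMap.eq_zero_of_basis b (IsMultilin.linear_zero hf _ _) (fun i =>
    IsLinearMap.eq_zero_of_basis b (IsMultilin.linear_one hf _ _) (fun j =>
      IsLinearMap.eq_zero_of_basis b (IsMultilin.linear_two hf _ _) (fun k => h0 i j k) _) _) _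

end Projection

section Zero

variable {E : Type*} [NormedAddCommGroup E] [NormedSpace ℝ E]
  {H : Type*} [TopologicalSpace H] {I : ModelWithCorners ℝ E H}
  {M : Type*} [TopologicalSpace M] [ChartedSpace H M] [IsManifold I ∞ M]
  {nabla : CovariantDerivative I E (fun x : M => TangentSpace I x)}

lemma covDeriv_eq_zero {k : ℕ} {A : ∀ x : M, (Fin k → TangentSpace I x) → ℝ}
    (hA : ∀ x v, A x v = 0) (x : M) (u : TangentSpace I x) (v : Fin k → TangentSpace I x) :
    covDeriv nabla A x u v = 0 := by
  simp [covDeriv, hA, mvfderiv_const]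

end Zero

/-! ### Consequences for almost Calabi–Yau manifolds with torsion. -/

variable {M : Type*} [TopologicalSpace M] [T2Space M]
  [ChartedSpace (EuclideanSpace ℝ (Fin 6)) M] [IsManifold (𝓡 6) ∞ M]
  [RiemannianBundle (fun x : M => TangentSpace (𝓡 6) x)]
  [IsContMDiffRiemannianBundle (𝓡 6) ∞ (EuclideanSpace ℝ (Fin 6))
    (fun x : M => TangentSpace (𝓡 6) x)]
  {S : SU3Structure M}
  {nabla D : CovariantDerivative (𝓡 6) (EuclideanSpace ℝ (Fin 6))
    (fun x : M => TangentSpace (𝓡 6) x)} {x : M}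

namespace SU3Structure.IsACYT

variable (h : S.IsACYT nabla)
include h

lemma isThreeForm (x : M) : IsThreeForm (torsionTensor nabla x) :=
  isThreeForm_torsionTensor (h.skew_torsion x)

lemma isLinearMap_JLeeForm (hD : IsLeviCivita D) (x : M) :
    IsLinearMap ℝ fun v => S.JLeeForm D x ![v] := by
  simp only [h.JLeeForm_eq hD, Matrix.cons_val_zero]
  exact IsLinearMap.const_mul (IsLinearMap.finset_sum fun i =>
    IsMultilin.linear_zero (isMultilin_torsionTensor x) _ _) _

lemma JLeeForm_smooth (hD : IsLeviCivita D) {X : ∀ y : M, TangentSpace (𝓡 6) y}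
    (hX : SmoothNear X x) : FunSmoothNear (𝓡 6) (fun y => S.JLeeForm D y ![X y]) x := by
  obtain ⟨e, he, ho⟩ := exists_orthonormal_frame (I := 𝓡 6) x
  refine ((FunSmoothNear.const (-(1 / 2 : ℝ))).mul (FunSmoothNear.sum (s := Finset.univ)
    fun i _ => torsionTensor_smooth h.smooth hX (he i) (smoothNear_J (S := S) (he i)))).congr ?_
  filter_upwards [ho] with y hy
  have hm := isMultilin_torsionTensor (nabla := nabla) y
  have := sum_bilin_eq (frame y) (orthonormalBasisOf hy)
    (B := fun a b => torsionTensor nabla y ![X y, a, S.J y b])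
    (fun w => hm.linear_one _ _)
    (fun w => (IsMultilin.comp_three hm (.id ℝ _) (.id ℝ _) (S.J y)).linear_two _ _)
  simp only [coe_orthonormalBasisOf] at this
  rw [h.JLeeForm_eq hD]
  exact congrArg (fun s => -(1 / 2) * s) this

lemma hasCovDerivAt_JLeeForm' (hD : IsLeviCivita D) (x : M) (u : TangentSpace (𝓡 6) x) :
    HasCovDerivAt nabla (S.JLeeForm D) x u (covDeriv nabla (S.JLeeForm D) x u) := by
  have h1 := h.hasCovDerivAt_JLeeForm hD (h.hasCovDerivAt_torsion u)
  convert h1 using 1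
  ext v
  exact h1.covDeriv_eq v

lemma covDeriv_leeForm (hD : IsLeviCivita D) (u v : TangentSpace (𝓡 6) x) :
    covDeriv nabla (S.leeForm D) x u ![v] = covDeriv nabla (S.JLeeForm D) x u ![S.J x v] :=
  (h.hasCovDerivAt_leeForm hD (h.hasCovDerivAt_JLeeForm' hD x u)).covDeriv_eq ![v]

variable (hR : CurvaturePairSymmetric nabla)
include hR

lemma isFourForm (x : M) : IsFourForm fun u a b c : TangentSpace (𝓡 6) x =>
    covDeriv nabla (torsionTensor nabla) x u ![a, b, c] :=
  isFourForm_covDeriv_torsionTensor h.parallel_metric h.smooth h.skew_torsion hR x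

/-- Each complex line is counted twice in the trace, which absorbs the factor `1/2` of
`JLeeForm_eq`. The contraction of the 4-form `∇T` with `F` appears. -/
lemma covDeriv_JLeeForm (hD : IsLeviCivita D) {e : OrthonormalBasis (Fin 6) ℝ (TangentSpace (𝓡 6) x)}
    (he : IsAdapted (S.J x) e) (u v : TangentSpace (𝓡 6) x) :
    covDeriv nabla (S.JLeeForm D) x u ![v]
      = -(covDeriv nabla (torsionTensor nabla) x u ![v, e 0, e 1]
        + covDeriv nabla (torsionTensor nabla) x u ![v, e 2, e 3]
        + covDeriv nabla (torsionTensor nabla) x u ![v, e 4, e 5]) := by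
  have hA := h.isFourForm hR x
  rw [(h.hasCovDerivAt_JLeeForm hD (h.hasCovDerivAt_torsion u)).covDeriv_eq]
  have := he.sum_contraction (frame x)
    (B := fun a b => covDeriv nabla (torsionTensor nabla) x u ![v, a, b])
    (fun w => hA.linear₃ u v w) (fun w => hA.linear₄ u v w) (fun a b => hA.swap₃ u v a b)
  simp only [Matrix.cons_val_zero, this]
  ring

lemma covDeriv_JLeeForm_skew (hD : IsLeviCivita D) (u v : TangentSpace (𝓡 6) x) :
    covDeriv nabla (S.JLeeForm D) x u ![v] + covDeriv nabla (S.JLeeForm D) x v ![u] = 0 := by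
  obtain ⟨e, he, -⟩ := h.exists_adapted (x := x)
  have hA := h.isFourForm hR x
  rw [h.covDeriv_JLeeForm hR hD he, h.covDeriv_JLeeForm hR hD he]
  linarith [hA.swap₁ u v (e 0) (e 1), hA.swap₁ u v (e 2) (e 3), hA.swap₁ u v (e 4) (e 5)]

lemma covDeriv_JLeeForm_neg (hD : IsLeviCivita D) (u v : TangentSpace (𝓡 6) x) :
    covDeriv nabla (S.JLeeForm D) x u ![-v] = -covDeriv nabla (S.JLeeForm D) x u ![v] := by
  obtain ⟨e, he, -⟩ := h.exists_adapted (x := x)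
  have hA := h.isFourForm hR x
  rw [h.covDeriv_JLeeForm hR hD he, h.covDeriv_JLeeForm hR hD he, hA.neg₂, hA.neg₂, hA.neg₂]
  ring

/-- If `∇N = 0`, then `∇Jθ` is of type `(1,1)`. -/
lemma covDeriv_JLeeForm_J (hD : IsLeviCivita D) (hN : IsParallel nabla S.N)
    (u v : TangentSpace (𝓡 6) x) :
    covDeriv nabla (S.JLeeForm D) x (S.J x u) ![S.J x v]
      = covDeriv nabla (S.JLeeForm D) x u ![v] := by
  obtain ⟨e, he, -⟩ := h.exists_adapted (x := x)
  have hA := h.isFourForm hR x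
  -- Write out `(∇_a N)(Ja, u, v) = 0`: two of its terms repeat `a`, and the others say that `∇T(a,
  -- Ja, ·, ·)` is `J`-invariant.
  have key : ∀ a, covDeriv nabla (torsionTensor nabla) x (S.J x u) ![S.J x v, a, S.J x a]
      = covDeriv nabla (torsionTensor nabla) x u ![v, a, S.J x a] := by
    intro a
    have h1 := (h.hasCovDerivAt_N (h.hasCovDerivAt_torsion a)).covDeriv_eq ![S.J x a, u, v]
    rw [hN] at h1
    simp only [Matrix.cons_val_zero, Matrix.cons_val_one, Matrix.cons_val, S.J_J, hA.neg₂,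
      hA.self₁₂] at h1
    rw [hA.pair_swap (S.J x u), hA.pair_swap u]
    linarith
  rw [h.covDeriv_JLeeForm hR hD he, h.covDeriv_JLeeForm hR hD he, ← he.apply_zero, ← he.apply_two,
    ← he.apply_four, key, key, key]

/-- If the norm of the Nijenhuis tensor is constant, then the Nijenhuis tensor is parallel. -/
theorem isParallel_N {c : ℝ} (hc : ∀ x : M, normSq S.N x = c) : IsParallel nabla S.N := by
  have hN : ∀ y, IsTypeThreeZero (S.J y) (S.N y) := by
    intro y
    obtain ⟨e, he, -⟩ := h.exists_adapted (x := y)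
    have := (h.isThreeForm y).isTypeThreeZero_proj he
    rwa [← funext h.N_eq] at this
  intro x u v
  by_cases hc0 : c = 0
  · exact covDeriv_eq_zero (fun y => (hN y).multilin.eq_zero_of_sum_sq (frame y)
      ((hc y).trans hc0)) x u v
  obtain ⟨e, he, -⟩ := h.exists_adapted (x := x)
  have hA := h.isFourForm hR x
  have hB := fun u : TangentSpace (𝓡 6) x => h.hasCovDerivAt_N (h.hasCovDerivAt_torsion u)
  have horth := fun u : TangentSpace (𝓡 6) x =>
    ((hB u).normSq h.parallel_metric fun y => (hN y).multilin).2
  have hconst : normSq S.N = fun _ => c := funext hc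
  simp only [hconst, mvfderiv_const, _root_.zero_apply] at horth
  have horth' := fun u => (mul_eq_zero.1 (horth u).symm).resolve_left two_ne_zero
  have hty := (isThreeForm_covDeriv_torsionTensor h.smooth h.skew_torsion u).isTypeThreeZero_proj he
  -- Orthogonality in the direction `Ju` is, by `fourForm_proj_J`, orthogonality of `(∇_u
  -- N)(J·,·,·)` to `N`: the second condition needed on a complex line.
  have h2 := horth' (S.J x u)
  simp only [Matrix.cons_val_zero, Matrix.cons_val_one, Matrix.cons_val,
    he.fourForm_proj_J hA] at h2
  have h3 := (hN x).eq_zero_of_orthogonal hty he (frame x) (horth' u) (by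
    simp only [neg_mul, Finset.sum_neg_distrib, neg_eq_zero] at h2
    simpa only [Matrix.cons_val_zero, Matrix.cons_val_one, Matrix.cons_val] using h2)
    (by rw [← normSq, hc]; exact hc0) (v 0) (v 1) (v 2)
  rw [(hB u).covDeriv_eq, ← h3]
  congr 3

/-! ### Vanishing Lee form: parallel torsion and scalar curvature. -/

section Balanced

variable (hD : IsLeviCivita D) (hθ : ∀ (x : M) (X : TangentSpace (𝓡 6) x), S.leeForm D x ![X] = 0)
include hD hθ

lemma JLeeForm_eq_zero (x : M) (v : Fin 1 → TangentSpace (𝓡 6) x) : S.JLeeForm D x v = 0 := by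
  rw [JLeeForm, hθ, neg_zero]

/-- If the Lee form vanishes, then the torsion is parallel. -/
theorem isParallel_torsionTensor : IsParallel nabla (torsionTensor nabla) := by
  intro x u v
  obtain ⟨e, he, -⟩ := h.exists_adapted (x := x)
  have hv : v = ![v 0, v 1, v 2] := by ext1 i; fin_cases i <;> rfl
  rw [hv]
  refine he.fourForm_eq_zero_of_contraction (h.isFourForm hR x) (fun a b => ?_) _ _ _ _
  have := h.covDeriv_JLeeForm hR hD he a b
  rw [covDeriv_eq_zero (JLeeForm_eq_zero h hR hD hθ)] at this
  linarith

/-- Once `∇T = 0`, the Bianchi identity contains only quadratic torsion terms, and `θ = 0` supplies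
the vanishing trace of `T`. -/
lemma scalarCurvature_eq_neg (x : M) : scalarCurvature nabla x
    = -∑ i, ∑ j, ∑ k, torsionTensor nabla x ![frame x i, frame x j, frame x k]
      * torsionTensor nabla x ![S.J x (frame x i), S.J x (frame x j), frame x k] := by
  obtain ⟨e, he, htr⟩ := h.exists_adapted (x := x)
  have hsk := fun u v w z : TangentSpace (𝓡 6) x =>
    h.parallel_metric.curvature_skew h.smooth u v w z
  have hlin : ∀ y z w : TangentSpace (𝓡 6) x,
      IsLinearMap ℝ fun v => inner ℝ (curvature nabla x y z w) v := fun y z w =>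
    ⟨fun a b => inner_add_right _ _ _, fun r a => inner_smul_right _ _ _⟩
  have hlin₃ : ∀ y z w : TangentSpace (𝓡 6) x,
      IsLinearMap ℝ fun v => inner ℝ (curvature nabla x y z v) w := by
    intro y z w
    simp only [hsk y z _ w]
    exact ⟨fun a b => by rw [inner_add_right]; ring, fun r a => by rw [inner_smul_right]; simp⟩
  refine (h.isThreeForm x).sum_curvature he (frame x)
    (R := fun u v w z => inner ℝ (curvature nabla x u v w) z) (fun y z w => ?_) hlin hsk
    h.curvature_J (fun u v => ?_) (fun u v w z => ?_) (fun v => ?_)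
  -- Pair symmetry carries the first argument to the third, where linearity comes from skewness.
  · simp only [hR x _ y z w]
    exact hlin₃ z w y
  · rw [he.sum_contraction (frame x) (B := fun w z => inner ℝ (curvature nabla x u v w) z)
      (fun w => hlin₃ u v w) (hlin u v) (hsk u v), htr, mul_zero]
  · have hp := h.isParallel_torsionTensor hR hD hθ
    have hin : ∀ a b c d : TangentSpace (𝓡 6) x,
        torsionTensor nabla x ![nabla.torsion x a b, c, d]
          = ∑ k, torsionTensor nabla x ![a, b, frame x k] * torsionTensor nabla x ![c, d, frame x k] := by
      intro a b c d
      rw [torsionTensor_torsion (h.skew_torsion x), ← (frame x).sum_inner_mul_inner]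
      refine Finset.sum_congr rfl fun k _ => ?_
      rw [real_inner_comm (nabla.torsion x c d) (frame x k)]
      rfl
    rw [bianchi h.parallel_metric h.smooth, hp, hp, hp, hin, hin, hin]
    ring
  · have h1 := h.JLeeForm_eq hD ![v]
    rw [JLeeForm_eq_zero h hR hD hθ] at h1
    simp only [(h.isThreeForm x).swap₂ _ _ v, (h.isThreeForm x).swap₁ _ v, neg_neg]
    simp only [Matrix.cons_val_zero] at h1
    linarith

/-- Both right sides equal `t/4 - q`. The second involves only norms of tensors whose parallelism is
at hand, and serves to prove constancy. -/
lemma scalarCurvature_eq (x : M) : scalarCurvature D x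
      = -(1 / 12) * normSq S.dFPlus x + (5 / 64) * normSq S.N x ∧
    scalarCurvature D x
      = -(1 / 12) * normSq (torsionTensor nabla) x + (1 / 12) * normSq S.N x := by
  obtain ⟨e, he, -⟩ := h.exists_adapted (x := x)
  have h1 := hD.scalarCurvature_eq h.parallel_metric h.smooth h.skew_torsion
    (h.isParallel_torsionTensor hR hD hθ) x
  have h2 := h.scalarCurvature_eq_neg hR hD hθ x
  have h3 := (h.isThreeForm x).sum_sq_proj he (frame x)
  have h4 := (h.isThreeForm x).sum_sq_plus he (frame x)
  rw [h1, h2]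
  simp only [normSq, h.N_eq, h.dFPlus_eq, Matrix.cons_val_zero, Matrix.cons_val_one,
    Matrix.cons_val]
  rw [h3, h4]
  constructor <;> ring

/-- If the Lee form vanishes, then the scalar curvature is locally constant. -/
theorem scalarCurvature_eq_of_mem_connectedComponent {x y : M} (hy : y ∈ connectedComponent x) :
    scalarCurvature D y = scalarCurvature D x := by
  have hA : ∀ (x : M) (u : TangentSpace (𝓡 6) x),
      HasCovDerivAt nabla (torsionTensor nabla) x u fun _ => 0 := by
    intro x u
    convert h.hasCovDerivAt_torsion u using 1
    exact (funext (h.isParallel_torsionTensor hR hD hθ x u)).symm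
  have hT : ∀ y, IsMultilin (torsionTensor nabla y) := isMultilin_torsionTensor
  have hN : ∀ y, IsMultilin (S.N y) := by
    intro y
    obtain ⟨e, he, -⟩ := h.exists_adapted (x := y)
    have := ((h.isThreeForm y).isTypeThreeZero_proj he).multilin
    rwa [← funext h.N_eq] at this
  rw [(h.scalarCurvature_eq hR hD hθ x).2, (h.scalarCurvature_eq hR hD hθ y).2,
    eq_of_mvfderiv_eq_zero (I := 𝓡 6)
      (fun z => ((hA z 0).normSq h.parallel_metric hT).1)
      (fun z u => by rw [((hA z u).normSq h.parallel_metric hT).2]; simp) hy,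
    eq_of_mvfderiv_eq_zero (I := 𝓡 6)
      (fun z => ((h.hasCovDerivAt_N (hA z 0)).normSq h.parallel_metric hN).1)
      (fun z u => by rw [((h.hasCovDerivAt_N (hA z u)).normSq h.parallel_metric hN).2]; simp) hy]

end Balanced
end SU3Structure.IsACYT

end

end ACYT

/-! ### The main theorem. -/

theorem mainTheorem9 {M : Type*} [TopologicalSpace M] [T2Space M]
    [ChartedSpace (EuclideanSpace ℝ (Fin 6)) M] [IsManifold (𝓡 6) ∞ M]
    [RiemannianBundle (fun x : M => TangentSpace (𝓡 6) x)]
    [IsContMDiffRiemannianBundle (𝓡 6) ∞ (EuclideanSpace ℝ (Fin 6))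
      (fun x : M => TangentSpace (𝓡 6) x)]
    (S : ACYT.SU3Structure M)
    (nabla : CovariantDerivative (𝓡 6) (EuclideanSpace ℝ (Fin 6))
      (fun x : M => TangentSpace (𝓡 6) x))
    (hnabla : S.IsACYT nabla)
    (D : CovariantDerivative (𝓡 6) (EuclideanSpace ℝ (Fin 6))
      (fun x : M => TangentSpace (𝓡 6) x))
    (hD : ACYT.IsLeviCivita D)
    (hR : ACYT.CurvaturePairSymmetric nabla) :
    -- the covariant derivative of `Jθ` is skew-symmetric, and its dual vector field is Killing
    (∀ (x : M) (X Y : TangentSpace (𝓡 6) x),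
      ACYT.covDeriv nabla (S.JLeeForm D) x X ![Y]
        + ACYT.covDeriv nabla (S.JLeeForm D) x Y ![X] = 0) ∧
    (∀ (x : M) (X Y : TangentSpace (𝓡 6) x),
      ACYT.covDeriv nabla (S.leeForm D) x X ![S.J x Y]
        = -ACYT.covDeriv nabla (S.leeForm D) x Y ![S.J x X]) ∧
    ACYT.IsKilling (ACYT.sharp (S.JLeeForm D)) ∧
    -- the case where the Nijenhuis tensor has constant norm
    ((∃ c : ℝ, ∀ x : M, ACYT.normSq S.N x = c) →
      ACYT.IsParallel nabla S.N ∧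
      ∀ (x : M) (X Y : TangentSpace (𝓡 6) x),
        ACYT.covDeriv nabla (S.leeForm D) x X ![Y]
          = ACYT.covDeriv nabla (S.leeForm D) x Y ![X] ∧
        ACYT.covDeriv nabla (S.leeForm D) x X ![Y]
          = ACYT.covDeriv nabla (S.leeForm D) x (S.J x X) ![S.J x Y]) ∧
    -- the case where the Lee form vanishes
    ((∀ (x : M) (X : TangentSpace (𝓡 6) x), S.leeForm D x ![X] = 0) →
      ACYT.IsParallel nabla (ACYT.torsionTensor nabla) ∧
      ACYT.IsParallel nabla S.dF ∧
      ACYT.IsParallel nabla S.N ∧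
      (∀ x : M, ACYT.scalarCurvature D x
        = -(1 / 12) * ACYT.normSq S.dFPlus x + (5 / 64) * ACYT.normSq S.N x) ∧
      ∀ x : M, ∀ y ∈ connectedComponent x,
        ACYT.scalarCurvature D y = ACYT.scalarCurvature D x) := by
  refine ⟨fun x X Y => hnabla.covDeriv_JLeeForm_skew hR hD X Y, fun x X Y => ?_, ?_, ?_, ?_⟩
  · have h1 := hnabla.covDeriv_JLeeForm_skew hR hD X Y
    rw [hnabla.covDeriv_leeForm hD, hnabla.covDeriv_leeForm hD, S.J_J, S.J_J,
      hnabla.covDeriv_JLeeForm_neg hR hD, hnabla.covDeriv_JLeeForm_neg hR hD]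
    linarith
  · exact ACYT.isKilling_sharp hnabla.parallel_metric hnabla.skew_torsion
      (hnabla.isLinearMap_JLeeForm hD) (hnabla.JLeeForm_smooth hD)
      (hnabla.hasCovDerivAt_JLeeForm' hD) fun x X Y => hnabla.covDeriv_JLeeForm_skew hR hD X Y
  · rintro ⟨c, hc⟩
    have hN := hnabla.isParallel_N hR hc
    -- `(∇_X θ)Y = (∇_X Jθ)(JY)`; type (1,1) allows `J` to be applied to both arguments, and `J² =
    -- -1` gives the sign.
    have hJ : ∀ (x : M) (X Y : TangentSpace (𝓡 6) x),
        ACYT.covDeriv nabla (S.leeForm D) x X ![Y]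
          = -ACYT.covDeriv nabla (S.JLeeForm D) x (S.J x X) ![Y] := by
      intro x X Y
      rw [hnabla.covDeriv_leeForm hD, ← hnabla.covDeriv_JLeeForm_J hR hD hN, S.J_J,
        hnabla.covDeriv_JLeeForm_neg hR hD]
    refine ⟨hN, fun x X Y => ⟨?_, ?_⟩⟩
    · rw [hJ, hnabla.covDeriv_leeForm hD]
      linarith [hnabla.covDeriv_JLeeForm_skew hR hD (S.J x X) Y]
    · rw [hnabla.covDeriv_leeForm hD, hnabla.covDeriv_leeForm hD,
        hnabla.covDeriv_JLeeForm_J hR hD hN]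
  · intro hθ
    have hT := hnabla.isParallel_torsionTensor hR hD hθ
    refine ⟨hT, fun x u v => ?_, fun x u v => ?_, fun x => (hnabla.scalarCurvature_eq hR hD hθ x).1,
      fun x y hy => hnabla.scalarCurvature_eq_of_mem_connectedComponent hR hD hθ hy⟩
    · rw [(hnabla.hasCovDerivAt_dF (hnabla.hasCovDerivAt_torsion u)).covDeriv_eq]
      simp [hT x u]
    · rw [(hnabla.hasCovDerivAt_N (hnabla.hasCovDerivAt_torsion u)).covDeriv_eq]
      simp [hT x u]
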